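/- **Theorem (Canonical SCM to MAC laminations).** Let $d\ge 2$, let $\mathbb S=\mathbb R/\mathbb Z$ and $\sigma_d(t)=dt \pmod 1$. *Conventions.* The length $|\overline{ab}|\le \tfrac12$ of a chord is the length of the shorter arc it subtends. Chords *cross* if they meet in the open disk without being equal. A *lamination* is a set of pairwise non-crossing nondegenerate chords (leaves) of the closed disk whose union with $\mathbb S$ is closed; the points of $\mathbb S$ count as degenerate leaves, and closures of sets of leaves are taken within the nondegenerate chords. It is *$d$-invariant* if it is forward invariant (up to degenerate images), backward invariant and sibling invariant (each leaf with nondegenerate image is one of $d$ pairwise disjoint leaves with this image), if its equivalence classes (points joined by finite chains of leaves) are finite, and if all its leaves are boundary chords of convex hulls of classes. A polygon is given by its finite vertex set; leaves are polygons with two vertices. A polygon $P$ is *identity return* if for some $n\ge1$ the polygons $P,\sigma_d(P),\dots,\sigma_d^{n-1}(P)$ are pairwise disjoint, $\sigma_d^n|_P=\mathrm{id}$ and $\sigma_d$ preserves circular order on every $\sigma_d^i(P)$; it is *rotational* if $\sigma_d$ maps $P$ onto itself preserving circular order with nonzero rotation number. A *critical portrait* is a finite set of non-crossing critical chords (both endpoints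 have the same image) cutting the disk into sectors (apart from all critical polygons, whose vertices all have the same image) whose boundaries map to $\mathbb S$ with degree one. A sector is *maximal* if its boundary contains every chord of the portrait, where for the sides of an all critical polygon formed by chords of the portrait one side suffices. *Pulling back* a forward invariant set $F$ of leaves with respect to critical chords $C$ which no leaf of $F$ crosses means: choose one branch $\tau_i$ of $\sigma_d^{-1}$ into each of the $d$ sectors of $C$, with disjoint images and such that each $\ell\in F$ equals $\tau_i(\sigma_d(\ell))$ for some $i$; put $F_0=F$, $F_{n+1}=F_n\cup\bigcup_i\tau_i(F_n)$, $F_\infty=\bigcup_n F_n$; the result is $\overline{F_\infty}$. *MAC.* A *MAC leaf* is a nondegenerate periodic leaf $M$ whose orbit is non-crossing and is not crossed by the sides of some all critical $d$-gon, and whose length is closest to $\frac1d$ in its orbit. If the orbit of $M$ is pulled back with respect to an all critical $d$-gon having an endpoint of $M$ as a vertex and the result $\mathcal L$ is a $d$-invariant lamination, $\mathcal L$ is the (canonical) *MAC lamination* $\mathcal L(M)$ of $M$. *SCM.* A periodic polygon $P$ is *SCM* if some $P_j=\sigma_d^j(P)$ lies in a maximal sector $T$ of some critical portrait and, for each side $s$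 of $P_j$ and each $i$ such that $\sigma_d^{i}(P_j)\not\subset T$, the length of $\sigma_d^i(s)$ is not closer to $\frac1d$ than that of $s$. Let $P$ be an SCM polygon with a chain of $d-1$ adjacent sides, joining consecutive vertices $v_0,v_1,\dots,v_{d-1}$, which are $d-1$ longest sides of $P$, and let $C$ be a critical portrait consisting of $d-1$ critical chords, one under each of these sides (on the side opposite to $P$) and touching one of its endpoints, such that $P$ lies in a maximal sector of $C$. If the orbit of (the sides of) $P$ is pulled back with respect to $C$ and the result $\mathcal S$ is a $d$-invariant lamination, $\mathcal S$ is a *canonical SCM lamination* of $P$. *Statement.* Let $\mathcal S$ be a canonical SCM lamination of $P$, where $P$ is either an identity return $d$-gon, or a rotational $k(d-1)$-gon whose vertices all have least period $k$. Then there is a unique pair $(M,\mathcal L)$ such that $M$ is a MAC leaf, $\mathcal L$ is its MAC lamination $\mathcal L(M)$ (in particular a $d$-invariant lamination), and 1. if $P$ is identity return, $M$ is the shortest side of $P$, strictly shorter than all other sides; 2. if $P$ is rotational, $M$ joins two vertices of $P$ and, for $d\ge3$, runs through the interior of $P$, i.e. is not a side of $P$. Moreover $M=\overline{v_0v_{d-1}}$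 joins the two ends of the chain of $d-1$ longest sides, and $\mathcal L$ is obtained from $\mathcal S$ by adding all pullbacks (by the same branches $\tau_i$) of the orbit of $M$, removing the grand orbit $\{\ell : \sigma_d^n(\ell)=\sigma_d^m(s)\text{ for some } n,m\ge 0 \text{ and some side } s\ne M \text{ of } P\}$, except for leaves in the grand orbit of $M$, and taking the closure. -/

import Mathlib

open Set Function

noncomputable section

namespace Lam

/-- The circle `ℝ/ℤ`, with its circular (counterclockwise) order and arc-length metric. -/
abbrev Circ : Type := UnitAddCircle

/-- A chord of the closed unit disk, as the unordered pair of its endpoints. Chords with equal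
endpoints are the degenerate ones, i.e. the points of the circle. -/
abbrev Chord : Type := Sym2 Circ

/-- The map `t ↦ d t (mod 1)`. -/
def sigma (d : ℕ) (x : Circ) : Circ := d • x

/-- The `n`-th image of a chord. -/
def chordIter (d n : ℕ) (e : Chord) : Chord := Sym2.map ((sigma d)^[n]) e

/-- The length of a chord: the shorter one of the two arcs that it subtends (at most `1/2`). -/
def chordLength : Chord → ℝ :=
  Sym2.lift ⟨fun x y => ‖x - y‖, fun x y => norm_sub_rev x y⟩

/-- Distance of the length of a chord from the critical length `1/d`. -/
def critDist (d : ℕ) (e : Chord) : ℝ := |chordLength e - 1 / (d : ℝ)|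

/-- Two chords cross: they meet in the open disk without being equal. -/
def Crosses (e f : Chord) : Prop :=
  ∃ a b x y : Circ, e = s(a, b) ∧ f = s(x, y) ∧ sbtw a x b ∧ sbtw b y a

/-- Two chords are disjoint in the closed disk. -/
def ChordsDisjoint (e f : Chord) : Prop :=
  (∀ x, x ∈ e → x ∉ f) ∧ ¬ Crosses e f

/-- Closure of a set of chords, within the nondegenerate chords. -/
def chordClosure (L : Set Chord) : Set Chord :=
  {e | ∃ x y : Circ, x ≠ y ∧ e = s(x, y) ∧ (x, y) ∈ closure {p : Circ × Circ | s(p.1, p.2) ∈ L}}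

/-! ### Polygons, given by their finite vertex sets -/

/-- `y` is the vertex of `P` that follows `x` counterclockwise. -/
def Consecutive (P : Set Circ) (x y : Circ) : Prop :=
  x ∈ P ∧ y ∈ P ∧ x ≠ y ∧ ∀ z ∈ P, ¬ sbtw x z y

/-- `e` is a boundary chord of the convex hull of `P`. -/
def IsSide (P : Set Circ) (e : Chord) : Prop :=
  ∃ x y : Circ, Consecutive P x y ∧ e = s(x, y)

/-- The set of the sides of `P`. -/
def sides (P : Set Circ) : Set Chord := {e | IsSide P e}

/-- `e` joins two different vertices of `P`. -/
def IsChordOf (P : Set Circ) (e : Chord) : Prop :=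
  ∃ x ∈ P, ∃ y ∈ P, x ≠ y ∧ e = s(x, y)

/-- The convex hulls of `A` and `B` are disjoint. -/
def HullsDisjoint (A B : Set Circ) : Prop :=
  Disjoint A B ∧ ∀ e f : Chord, IsChordOf A e → IsChordOf B f → ¬ Crosses e f

/-- `σ_d` preserves the circular order of the points of `A`. -/
def PreservesOrder (d : ℕ) (A : Set Circ) : Prop :=
  ∀ a ∈ A, ∀ b ∈ A, ∀ c ∈ A, sbtw a b c → sbtw (sigma d a) (sigma d b) (sigma d c)

/-- Identity return polygon (or leaf). The number `n` is its period: the `n` polygons of the orbit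
are pairwise disjoint, hence different. -/
def IsIdentityReturn (d : ℕ) (P : Set Circ) : Prop :=
  2 ≤ P.ncard ∧ ∃ n : ℕ, 0 < n ∧
    (∀ i j : ℕ, i < j → j < n → HullsDisjoint ((sigma d)^[i] '' P) ((sigma d)^[j] '' P)) ∧
    (∀ x ∈ P, (sigma d)^[n] x = x) ∧
    ∀ i : ℕ, PreservesOrder d ((sigma d)^[i] '' P)

/-- Rotational polygon (or leaf): mapped to itself preserving circular order. The rotation number
is nonzero exactly when no vertex is fixed. -/
def IsRotational (d : ℕ) (P : Set Circ) : Prop :=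
  2 ≤ P.ncard ∧ sigma d '' P = P ∧ PreservesOrder d P ∧ ∀ x ∈ P, sigma d x ≠ x

/-! ### Invariant laminations

A lamination is given by its set of nondegenerate leaves; every point of the circle counts as a
degenerate leaf. -/

/-- Lamination: no two leaves cross, and the union of the leaves and the circle is closed. (For
sets of non-crossing chords the latter says that a nondegenerate limit of leaves is a leaf.) -/
structure IsLamination (L : Set Chord) : Prop where
  nondegenerate : ∀ e ∈ L, ¬ e.IsDiag
  noncrossing : ∀ e ∈ L, ∀ f ∈ L, ¬ Crosses e f
  closed : chordClosure L ⊆ L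

/-- The equivalence class of `x`: the points joined to `x` by a finite concatenation of leaves. -/
def leafClass (L : Set Chord) (x : Circ) : Set Circ :=
  {y | Relation.ReflTransGen (fun u w => s(u, w) ∈ L) x y}

/-- Sibling `d`-invariant lamination with finite equivalence classes, all of whose leaves are
boundary chords of the convex hulls of equivalence classes. -/
structure IsInvariantLamination (d : ℕ) (L : Set Chord) : Prop where
  isLamination : IsLamination L
  forward_invariant : ∀ e ∈ L, (chordIter d 1 e).IsDiag ∨ chordIter d 1 e ∈ L
  backward_invariant : ∀ e ∈ L, ∃ f ∈ L, chordIter d 1 f = e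
  sibling_invariant : ∀ e ∈ L, ¬ (chordIter d 1 e).IsDiag →
    ∃ f : Fin d → Chord, (∃ i, f i = e) ∧ (∀ i, f i ∈ L) ∧
      (∀ i, chordIter d 1 (f i) = chordIter d 1 e) ∧
      ∀ i j, i ≠ j → ChordsDisjoint (f i) (f j)
  finite_classes : ∀ x, (leafClass L x).Finite
  boundary_leaves : ∀ x y : Circ, s(x, y) ∈ L → IsSide (leafClass L x) s(x, y)

/-- The grand orbit of a set of chords. -/
def grandOrbit (d : ℕ) (X : Set Chord) : Set Chord :=
  {e | ∃ f ∈ X, ∃ n k : ℕ, chordIter d n e = chordIter d k f}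

/-- The forward orbit of a set of chords. -/
def forwardOrbit (d : ℕ) (X : Set Chord) : Set Chord :=
  {e | ∃ f ∈ X, ∃ k : ℕ, e = chordIter d k f}

/-! ### Critical portraits and pullbacks -/

/-- Critical chord: its endpoints are different and have the same image. -/
def IsCritical (d : ℕ) (c : Chord) : Prop :=
  ¬ c.IsDiag ∧ (chordIter d 1 c).IsDiag

/-- The endpoints of the chords in `C`. -/
def vertices (C : Set Chord) : Set Circ := {x | ∃ c ∈ C, x ∈ c}

/-- For `t` outside `vertices C`: the points of the circle in the closed region, cut out of the disk
by the chords in `C`, that has `t` in its boundary. -/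
def sector (C : Set Chord) (t : Circ) : Set Circ :=
  {x | ∀ c ∈ C, ¬ Crosses c s(t, x)}

/-- Critical portrait: finitely many non-crossing critical chords, sufficiently many to cut the disk
into regions (and all critical polygons) such that the boundary of each region maps onto the circle
with degree one. -/
structure IsCriticalPortrait (d : ℕ) (C : Set Chord) : Prop where
  finite : C.Finite
  critical : ∀ c ∈ C, IsCritical d c
  noncrossing : ∀ c ∈ C, ∀ c' ∈ C, ¬ Crosses c c'
  degree_one : ∀ t, t ∉ vertices C → InjOn (sigma d) (sector C t \ vertices C)

/-- The chord `c` of `C` lies in the boundary of the sector of `t`. -/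
def BoundsSector (C : Set Chord) (t : Circ) (c : Chord) : Prop :=
  c ∈ C ∧ ∀ x ∈ c, x ∈ sector C t

/-- All the points of `Q` have the same image. -/
def AllCritical (d : ℕ) (Q : Set Circ) : Prop :=
  ∀ x ∈ Q, ∀ y ∈ Q, sigma d x = sigma d y

/-- The sector of `t` is maximal: it has in its boundary each chord of `C`, except that a side of an
all critical polygon formed by chords of `C` may be represented by another side of it. -/
def IsMaximalSector (d : ℕ) (C : Set Chord) (t : Circ) : Prop :=
  ∀ c ∈ C, BoundsSector C t c ∨
    ∃ Q : Set Circ, 3 ≤ Q.ncard ∧ AllCritical d Q ∧ sides Q ⊆ C ∧ c ∈ sides Q ∧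
      ∃ c' ∈ sides Q, BoundsSector C t c'

/-- `F` meets the chords of `C` at most at endpoints. -/
def Compatible (F C : Set Chord) : Prop :=
  ∀ e ∈ F, ∀ c ∈ C, ¬ Crosses e c

/-- Pullback scheme for `F` and `C`: one branch `τ i` of the inverse of `σ_d` for each of the `d`
sectors of `C`. At the critical values the branches are chosen so that their images are disjoint
(the sectors are taken half-open) and so that every leaf of `F` lies in the image of one branch. -/
structure IsPullbackScheme (d : ℕ) (F C : Set Chord) (τ : Fin d → Circ → Circ) : Prop where
  right_inverse : ∀ i y, sigma d (τ i y) = y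
  sectors : ∃ t : Fin d → Circ, (∀ i, t i ∉ vertices C) ∧ (∀ i y, τ i y ∈ sector C (t i)) ∧
    ∀ s, s ∉ vertices C → ∃ i, s ∈ sector C (t i)
  disjoint_images : ∀ y, Injective fun i => τ i y
  fixes : ∀ e ∈ F, ∃ i, Sym2.map (τ i) (chordIter d 1 e) = e

/-- The `n`-th stage of the pullback of `F`. -/
def pullbackStage {d : ℕ} (τ : Fin d → Circ → Circ) (F : Set Chord) : ℕ → Set Chord
  | 0 => F
  | n + 1 => pullbackStage τ F n ∪ ⋃ i, Sym2.map (τ i) '' pullbackStage τ F n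

/-- The union of all stages of the pullback of `F`. -/
def pullback {d : ℕ} (τ : Fin d → Circ → Circ) (F : Set Chord) : Set Chord :=
  ⋃ n, pullbackStage τ F n

/-! ### Major all critical (MAC) leaves -/

/-- MAC leaf: a periodic leaf, with non-crossing orbit compatible with an all critical `d`-gon, that
is closest to critical length in its orbit. -/
structure IsMACLeaf (d : ℕ) (M : Chord) : Prop where
  nondegenerate : ¬ M.IsDiag
  periodic : ∃ n : ℕ, 0 < n ∧ chordIter d n M = M
  noncrossing : ∀ i j : ℕ, ¬ Crosses (chordIter d i M) (chordIter d j M)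
  compatible : ∃ Q : Set Circ, Q.ncard = d ∧ AllCritical d Q ∧
    Compatible (forwardOrbit d {M}) (sides Q)
  major : ∀ i : ℕ, critDist d M ≤ critDist d (chordIter d i M)

/-- `L` is the canonical MAC lamination of `M`: the invariant lamination obtained by pulling back
the orbit of `M` with respect to an all critical `d`-gon attached to an endpoint of `M`. -/
structure IsCanonicalMAC (d : ℕ) (M : Chord) (L : Set Chord) : Prop where
  isMACLeaf : IsMACLeaf d M
  isPullback : ∃ (Q : Set Circ) (τ : Fin d → Circ → Circ),
    Q.ncard = d ∧ AllCritical d Q ∧ (∃ a ∈ Q, a ∈ M) ∧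
    Compatible (forwardOrbit d {M}) (sides Q) ∧
    IsPullbackScheme d (forwardOrbit d {M}) (sides Q) τ ∧
    L = chordClosure (pullback τ (forwardOrbit d {M}))
  isInvariantLamination : IsInvariantLamination d L

/-! ### Single critical moment (SCM) polygons -/

/-- SCM polygon: at some moment of its orbit it lies in a maximal critical sector of a critical
portrait, and no side is closer to critical length when the polygon is in a different sector. -/
def IsSCM (d : ℕ) (P : Set Circ) : Prop :=
  ∃ (j : ℕ) (C : Set Chord) (t : Circ), IsCriticalPortrait d C ∧ t ∉ vertices C ∧
    IsMaximalSector d C t ∧ (sigma d)^[j] '' P ⊆ sector C t ∧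
    ∀ e ∈ sides ((sigma d)^[j] '' P), ∀ i : ℕ, ¬ ((sigma d)^[i + j] '' P ⊆ sector C t) →
      critDist d e ≤ critDist d (chordIter d i e)

/-- The chain of sides joining `v 0, v 1, …, v (d - 1)` consists of `d - 1` longest sides of `P`,
adjacent to each other. -/
structure IsLongestChain (d : ℕ) (P : Set Circ) (v : ℕ → Circ) : Prop where
  consecutive : ∀ i < d - 1, Consecutive P (v i) (v (i + 1))
  distinct : InjOn v (Iio (d - 1))
  longest : ∀ i < d - 1, ∀ e ∈ sides P, (∀ j < d - 1, e ≠ s(v j, v (j + 1))) →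
    chordLength e ≤ chordLength s(v i, v (i + 1))

/-- `C` consists of `d - 1` critical chords, one under each side of the chain and touching an
endpoint of that side. -/
def IsGuiding (d : ℕ) (v : ℕ → Circ) (C : Set Chord) : Prop :=
  ∃ c : ℕ → Chord, C = c '' Iio (d - 1) ∧ ∀ i < d - 1,
    IsCritical d (c i) ∧ (v i ∈ c i ∨ v (i + 1) ∈ c i) ∧ ∀ x ∈ c i, btw (v i) x (v (i + 1))

/-- `S` is a canonical SCM lamination of `P`: the invariant lamination obtained by pulling back the
orbit of `P` with respect to the guiding critical chords `C` at the `d - 1` longest sides of `P`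
(the chain `v`), by the branches `τ`. Here `P` is taken at its moment in the maximal sector. -/
structure IsCanonicalSCM (d : ℕ) (P : Set Circ) (v : ℕ → Circ) (C : Set Chord)
    (τ : Fin d → Circ → Circ) (S : Set Chord) : Prop where
  isSCM : IsSCM d P
  isLongestChain : IsLongestChain d P v
  isGuiding : IsGuiding d v C
  isCriticalPortrait : IsCriticalPortrait d C
  inside : ∃ t, t ∉ vertices C ∧ IsMaximalSector d C t ∧ P ⊆ sector C t
  compatible : Compatible (forwardOrbit d (sides P)) C
  isPullbackScheme : IsPullbackScheme d (forwardOrbit d (sides P)) C τ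
  isPullback : S = chordClosure (pullback τ (forwardOrbit d (sides P)))
  isInvariantLamination : IsInvariantLamination d S

/-- The position of the leaf `M` in `P`. Identity return: `M` is the (strictly) shortest side.
Rotational: `M` joins two vertices of `P` through the interior of `P`; only for `d = 2`, where the
MAC leaf bounds `P`, a side is allowed. -/
def IsMarkedBy (d : ℕ) (P : Set Circ) (M : Chord) : Prop :=
  (IsIdentityReturn d P →
    IsSide P M ∧ ∀ e ∈ sides P, e ≠ M → chordLength M < chordLength e) ∧
  (IsRotational d P → IsChordOf P M ∧ (3 ≤ d → ¬ IsSide P M))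

/-- Add the pullbacks of the orbit of `M` to `S` (recovering `M`), remove the grand orbit of the
sides of `P` other than `M` (what is not in the grand orbit of `M`), and take the closure. -/
def reduction {d : ℕ} (P : Set Circ) (τ : Fin d → Circ → Circ) (S : Set Chord) (M : Chord) :
    Set Chord :=
  chordClosure ((S ∪ pullback τ (forwardOrbit d {M})) \
    (grandOrbit d (sides P \ {M}) \ grandOrbit d {M}))

end Lam

end

/-! Write `b = v (d - 1)` and `a = v 0`, and count arcs of length `1/d` from `b`. A critical chord
under a side of the chain makes that side at least `1/d` long, strictly so because its image is
nondegenerate. As the `d - 1` sides fit into less than one turn, each is shorter than `2/d`. Hence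
(`exists_chainFrame`) `v i = b + (i + u i)/d` with `0 < u 0 < ... < u (d - 1) = 1`, each guiding
chord subtends exactly `1/d`, and its critical value is the image of a vertex in the chain. The
closing leaf `M = ab` spans an arc `u 0 / d < 1/d`, and no critical value has coordinate strictly
between `0` and `u 0`.

Everything follows from one property, `MACFrame`: each iterate of `M` has both ends in one arc `[b +
j/d, b + (j + β)/d]`, where `β = u 0`. Then `M` is longest in its orbit and shorter than `1/d`, so
it is closest to critical length. The `d` branches over the half-open arcs preserve circular order
and have disjoint images, so pulling back the orbit by them creates no crossings (`macPullback`). A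
leaf of this pullback has both ends or no end in the closed arc under `σ_d(M)`; therefore every
scheme for an all critical `d`-gon at an end of `M` yields the same leaves
(`pullback_eq_of_scheme`), and so do the branches `τ` (`pullback_eq_macPullback`).

`MACFrame` is obtained in two ways. For an identity return polygon, `M` is a side, and the guiding
chords and the images of the chain force each iterate into one arc, with its image either below or
above `u 0`. A chord above is shorter than `1 - u 0`, and the growth of lengths excludes this
(`macFrame_of_return`). For a rotational polygon, `σ_d` rotates the vertices by a multiple of `d -
1`, so the orbit of `b` is every `(d - 1)`-st vertex, and all of it lies on the arc from `b` to `a`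
(`RotFrame.macFrame`).

Finite classes with boundary leaves are inherited from `S` in the identity return case, where the
closed pullback is part of `S`. In the rotational case the branches contract every leaf outside the
orbit, so the pullback is already closed and its classes are preimages of subsets of one polygon.

Uniqueness is immediate for a strictly shortest side. In a rotational polygon the inner vertices of
the chain are farther than `1/d` from all other vertices, so a MAC leaf joins points of the orbit of
`b`; a noncrossing orbit makes them adjacent there, and maximal length selects `M`
(`eq_of_isMACLeaf`).

For the reduction with `d ≥ 3`, the leaves of `S` pulled back from sides other than `M` are removed,
since their orbits never meet that of `M`. Any leaf of `S` outside the pullback of the sides has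
eventually all iterates strictly inside the arcs of length `β/d` (`exists_isInner`). There,
pullbacks of `M` separate it from the leaves converging to it, so it is itself a limit of pullbacks
of `M` (`inner_mem_chordClosure`). For `d = 2` the sides are just the orbit of `M`. -/

noncomputable section

namespace Lam

/-! ### Coordinates on the circle -/

/-- The counterclockwise arc length from `c` to `x`, in `[0, 1)`. -/
def fr (c x : Circ) : ℝ := (AddCircle.equivIco 1 0 (x - c) : ℝ)

lemma fr_nonneg (c x : Circ) : 0 ≤ fr c x := (AddCircle.equivIco 1 0 (x - c)).2.1

lemma fr_lt_one (c x : Circ) : fr c x < 1 := by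
  have := (AddCircle.equivIco (1 : ℝ) 0 (x - c)).2.2
  simpa [fr] using this

lemma add_fr (c x : Circ) : c + (fr c x : Circ) = x := by
  have : ((fr c x : ℝ) : Circ) = x - c := (AddCircle.equivIco (1 : ℝ) 0).symm_apply_apply (x - c)
  rw [this]; abel

lemma fr_add_coe {c : Circ} {r : ℝ} (h0 : 0 ≤ r) (h1 : r < 1) : fr c (c + (r : Circ)) = r := by
  have : c + (r : Circ) - c = (r : Circ) := by abel
  rw [fr, this, AddCircle.coe_equivIco_mk_apply]
  simpa using Int.fract_eq_self.2 ⟨h0, h1⟩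

lemma fr_eq_of {c x : Circ} {r : ℝ} (h0 : 0 ≤ r) (h1 : r < 1) (h : x = c + (r : Circ)) :
    fr c x = r := by rw [h, fr_add_coe h0 h1]

lemma fr_self (c : Circ) : fr c c = 0 := fr_eq_of le_rfl one_pos (by simp)

lemma fr_inj {c x y : Circ} : fr c x = fr c y ↔ x = y :=
  ⟨fun h => by rw [← add_fr c x, h, add_fr], fun h => by rw [h]⟩

lemma fr_eq_zero {c x : Circ} : fr c x = 0 ↔ x = c := by
  rw [← fr_self c, fr_inj]

lemma fr_pos {c x : Circ} : 0 < fr c x ↔ x ≠ c := by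
  rw [(fr_nonneg c x).lt_iff_ne, ne_comm, Ne, fr_eq_zero]

lemma coe_int_eq_zero (n : ℤ) : ((n : ℝ) : Circ) = 0 := by
  rw [AddCircle.coe_eq_zero_iff]; exact ⟨n, by simp⟩

lemma coe_nat_eq_zero (n : ℕ) : ((n : ℝ) : Circ) = 0 := by
  exact_mod_cast coe_int_eq_zero n

lemma coe_one_eq_zero : ((1 : ℝ) : Circ) = 0 := by exact_mod_cast coe_int_eq_zero 1

lemma coe_eq_coe_iff {r s : ℝ} : (r : Circ) = (s : Circ) ↔ ∃ n : ℤ, r = s + n := by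
  rw [← sub_eq_zero, ← AddCircle.coe_sub, AddCircle.coe_eq_zero_iff]
  constructor
  · rintro ⟨n, hn⟩; exact ⟨n, by simp at hn; linarith⟩
  · rintro ⟨n, hn⟩; exact ⟨n, by simp; linarith⟩

lemma fr_add_coe_fract (c : Circ) (r : ℝ) : fr c (c + (r : Circ)) = Int.fract r := by
  apply fr_eq_of (Int.fract_nonneg r) (Int.fract_lt_one r)
  congr 1
  rw [coe_eq_coe_iff]
  exact ⟨⌊r⌋, by rw [Int.fract]; ring⟩

/-- Cyclic order of three reals in `[0, 1)`. -/
def cyc (A X B : ℝ) : Prop := (A < X ∧ X < B) ∨ (X < B ∧ B < A) ∨ (B < A ∧ A < X)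

/-- The order on the quotient compares representatives in an interval based at the first point, so
measuring both arcs from `x` turns it into the order of the reals. -/
lemma sbtw_iff_fr {x y z : Circ} : sbtw x y z ↔ 0 < fr x y ∧ fr x y < fr x z := by
  rw [sbtw_iff_not_btw, btw_cyclic]
  have key : ∀ a b c : Circ, btw a b c ↔ (c = a ∨ fr a b ≤ fr a c) := by
    intro a b c
    obtain ⟨B, hB0, hB1, rfl⟩ : ∃ r : ℝ, 0 ≤ r ∧ r < 1 ∧ a + (r : Circ) = b :=
      ⟨fr a b, fr_nonneg _ _, fr_lt_one _ _, add_fr _ _⟩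
    obtain ⟨C, hC0, hC1, rfl⟩ : ∃ r : ℝ, 0 ≤ r ∧ r < 1 ∧ a + (r : Circ) = c :=
      ⟨fr a c, fr_nonneg _ _, fr_lt_one _ _, add_fr _ _⟩
    induction a using QuotientAddGroup.induction_on with
    | H a =>
    rw [fr_add_coe hB0 hB1, fr_add_coe hC0 hC1]
    have h1 := @QuotientAddGroup.btw_coe_iff ℝ _ _ _ _ 1 ⟨one_pos⟩ a (a + B) (a + C)
    rw [show ((a : ℝ) : Circ) + (B : Circ) = ((a + B : ℝ) : Circ) from rfl,
      show ((a : ℝ) : Circ) + (C : Circ) = ((a + C : ℝ) : Circ) from rfl]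
    refine h1.trans ?_
    have e1 : toIcoMod (one_pos : (0 : ℝ) < 1) a (a + B) = a + B :=
      (toIcoMod_eq_self _).2 ⟨by linarith, by linarith⟩
    rw [e1]
    -- `toIocMod` puts the base point at the far end of its interval; this is why `c = a` always
    -- satisfies the weak order.
    rcases hC0.eq_or_lt with h | h
    · subst h
      simp only [add_zero, toIocMod_apply_left]
      simp; linarith
    · have e2 : toIocMod (one_pos : (0 : ℝ) < 1) a (a + C) = a + C :=
        (toIocMod_eq_self _).2 ⟨by linarith, by linarith⟩
      rw [e2]
      constructor
      · intro h; right; linarith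
      · rintro (h' | h')
        · exfalso
          have h2 : ((a + C : ℝ) : Circ) = ((a : ℝ) : Circ) := h'
          rw [coe_eq_coe_iff] at h2
          obtain ⟨n, hn⟩ := h2
          have h3 : (0 : ℝ) < n := by linarith
          have h4 : (n : ℝ) < 1 := by linarith
          norm_cast at h3 h4; omega
        · linarith
  rw [key, not_or, not_le, fr_pos]

lemma fr_change (c x y : Circ) : fr x y = Int.fract (fr c y - fr c x) := by
  rw [← fr_add_coe_fract x]
  congr 1
  rw [AddCircle.coe_sub]
  conv_lhs => rw [← add_fr c y]
  conv_rhs => rw [← add_fr c x]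
  rw [fr_add_coe (fr_nonneg _ _) (fr_lt_one _ _)]
  abel

lemma fract_sub_cases {X Y : ℝ} (hX0 : 0 ≤ X) (hX : X < 1) (hY0 : 0 ≤ Y) (hY : Y < 1) :
    (X ≤ Y ∧ Int.fract (Y - X) = Y - X) ∨ (Y < X ∧ Int.fract (Y - X) = Y - X + 1) := by
  rcases le_or_gt X Y with h | h
  · left; exact ⟨h, Int.fract_eq_self.2 ⟨by linarith, by linarith⟩⟩
  · right; refine ⟨h, ?_⟩
    rw [← Int.fract_add_one]; exact Int.fract_eq_self.2 ⟨by linarith, by linarith⟩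

lemma fr_cases (c x y : Circ) :
    (fr c x ≤ fr c y ∧ fr x y = fr c y - fr c x) ∨
      (fr c y < fr c x ∧ fr x y = fr c y - fr c x + 1) := by
  rw [fr_change c x y]
  exact fract_sub_cases (fr_nonneg _ _) (fr_lt_one _ _) (fr_nonneg _ _) (fr_lt_one _ _)

/-- Circular order does not depend on where the circle is cut. This allows sources to be measured
from `b` and images from `σ_d b`. -/
lemma sbtw_iff_cyc (c : Circ) {x y z : Circ} :
    sbtw x y z ↔ cyc (fr c x) (fr c y) (fr c z) := by
  rw [sbtw_iff_fr, cyc]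
  have := fr_nonneg c x; have := fr_nonneg c y; have := fr_nonneg c z
  have := fr_lt_one c x; have := fr_lt_one c y; have := fr_lt_one c z
  rcases fr_cases c x y with ⟨h1, e1⟩ | ⟨h1, e1⟩ <;>
  rcases fr_cases c x z with ⟨h2, e2⟩ | ⟨h2, e2⟩ <;> rw [e1, e2] <;> grind

/-- Two chords cross, in terms of coordinates of their endpoints. -/
def RCross (A B X Y : ℝ) : Prop :=
  (min A B < X ∧ X < max A B ∧ (Y < min A B ∨ max A B < Y)) ∨
    (min A B < Y ∧ Y < max A B ∧ (X < min A B ∨ max A B < X))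

lemma crosses_mk_iff {a b x y : Circ} :
    Crosses s(a, b) s(x, y) ↔
      (sbtw a x b ∧ sbtw b y a) ∨ (sbtw a y b ∧ sbtw b x a) := by
  constructor
  · rintro ⟨a', b', x', y', h1, h2, h3, h4⟩
    rw [Sym2.eq_iff] at h1 h2
    rcases h1 with ⟨rfl, rfl⟩ | ⟨rfl, rfl⟩ <;> rcases h2 with ⟨rfl, rfl⟩ | ⟨rfl, rfl⟩ <;> tauto
  · rintro (⟨h1, h2⟩ | ⟨h1, h2⟩)
    · exact ⟨a, b, x, y, rfl, rfl, h1, h2⟩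
    · exact ⟨a, b, y, x, rfl, Sym2.eq_swap, h1, h2⟩

lemma cyc_pair_iff (A B X Y : ℝ) :
    ((cyc A X B ∧ cyc B Y A) ∨ (cyc A Y B ∧ cyc B X A)) ↔ RCross A B X Y := by
  unfold cyc RCross
  rcases le_total A B with h | h
  · rw [min_eq_left h, max_eq_right h]
    constructor
    · rintro (⟨h1, h2⟩ | ⟨h1, h2⟩)
      · left
        have h3 : A < X ∧ X < B := by
          rcases h1 with h1 | h1 | h1
          · exact h1
          · linarith [h1.1, h1.2]
          · linarith [h1.1, h1.2]
        refine ⟨h3.1, h3.2, ?_⟩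
        rcases h2 with h2 | h2 | h2
        · linarith [h2.1, h2.2]
        · left; exact h2.1
        · right; exact h2.2
      · right
        have h3 : A < Y ∧ Y < B := by
          rcases h1 with h1 | h1 | h1
          · exact h1
          · linarith [h1.1, h1.2]
          · linarith [h1.1, h1.2]
        refine ⟨h3.1, h3.2, ?_⟩
        rcases h2 with h2 | h2 | h2
        · linarith [h2.1, h2.2]
        · left; exact h2.1
        · right; exact h2.2
    · rintro (⟨h1, h2, h3 | h3⟩ | ⟨h1, h2, h3 | h3⟩)
      · exact Or.inl ⟨Or.inl ⟨h1, h2⟩, Or.inr (Or.inl ⟨h3, by linarith⟩)⟩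
      · exact Or.inl ⟨Or.inl ⟨h1, h2⟩, Or.inr (Or.inr ⟨by linarith, h3⟩)⟩
      · exact Or.inr ⟨Or.inl ⟨h1, h2⟩, Or.inr (Or.inl ⟨h3, by linarith⟩)⟩
      · exact Or.inr ⟨Or.inl ⟨h1, h2⟩, Or.inr (Or.inr ⟨by linarith, h3⟩)⟩
  · rw [min_eq_right h, max_eq_left h]
    constructor
    · rintro (⟨h1, h2⟩ | ⟨h1, h2⟩)
      · right
        have h3 : B < Y ∧ Y < A := by
          rcases h2 with h1 | h1 | h1
          · exact h1
          · linarith [h1.1, h1.2]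
          · linarith [h1.1, h1.2]
        refine ⟨h3.1, h3.2, ?_⟩
        rcases h1 with h2 | h2 | h2
        · linarith [h2.1, h2.2]
        · left; exact h2.1
        · right; exact h2.2
      · left
        have h3 : B < X ∧ X < A := by
          rcases h2 with h1 | h1 | h1
          · exact h1
          · linarith [h1.1, h1.2]
          · linarith [h1.1, h1.2]
        refine ⟨h3.1, h3.2, ?_⟩
        rcases h1 with h2 | h2 | h2
        · linarith [h2.1, h2.2]
        · left; exact h2.1
        · right; exact h2.2
    · rintro (⟨h1, h2, h3 | h3⟩ | ⟨h1, h2, h3 | h3⟩)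
      · exact Or.inr ⟨Or.inr (Or.inl ⟨h3, by linarith⟩), Or.inl ⟨h1, h2⟩⟩
      · exact Or.inr ⟨Or.inr (Or.inr ⟨by linarith, h3⟩), Or.inl ⟨h1, h2⟩⟩
      · exact Or.inl ⟨Or.inr (Or.inl ⟨h3, by linarith⟩), Or.inl ⟨h1, h2⟩⟩
      · exact Or.inl ⟨Or.inr (Or.inr ⟨by linarith, h3⟩), Or.inl ⟨h1, h2⟩⟩

lemma crosses_iff_coord (c : Circ) {a b x y : Circ} :
    Crosses s(a, b) s(x, y) ↔ RCross (fr c a) (fr c b) (fr c x) (fr c y) := by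
  rw [crosses_mk_iff, ← cyc_pair_iff]
  simp only [sbtw_iff_cyc c]

lemma Crosses.symm {e f : Chord} (h : Crosses e f) : Crosses f e := by
  obtain ⟨a, b, x, y, rfl, rfl, h1, h2⟩ := h
  have h3 := fr_nonneg a x; have h4 := fr_nonneg a b; have h5 := fr_nonneg a y
  rw [sbtw_iff_cyc a, fr_self, cyc] at h1 h2
  refine ⟨y, x, a, b, Sym2.eq_swap, rfl, ?_, ?_⟩ <;> simp only [sbtw_iff_cyc a, fr_self, cyc] <;> grind

lemma norm_coe_of_le {r : ℝ} (h : |r| ≤ 1 / 2) : ‖(r : Circ)‖ = |r| := by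
  have := (AddCircle.norm_coe_eq_abs_iff (p := 1) (x := r) one_ne_zero).2 (by simpa using h)
  exact this

lemma norm_coe_eq {r : ℝ} (h0 : 0 ≤ r) (h1 : r ≤ 1) : ‖(r : Circ)‖ = min r (1 - r) := by
  rcases le_or_gt r (1 / 2) with h | h
  · rw [norm_coe_of_le (by rwa [abs_of_nonneg h0]), abs_of_nonneg h0, min_eq_left (by linarith)]
  · have : (r : Circ) = ((r - 1 : ℝ) : Circ) := by
      rw [coe_eq_coe_iff]; exact ⟨1, by push_cast; ring⟩
    have h2 : |r - 1| = 1 - r := by rw [abs_of_nonpos (by linarith)]; ring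
    rw [this, norm_coe_of_le (by rw [h2]; linarith), h2, min_eq_right (by linarith)]

lemma norm_sub_eq (c x y : Circ) :
    ‖x - y‖ = min |fr c x - fr c y| (1 - |fr c x - fr c y|) := by
  have hx := fr_nonneg c x; have hy := fr_nonneg c y
  have hx1 := fr_lt_one c x; have hy1 := fr_lt_one c y
  have e : x - y = ((fr c x - fr c y : ℝ) : Circ) := by
    conv_lhs => rw [← add_fr c x, ← add_fr c y]
    rw [AddCircle.coe_sub]; abel
  rw [e]
  rcases le_total (fr c y) (fr c x) with h | h
  · rw [abs_of_nonneg (by linarith), norm_coe_eq (by linarith) (by linarith)]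
  · rw [abs_of_nonpos (by linarith), ← norm_neg, ← AddCircle.coe_neg,
      norm_coe_eq (by linarith) (by linarith)]

@[simp] lemma chordLength_mk (x y : Circ) : chordLength s(x, y) = ‖x - y‖ := rfl

lemma fr_swap {x y : Circ} (h : x ≠ y) : fr y x = 1 - fr x y := by
  have hp := fr_pos.2 h.symm
  rcases fr_cases x y x with ⟨h1, -⟩ | ⟨-, e⟩
  · rw [fr_self] at h1; linarith
  · rw [e, fr_self]; ring

/-! ### The map `σ_d` -/

@[simp] lemma sigma_add_coe (d : ℕ) (c : Circ) (r : ℝ) :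
    sigma d (c + (r : Circ)) = sigma d c + ((d * r : ℝ) : Circ) := by
  unfold sigma
  rw [smul_add, ← AddCircle.coe_nsmul, nsmul_eq_mul]

/-- In coordinates counted from `c` and from its image, `σ_d` is multiplication by `d` modulo one.
-/
lemma fr_sigma (d : ℕ) (c x : Circ) : fr (sigma d c) (sigma d x) = Int.fract (d * fr c x) := by
  conv_lhs => rw [← add_fr c x]
  rw [sigma_add_coe, fr_add_coe_fract]

@[simp] lemma chordIter_mk (d n : ℕ) (x y : Circ) :
    chordIter d n s(x, y) = s((sigma d)^[n] x, (sigma d)^[n] y) := rfl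

@[simp] lemma chordIter_zero (d : ℕ) (e : Chord) : chordIter d 0 e = e := by
  induction e using Sym2.ind with | _ x y => rfl

lemma chordIter_add (d m n : ℕ) (e : Chord) :
    chordIter d (m + n) e = chordIter d m (chordIter d n e) := by
  induction e using Sym2.ind with | _ x y => simp [iterate_add_apply]

lemma continuous_sigma (d : ℕ) : Continuous (sigma d) := by
  unfold sigma; fun_prop

/-! ### Branches of the inverse of `σ_d` -/

/-- The branch of the inverse of `σ_d` with values in the `j`-th half-open arc of length `1/d`
counted from `b`. -/
def br (d : ℕ) (b : Circ) (j : ℕ) (w : Circ) : Circ :=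
  b + (((j + fr (sigma d b) w) / d : ℝ) : Circ)

/-- The number of the half-open arc of length `1/d`, counted from `b`, that contains `x`. -/
def idx (d : ℕ) (b x : Circ) : ℕ := ⌊d * fr b x⌋₊

section
variable {d : ℕ} {b : Circ}

lemma sigma_br (hd : 0 < d) (j : ℕ) (w : Circ) : sigma d (br d b j w) = w := by
  have hd' : (d : ℝ) ≠ 0 := by positivity
  rw [br, sigma_add_coe, mul_div_cancel₀ _ hd', AddCircle.coe_add, coe_nat_eq_zero, zero_add, add_fr]

lemma fr_br {j : ℕ} (hj : j < d) (w : Circ) :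
    fr b (br d b j w) = (j + fr (sigma d b) w) / d := by
  have hd : (0 : ℝ) < d := by exact_mod_cast (by omega : 0 < d)
  have h0 := fr_nonneg (sigma d b) w; have h1 := fr_lt_one (sigma d b) w
  have hj' : (j : ℝ) + 1 ≤ d := by exact_mod_cast hj
  apply fr_add_coe
  · positivity
  · rw [div_lt_one hd]; linarith

lemma idx_lt (hd : 0 < d) (x : Circ) : idx d b x < d := by
  have hd' : (0 : ℝ) < d := by exact_mod_cast hd
  rw [idx, Nat.floor_lt (by have := fr_nonneg b x; positivity)]
  have := fr_lt_one b x
  nlinarith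

/-- Integer and fractional part of `d * fr b x`: the first numbers the arc, the second is the
coordinate of the image. -/
lemma fr_eq_idx (hd : 0 < d) (x : Circ) :
    fr b x = (idx d b x + fr (sigma d b) (sigma d x)) / d := by
  have hd' : (0 : ℝ) < d := by exact_mod_cast hd
  have h0 : (0 : ℝ) ≤ d * fr b x := by have := fr_nonneg b x; positivity
  rw [fr_sigma, idx, eq_div_iff hd'.ne', mul_comm, natCast_floor_eq_intCast_floor h0]
  exact (Int.floor_add_fract _).symm

lemma br_idx (hd : 0 < d) (x : Circ) : br d b (idx d b x) (sigma d x) = x := by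
  rw [br, ← fr_eq_idx hd, add_fr]

lemma idx_br {j : ℕ} (hj : j < d) (w : Circ) : idx d b (br d b j w) = j := by
  have hd : (0 : ℝ) < d := by exact_mod_cast (by omega : 0 < d)
  have h0 := fr_nonneg (sigma d b) w; have h1 := fr_lt_one (sigma d b) w
  rw [idx, fr_br hj, mul_div_cancel₀ _ hd.ne', Nat.floor_eq_iff (by positivity)]
  constructor <;> linarith

lemma br_injective_index {i j : ℕ} (hi : i < d) (hj : j < d) {w w' : Circ}
    (h : br d b i w = br d b j w') : i = j := by
  rw [← idx_br (b := b) hi w, h, idx_br hj]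

/-- Crossing depends only on comparisons between an end of one chord and an end of the other. -/
lemma RCross_congr {A B X Y A' B' X' Y' : ℝ} (hAX : A < X ↔ A' < X') (hXA : X < A ↔ X' < A')
    (hBX : B < X ↔ B' < X') (hXB : X < B ↔ X' < B') (hAY : A < Y ↔ A' < Y')
    (hYA : Y < A ↔ Y' < A') (hBY : B < Y ↔ B' < Y') (hYB : Y < B ↔ Y' < B') :
    RCross A B X Y ↔ RCross A' B' X' Y' := by
  unfold RCross
  simp only [lt_min_iff, max_lt_iff, min_lt_iff, lt_max_iff, hAX, hXA, hBX, hXB, hAY, hYA, hBY, hYB]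

/-- In coordinates a branch is an increasing affine map. -/
lemma crosses_map_br {j : ℕ} (hj : j < d) {e f : Chord} :
    Crosses (Sym2.map (br d b j) e) (Sym2.map (br d b j) f) ↔ Crosses e f := by
  have hd : (0 : ℝ) < d := by exact_mod_cast (by omega : 0 < d)
  induction e using Sym2.ind with | _ x y
  induction f using Sym2.ind with | _ z w
  have key : ∀ u v, fr b (br d b j u) < fr b (br d b j v) ↔
      fr (sigma d b) u < fr (sigma d b) v := by
    intro u v
    rw [fr_br hj, fr_br hj, div_lt_div_iff_of_pos_right hd]
    constructor <;> intro h <;> linarith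
  simp only [Sym2.map_mk]
  rw [crosses_iff_coord b, crosses_iff_coord (sigma d b)]
  apply RCross_congr <;> exact key _ _

/-- Different branches take values in disjoint half-open arcs. -/
lemma not_crosses_map_br {i j : ℕ} (hi : i < d) (hj : j < d) (hij : i ≠ j) (e f : Chord) :
    ¬ Crosses (Sym2.map (br d b i) e) (Sym2.map (br d b j) f) := by
  have hd : (0 : ℝ) < d := by exact_mod_cast (by omega : 0 < d)
  induction e using Sym2.ind with | _ x y
  induction f using Sym2.ind with | _ z w
  simp only [Sym2.map_mk]
  rw [crosses_iff_coord b, fr_br hi, fr_br hi, fr_br hj, fr_br hj]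
  have hx := fr_nonneg (sigma d b) x; have hx1 := fr_lt_one (sigma d b) x
  have hy := fr_nonneg (sigma d b) y; have hy1 := fr_lt_one (sigma d b) y
  have hz := fr_nonneg (sigma d b) z; have hz1 := fr_lt_one (sigma d b) z
  have hw := fr_nonneg (sigma d b) w; have hw1 := fr_lt_one (sigma d b) w
  unfold RCross
  simp only [lt_min_iff, max_lt_iff, min_lt_iff, lt_max_iff, div_lt_div_iff_of_pos_right hd]
  rcases lt_or_gt_of_ne hij with h | h
  · have : (i : ℝ) + 1 ≤ j := by exact_mod_cast h
    rintro (⟨-, h2 | h2, -⟩ | ⟨-, h2 | h2, -⟩) <;> linarith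
  · have : (j : ℝ) + 1 ≤ i := by exact_mod_cast h
    rintro (⟨h2 | h2, -, -⟩ | ⟨h2 | h2, -, -⟩) <;> linarith

end

/-! ### Pullbacks -/

section
variable {d : ℕ} {τ τ' : Fin d → Circ → Circ} {F F' : Set Chord}

lemma subset_pullback : F ⊆ pullback τ F := fun _ he => mem_iUnion.2 ⟨0, he⟩

lemma map_mem_pullback {e : Chord} (he : e ∈ pullback τ F) (i : Fin d) :
    Sym2.map (τ i) e ∈ pullback τ F := by
  obtain ⟨n, hn⟩ := mem_iUnion.1 he
  exact mem_iUnion.2 ⟨n + 1, Or.inr (mem_iUnion.2 ⟨i, e, hn, rfl⟩)⟩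

lemma pullback_induction {p : Chord → Prop} (h0 : ∀ e ∈ F, p e)
    (h1 : ∀ e ∈ pullback τ F, p e → ∀ i, p (Sym2.map (τ i) e)) : ∀ e ∈ pullback τ F, p e := by
  intro e he
  obtain ⟨n, hn⟩ := mem_iUnion.1 he
  clear he
  induction n generalizing e with
  | zero => exact h0 e hn
  | succ n ih =>
    rcases hn with hn | hn
    · exact ih e hn
    · obtain ⟨i, f, hf, rfl⟩ := mem_iUnion.1 hn
      exact h1 f (mem_iUnion.2 ⟨n, hf⟩) (ih f hf) i

lemma pullback_subset {X : Set Chord} (h0 : F ⊆ X)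
    (h1 : ∀ e ∈ X, ∀ i, Sym2.map (τ i) e ∈ X) : pullback τ F ⊆ X :=
  pullback_induction h0 fun _ _ he i => h1 _ he i

lemma pullback_mono (h : F ⊆ F') : pullback τ F ⊆ pullback τ F' :=
  pullback_subset (h.trans subset_pullback) fun _ he i => map_mem_pullback he i

/-- Only the set of images of each single leaf matters, so two families of branches may be matched
in a way that varies from leaf to leaf. -/
lemma pullback_congr (h1 : ∀ e ∈ pullback τ F, ∀ i, ∃ j, Sym2.map (τ' i) e = Sym2.map (τ j) e)
    (h2 : ∀ e ∈ pullback τ F, ∀ i, ∃ j, Sym2.map (τ i) e = Sym2.map (τ' j) e) :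
    pullback τ' F = pullback τ F := by
  have h3 : pullback τ' F ⊆ pullback τ F :=
    pullback_subset subset_pullback fun e he i => by
      obtain ⟨j, hj⟩ := h1 e he i
      rw [hj]; exact map_mem_pullback he j
  refine h3.antisymm fun e he => ?_
  refine pullback_induction (p := fun e => e ∈ pullback τ' F) (fun e he => subset_pullback he)
    (fun e he he' i => ?_) e he
  obtain ⟨j, hj⟩ := h2 e he i
  rw [hj]; exact map_mem_pullback he' j

/-- A section of `σ_d` cannot exchange the ends: if it sent `σ_d p` to `q`, then `p` and `q` would
have the same image and hence coincide. -/
lemma eq_of_map_eq {f : Circ → Circ} (hf : ∀ y, sigma d (f y) = y) {p q : Circ}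
    (h : Sym2.map f (chordIter d 1 s(p, q)) = s(p, q)) :
    f (sigma d p) = p ∧ f (sigma d q) = q := by
  simp only [chordIter_mk, iterate_one, Sym2.map_mk, Sym2.eq_iff] at h
  rcases h with h | ⟨h, h'⟩
  · exact h
  · have h1 := hf (sigma d p)
    rw [h] at h1
    rw [h1] at h'
    exact ⟨h', by rw [h1, h]⟩

lemma chordIter_one_map (hτ : ∀ i y, sigma d (τ i y) = y) (i : Fin d) (e : Chord) :
    chordIter d 1 (Sym2.map (τ i) e) = e := by
  induction e using Sym2.ind with | _ x y
  simp [hτ]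

lemma chordIter_mem_pullback (hτ : ∀ i y, sigma d (τ i y) = y)
    (hF : ∀ e ∈ F, chordIter d 1 e ∈ F) {e : Chord} (he : e ∈ pullback τ F) :
    chordIter d 1 e ∈ pullback τ F := by
  refine pullback_induction (p := fun e => chordIter d 1 e ∈ pullback τ F)
    (fun e he => subset_pullback (hF e he)) (fun e he _ i => ?_) e he
  rwa [chordIter_one_map hτ]

lemma chordIter_succ (d n : ℕ) (e : Chord) :
    chordIter d (n + 1) e = chordIter d n (chordIter d 1 e) := chordIter_add d n 1 e

lemma chordIter_comm (d m n : ℕ) (e : Chord) :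
    chordIter d m (chordIter d n e) = chordIter d n (chordIter d m e) := by
  rw [← chordIter_add, add_comm, chordIter_add]

lemma exists_chordIter_mem (hτ : ∀ i y, sigma d (τ i y) = y) {e : Chord}
    (he : e ∈ pullback τ F) : ∃ m, chordIter d m e ∈ F := by
  refine pullback_induction (p := fun e => ∃ m, chordIter d m e ∈ F)
    (fun e he => ⟨0, by simpa⟩) (fun e _ h i => ?_) e he
  obtain ⟨m, hm⟩ := h
  exact ⟨m + 1, by rwa [chordIter_succ, chordIter_one_map hτ]⟩

lemma IsDiag.chordIter {e : Chord} (h : e.IsDiag) (d n : ℕ) : (chordIter d n e).IsDiag := by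
  induction e using Sym2.ind with | _ x y
  simp only [Sym2.mk_isDiag_iff, chordIter_mk] at *
  rw [h]

lemma not_isDiag_of_mem_pullback (hτ : ∀ i y, sigma d (τ i y) = y)
    (hF : ∀ e ∈ F, ¬ e.IsDiag) {e : Chord} (he : e ∈ pullback τ F) : ¬ e.IsDiag := by
  obtain ⟨m, hm⟩ := exists_chordIter_mem hτ he
  exact fun h => hF _ hm (IsDiag.chordIter h d m)

lemma exists_eq_map (hτ : ∀ i y, sigma d (τ i y) = y)
    (hF : ∀ e ∈ F, ∃ i, Sym2.map (τ i) (chordIter d 1 e) = e) {e : Chord}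
    (he : e ∈ pullback τ F) : ∃ i, Sym2.map (τ i) (chordIter d 1 e) = e := by
  refine pullback_induction (p := fun e => ∃ i, Sym2.map (τ i) (chordIter d 1 e) = e)
    hF (fun e _ _ i => ⟨i, ?_⟩) e he
  rw [chordIter_one_map hτ]

lemma mem_forwardOrbit_self {X : Set Chord} {e : Chord} (he : e ∈ X) : e ∈ forwardOrbit d X :=
  ⟨e, he, 0, by simp⟩

lemma chordIter_mem_forwardOrbit {X : Set Chord} {e : Chord} (he : e ∈ forwardOrbit d X) (n : ℕ) :
    chordIter d n e ∈ forwardOrbit d X := by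
  obtain ⟨f, hf, k, rfl⟩ := he
  exact ⟨f, hf, n + k, (chordIter_add d n k f).symm⟩

lemma pullback_forwardOrbit_subset_grandOrbit (hτ : ∀ i y, sigma d (τ i y) = y) {X : Set Chord} :
    pullback τ (forwardOrbit d X) ⊆ grandOrbit d X := by
  intro e he
  obtain ⟨m, f, hf, k, hk⟩ := exists_chordIter_mem hτ he
  exact ⟨f, hf, m, k, hk⟩

end

open Filter Topology

/-! ### Closures of sets of chords -/

lemma mk_mem_chordClosure {L : Set Chord} {x y : Circ} :
    s(x, y) ∈ chordClosure L ↔ x ≠ y ∧ (x, y) ∈ closure {p : Circ × Circ | s(p.1, p.2) ∈ L} := by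
  constructor
  · rintro ⟨x', y', hne, h, hcl⟩
    rw [Sym2.eq_iff] at h
    rcases h with ⟨rfl, rfl⟩ | ⟨rfl, rfl⟩
    · exact ⟨hne, hcl⟩
    · refine ⟨hne.symm, ?_⟩
      have h1 : MapsTo Prod.swap {p : Circ × Circ | s(p.1, p.2) ∈ L}
          {p : Circ × Circ | s(p.1, p.2) ∈ L} := by
        rintro ⟨p, q⟩ h
        simpa [Sym2.eq_swap (a := q)] using h
      exact h1.closure continuous_swap hcl
  · rintro ⟨hne, hcl⟩
    exact ⟨x, y, hne, rfl, hcl⟩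

lemma not_isDiag_of_mem_chordClosure {L : Set Chord} {e : Chord} (he : e ∈ chordClosure L) :
    ¬ e.IsDiag := by
  obtain ⟨x, y, hne, rfl, -⟩ := he
  simpa using hne

lemma mem_chordClosure_of_mem {L : Set Chord} {e : Chord} (he : e ∈ L) (hd : ¬ e.IsDiag) :
    e ∈ chordClosure L := by
  induction e using Sym2.ind with | _ x y
  exact mk_mem_chordClosure.2 ⟨by simpa using hd, subset_closure he⟩

lemma chordClosure_mono {L L' : Set Chord} (h : L ⊆ L') : chordClosure L ⊆ chordClosure L' := by
  rintro e ⟨x, y, hne, rfl, hcl⟩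
  have h1 : {p : Circ × Circ | s(p.1, p.2) ∈ L} ⊆ {p : Circ × Circ | s(p.1, p.2) ∈ L'} :=
    fun p hp => h hp
  exact ⟨x, y, hne, rfl, closure_mono h1 hcl⟩

lemma chordClosure_subset_of {L L' : Set Chord} (h : L' ⊆ chordClosure L) :
    chordClosure L' ⊆ chordClosure L := by
  rintro e ⟨x, y, hne, rfl, hcl⟩
  refine ⟨x, y, hne, rfl, closure_minimal ?_ isClosed_closure hcl⟩
  rintro ⟨p, q⟩ hp
  exact (mk_mem_chordClosure.1 (h hp)).2

lemma fr_eq_fr_zero (c x : Circ) : fr c x = fr 0 (x - c) := by simp [fr]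

lemma continuousAt_fr_zero {x : Circ} (hx : x ≠ 0) : ContinuousAt (fr 0) x := by
  have h : fr 0 = fun x : Circ => (AddCircle.equivIco 1 0 x : ℝ) := by ext y; simp [fr]
  rw [h]
  exact continuous_subtype_val.continuousAt.comp
    (AddCircle.continuousAt_equivIco (p := (1 : ℝ)) (a := 0) (by simpa using hx))

lemma continuousAt_fr {c x : Circ} (hx : x ≠ c) : ContinuousAt (fr c) x := by
  have h : fr c = fun x => fr 0 (x - c) := by ext y; exact fr_eq_fr_zero c y
  rw [h]
  exact ContinuousAt.comp (f := fun y : Circ => y - c) (continuousAt_fr_zero (sub_ne_zero.2 hx))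
    (by fun_prop)

lemma isOpen_sbtw : IsOpen {p : Circ × Circ × Circ | sbtw p.1 p.2.1 p.2.2} := by
  rw [isOpen_iff_mem_nhds]
  rintro ⟨x, y, z⟩ h
  have h1 := sbtw_iff_fr.1 h
  have hy : y - x ≠ 0 := sub_ne_zero.2 (fr_pos.1 h1.1)
  have hz : z - x ≠ 0 := sub_ne_zero.2 (fr_pos.1 (h1.1.trans h1.2))
  have cy : ContinuousAt (fun p : Circ × Circ × Circ => fr 0 (p.2.1 - p.1)) (x, y, z) :=
    ContinuousAt.comp (f := fun p : Circ × Circ × Circ => p.2.1 - p.1) (continuousAt_fr_zero hy)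
      (by fun_prop)
  have cz : ContinuousAt (fun p : Circ × Circ × Circ => fr 0 (p.2.2 - p.1)) (x, y, z) :=
    ContinuousAt.comp (f := fun p : Circ × Circ × Circ => p.2.2 - p.1) (continuousAt_fr_zero hz)
      (by fun_prop)
  rw [fr_eq_fr_zero, fr_eq_fr_zero x z] at h1
  filter_upwards [cy.eventually_const_lt h1.1, cy.eventually_lt cz h1.2] with p h2 h3
  exact sbtw_iff_fr.2 ⟨by rwa [fr_eq_fr_zero], by rwa [fr_eq_fr_zero, fr_eq_fr_zero p.1 p.2.2]⟩

/-- Openness of crossing is what lets noncrossing families pass to their closures. -/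
lemma isOpen_crosses :
    IsOpen {p : (Circ × Circ) × (Circ × Circ) | Crosses s(p.1.1, p.1.2) s(p.2.1, p.2.2)} := by
  simp only [crosses_mk_iff]
  refine IsOpen.union (IsOpen.inter ?_ ?_) (IsOpen.inter ?_ ?_)
  · exact isOpen_sbtw.preimage
      (f := fun p : (Circ × Circ) × (Circ × Circ) => (p.1.1, p.2.1, p.1.2)) (by fun_prop)
  · exact isOpen_sbtw.preimage
      (f := fun p : (Circ × Circ) × (Circ × Circ) => (p.1.2, p.2.2, p.1.1)) (by fun_prop)
  · exact isOpen_sbtw.preimage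
      (f := fun p : (Circ × Circ) × (Circ × Circ) => (p.1.1, p.2.2, p.1.2)) (by fun_prop)
  · exact isOpen_sbtw.preimage
      (f := fun p : (Circ × Circ) × (Circ × Circ) => (p.1.2, p.2.1, p.1.1)) (by fun_prop)

lemma exists_crosses_of_chordClosure {A B : Set Chord} {e f : Chord} (he : e ∈ chordClosure A)
    (hf : f ∈ chordClosure B) (h : Crosses e f) : ∃ e' ∈ A, ∃ f' ∈ B, Crosses e' f' := by
  obtain ⟨x, y, -, rfl, hx⟩ := he
  obtain ⟨z, w, -, rfl, hz⟩ := hf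
  have h1 : ((x, y), (z, w)) ∈ closure ({p : Circ × Circ | s(p.1, p.2) ∈ A} ×ˢ
      {p : Circ × Circ | s(p.1, p.2) ∈ B}) := by
    rw [closure_prod_eq]; exact ⟨hx, hz⟩
  obtain ⟨⟨p, q⟩, h2, h3⟩ := mem_closure_iff.1 h1 _ isOpen_crosses h
  exact ⟨_, h3.1, _, h3.2, h2⟩

lemma not_crosses_chordClosure {A : Set Chord} {f : Chord} (h : ∀ e ∈ A, ¬ Crosses e f) :
    ∀ e ∈ chordClosure A, ¬ Crosses e f := by
  intro e he hc
  have hf : ¬ f.IsDiag := by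
    intro hd
    obtain ⟨a, b, x, y, -, rfl, h1, h2⟩ := hc
    rw [Sym2.mk_isDiag_iff] at hd
    subst hd
    exact sbtw_asymm h1 h2
  obtain ⟨e', he', f', hf', hc'⟩ := exists_crosses_of_chordClosure he
    (mem_chordClosure_of_mem (mem_singleton f) hf) hc
  rw [mem_singleton_iff] at hf'
  exact h e' he' (hf' ▸ hc')

/-! ### Sets of chords invariant under the branches `br d b` -/

/-- A noncrossing set of chords that is forward invariant and consists of the images of its elements
under the branches `br d b j`. -/
structure BranchInvariant (d : ℕ) (b : Circ) (E : Set Chord) : Prop where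
  nondegenerate : ∀ e ∈ E, ¬ e.IsDiag
  noncrossing : ∀ e ∈ E, ∀ f ∈ E, ¬ Crosses e f
  forward : ∀ e ∈ E, chordIter d 1 e ∈ E
  map_mem : ∀ e ∈ E, ∀ j < d, Sym2.map (br d b j) e ∈ E
  eq_map : ∀ e ∈ E, ∃ j < d, Sym2.map (br d b j) (chordIter d 1 e) = e

/-- The coordinates, counted from `c`, of the ordered chords in `E`. -/
def frPairs (c : Circ) (E : Set Chord) : Set (ℝ × ℝ) :=
  (fun p : Circ × Circ => (fr c p.1, fr c p.2)) '' {p : Circ × Circ | s(p.1, p.2) ∈ E}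

/-- A branch `br d b j` jumps at `σ_d b`, while `brPt d b j` is continuous in the real coordinate.
Limits are therefore taken in the compact unit square, where the coordinates `0` and `1` of `σ_d b`
stay distinct. -/
lemma isCompact_closure_frPairs (c : Circ) (E : Set Chord) : IsCompact (closure (frPairs c E)) := by
  refine (isCompact_Icc (a := ((0, 0) : ℝ × ℝ)) (b := (1, 1))).closure_of_subset ?_
  rintro _ ⟨⟨p, q⟩, -, rfl⟩
  exact ⟨⟨fr_nonneg _ _, fr_nonneg _ _⟩, ⟨(fr_lt_one _ _).le, (fr_lt_one _ _).le⟩⟩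

lemma exists_closure_frPairs (c : Circ) {E : Set Chord} {x y : Circ}
    (h : (x, y) ∈ closure {p : Circ × Circ | s(p.1, p.2) ∈ E}) :
    ∃ r ∈ closure (frPairs c E), x = c + (r.1 : Circ) ∧ y = c + (r.2 : Circ) := by
  let Φ : ℝ × ℝ → Circ × Circ := fun r => (c + (r.1 : Circ), c + (r.2 : Circ))
  have hΦ : Continuous Φ := by
    have := AddCircle.continuous_mk' (1 : ℝ)
    exact (continuous_const.add (this.comp continuous_fst)).prodMk
      (continuous_const.add (this.comp continuous_snd))
  have h1 : closure {p : Circ × Circ | s(p.1, p.2) ∈ E} ⊆ Φ '' closure (frPairs c E) := by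
    refine closure_minimal ?_ ((isCompact_closure_frPairs c E).image hΦ).isClosed
    rintro ⟨p, q⟩ hpq
    exact ⟨(fr c p, fr c q), subset_closure ⟨(p, q), hpq, rfl⟩, by simp [Φ, add_fr]⟩
  obtain ⟨r, hr, h2⟩ := h1 h
  simp only [Φ, Prod.mk.injEq] at h2
  exact ⟨r, hr, h2.1.symm, h2.2.symm⟩

section
variable {d : ℕ} {b : Circ} {E : Set Chord}

/-- The `j`-th preimage in terms of coordinates. -/
def brPt (d : ℕ) (b : Circ) (j : ℕ) (r : ℝ) : Circ := b + (((j + r) / d : ℝ) : Circ)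

lemma brPt_fr (j : ℕ) (w : Circ) : brPt d b j (fr (sigma d b) w) = br d b j w := rfl

lemma continuous_brPt (j : ℕ) : Continuous (brPt d b j) := by
  have := AddCircle.continuous_mk' (1 : ℝ)
  exact continuous_const.add (this.comp (by fun_prop))

lemma sigma_brPt (hd : 0 < d) (j : ℕ) (r : ℝ) : sigma d (brPt d b j r) = sigma d b + (r : Circ) := by
  have hd' : (d : ℝ) ≠ 0 := by positivity
  rw [brPt, sigma_add_coe, mul_div_cancel₀ _ hd', AddCircle.coe_add, coe_nat_eq_zero, zero_add]

lemma brPt_mem_closure (hE : BranchInvariant d b E) {j : ℕ} (hj : j < d) {r : ℝ × ℝ}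
    (hr : r ∈ closure (frPairs (sigma d b) E)) :
    (brPt d b j r.1, brPt d b j r.2) ∈ closure {p : Circ × Circ | s(p.1, p.2) ∈ E} := by
  have h1 : MapsTo (fun r : ℝ × ℝ => (brPt d b j r.1, brPt d b j r.2)) (frPairs (sigma d b) E)
      {p : Circ × Circ | s(p.1, p.2) ∈ E} := by
    rintro _ ⟨⟨p, q⟩, hpq, rfl⟩
    exact hE.map_mem _ hpq j hj
  have c := continuous_brPt (d := d) (b := b) j
  exact h1.closure ((c.comp continuous_fst).prodMk (c.comp continuous_snd)) hr

lemma exists_brPt_of_mem_closure (hd : 0 < d) (hE : BranchInvariant d b E) {x y : Circ}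
    (h : (x, y) ∈ closure {p : Circ × Circ | s(p.1, p.2) ∈ E}) :
    ∃ j < d, ∃ r ∈ closure (frPairs (sigma d b) E), x = brPt d b j r.1 ∧ y = brPt d b j r.2 := by
  have h1 : closure {p : Circ × Circ | s(p.1, p.2) ∈ E} ⊆
      ⋃ j : Fin d, (fun r : ℝ × ℝ => (brPt d b j r.1, brPt d b j r.2)) ''
        closure (frPairs (sigma d b) E) := by
    refine closure_minimal ?_ (isClosed_iUnion_of_finite fun j => ?_)
    · rintro ⟨p, q⟩ hpq
      obtain ⟨j, hj, h2⟩ := hE.eq_map _ hpq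
      have h3 := eq_of_map_eq (fun y => sigma_br hd j y) h2
      refine mem_iUnion.2 ⟨⟨j, hj⟩, (fr (sigma d b) (sigma d p), fr (sigma d b) (sigma d q)),
        subset_closure ⟨(sigma d p, sigma d q), hE.forward _ hpq, rfl⟩, ?_⟩
      simp only [brPt_fr, h3]
    · have c := continuous_brPt (d := d) (b := b) j
      exact ((isCompact_closure_frPairs _ E).image
        ((c.comp continuous_fst).prodMk (c.comp continuous_snd))).isClosed
  obtain ⟨j, r, hr, h2⟩ := mem_iUnion.1 (h1 h)
  simp only [Prod.mk.injEq] at h2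
  exact ⟨j, j.2, r, hr, h2.1.symm, h2.2.symm⟩

lemma isLamination_chordClosure (hE : BranchInvariant d b E) : IsLamination (chordClosure E) where
  nondegenerate _ he := not_isDiag_of_mem_chordClosure he
  noncrossing e he f hf h := by
    obtain ⟨e', he', f', hf', h'⟩ := exists_crosses_of_chordClosure he hf h
    exact hE.noncrossing e' he' f' hf' h'
  closed := chordClosure_subset_of subset_rfl

lemma forward_chordClosure (hE : ∀ e ∈ E, chordIter d 1 e ∈ E) {e : Chord}
    (he : e ∈ chordClosure E) :
    (chordIter d 1 e).IsDiag ∨ chordIter d 1 e ∈ chordClosure E := by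
  obtain ⟨x, y, -, rfl, hcl⟩ := he
  refine or_iff_not_imp_left.2 fun h => mk_mem_chordClosure.2 ⟨by simpa using h, ?_⟩
  have h1 : MapsTo (fun p : Circ × Circ => (sigma d p.1, sigma d p.2))
      {p : Circ × Circ | s(p.1, p.2) ∈ E} {p : Circ × Circ | s(p.1, p.2) ∈ E} :=
    fun p hp => hE _ hp
  have c := continuous_sigma d
  exact h1.closure ((c.comp continuous_fst).prodMk (c.comp continuous_snd)) hcl

lemma backward_chordClosure (hd : 0 < d) (hE : BranchInvariant d b E) {e : Chord}
    (he : e ∈ chordClosure E) : ∃ f ∈ chordClosure E, chordIter d 1 f = e := by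
  obtain ⟨x, y, hne, rfl, hcl⟩ := he
  obtain ⟨r, hr, hx, hy⟩ := exists_closure_frPairs (sigma d b) hcl
  -- Every branch provides a preimage; number `0` is as good as any.
  have hs : chordIter d 1 s(brPt d b 0 r.1, brPt d b 0 r.2) = s(x, y) := by
    simp only [chordIter_mk, iterate_one, sigma_brPt hd, hx, hy]
  refine ⟨s(brPt d b 0 r.1, brPt d b 0 r.2), mk_mem_chordClosure.2 ⟨fun h => hne ?_,
    brPt_mem_closure hE hd hr⟩, hs⟩
  rw [hx, hy, ← sigma_brPt hd 0, ← sigma_brPt hd 0, h]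

lemma brPt_ne (hd : 0 < d) {i j : ℕ} (hi : i < d) (hj : j < d) (hij : i ≠ j) (r : ℝ) :
    brPt d b i r ≠ brPt d b j r := by
  have hd' : (0 : ℝ) < d := by exact_mod_cast hd
  intro h
  rw [brPt, brPt, add_right_inj, coe_eq_coe_iff] at h
  obtain ⟨n, hn⟩ := h
  have h1 : (i : ℝ) = j + n * d := by
    field_simp at hn; linarith
  have h2 : (i : ℤ) = j + n * d := by exact_mod_cast h1
  have h3 : n = 0 := by nlinarith [sq_nonneg n, (by omega : (i : ℤ) < d), (by omega : (j : ℤ) < d)]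
  subst h3; omega

/-- All siblings come from one limit pair `r` of coordinates, through the `d` maps `brPt d b i`.
Each is a limit of leaves, and corresponding ends differ by proper multiples of `1/d`. -/
lemma sibling_chordClosure (hd : 0 < d) (hE : BranchInvariant d b E) {e : Chord}
    (he : e ∈ chordClosure E) (hs : ¬ (chordIter d 1 e).IsDiag) :
    ∃ f : Fin d → Chord, (∃ i, f i = e) ∧ (∀ i, f i ∈ chordClosure E) ∧
      (∀ i, chordIter d 1 (f i) = chordIter d 1 e) ∧
      ∀ i j, i ≠ j → ChordsDisjoint (f i) (f j) := by
  obtain ⟨x, y, hne, rfl, hcl⟩ := he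
  obtain ⟨j, hj, r, hr, hx, hy⟩ := exists_brPt_of_mem_closure hd hE hcl
  have hne' : sigma d b + (r.1 : Circ) ≠ sigma d b + (r.2 : Circ) := by
    rw [← sigma_brPt hd j, ← sigma_brPt hd j, ← hx, ← hy]
    simpa using hs
  have hmem : ∀ i : Fin d, s(brPt d b i r.1, brPt d b i r.2) ∈ chordClosure E := fun i =>
    mk_mem_chordClosure.2 ⟨fun h => hne' (by
      rw [← sigma_brPt hd i, ← sigma_brPt hd i, h]), brPt_mem_closure hE i.2 hr⟩
  refine ⟨fun i => s(brPt d b i r.1, brPt d b i r.2), ⟨⟨j, hj⟩, by simp [hx, hy]⟩, hmem,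
    fun i => by simp [hx, hy, sigma_brPt hd], fun i k hik => ⟨?_, fun h => ?_⟩⟩
  · have hik' : (i : ℕ) ≠ k := fun h => hik (Fin.ext h)
    have h12 : ∀ i k : Fin d, brPt d b i r.1 ≠ brPt d b k r.2 := by
      intro i k h
      apply hne'
      rw [← sigma_brPt hd i, h, sigma_brPt hd]
    intro z hz hz'
    rw [Sym2.mem_iff] at hz hz'
    rcases hz with rfl | rfl <;> rcases hz' with h | h
    · exact brPt_ne hd i.2 k.2 hik' _ h
    · exact h12 _ _ h
    · exact h12 _ _ h.symm
    · exact brPt_ne hd i.2 k.2 hik' _ h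
  · exact (isLamination_chordClosure hE).noncrossing _ (hmem i) _ (hmem k) h

end

/-! ### All critical `d`-gons -/

/-- The arc may end at `c` itself (`B = 1`), where the coordinate jumps back to `0`. The last
clauses prevent an end at `c` from then counting as a point outside the closed arc. -/
lemma crosses_arc_iff {c x y : Circ} {A B : ℝ} (hA : 0 ≤ A) (hAB : A < B) (hB : B ≤ 1)
    (hBA : B - A < 1) :
    Crosses s(c + (A : Circ), c + (B : Circ)) s(x, y) ↔
      (A < fr c x ∧ fr c x < B ∧ (fr c y < A ∨ B < fr c y) ∧ (B = 1 → fr c y ≠ 0)) ∨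
      (A < fr c y ∧ fr c y < B ∧ (fr c x < A ∨ B < fr c x) ∧ (B = 1 → fr c x ≠ 0)) := by
  have hx := fr_nonneg c x; have hy := fr_nonneg c y
  have hx1 := fr_lt_one c x; have hy1 := fr_lt_one c y
  rw [crosses_iff_coord c, fr_add_coe hA (by linarith), RCross]
  rcases hB.lt_or_eq with h | h
  · rw [fr_add_coe (by linarith) h, min_eq_left hAB.le, max_eq_right hAB.le]
    simp [h.ne]
  · have hA' : 0 < A := by linarith
    have e : fr c (c + (B : Circ)) = 0 := by rw [h, coe_one_eq_zero, add_zero, fr_self]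
    rw [e, min_eq_right hA, max_eq_left hA]
    simp only [h, true_implies]
    constructor
    · rintro (⟨h1, h2, h3 | h3⟩ | ⟨h1, h2, h3 | h3⟩)
      · linarith
      · exact Or.inr ⟨h3, hy1, Or.inl h2, h1.ne'⟩
      · linarith
      · exact Or.inl ⟨h3, hx1, Or.inl h2, h1.ne'⟩
    · rintro (⟨h1, h2, h3 | h3, h4⟩ | ⟨h1, h2, h3 | h3, h4⟩)
      · exact Or.inr ⟨lt_of_le_of_ne hy h4.symm, h3, Or.inr h1⟩
      · linarith
      · exact Or.inl ⟨lt_of_le_of_ne hx h4.symm, h3, Or.inr h1⟩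
      · linarith

/-- The all critical `d`-gon with vertex `c`. -/
def critGon (d : ℕ) (c : Circ) : Set Circ := {x | sigma d x = sigma d c}

section
variable {d : ℕ} {c : Circ}

lemma brPt_zero_of_sigma_eq (hd : 0 < d) {x : Circ} (hx : sigma d x = sigma d c) :
    x = brPt d c (idx d c x) 0 := by
  conv_lhs => rw [← br_idx (b := c) hd x, hx, ← brPt_fr, fr_self]

lemma brPt_one (j : ℕ) : brPt d c j 1 = brPt d c (j + 1) 0 := by
  rw [brPt, brPt]; push_cast; rw [add_zero]

lemma brPt_self (hd : 0 < d) (r : ℝ) : brPt d c d r = brPt d c 0 r := by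
  have hd' : (d : ℝ) ≠ 0 := by positivity
  rw [brPt, brPt, add_right_inj, coe_eq_coe_iff]
  exact ⟨1, by field_simp; push_cast; ring⟩

lemma fr_brPt {j : ℕ} (hj : j < d) {r : ℝ} (h0 : 0 ≤ r) (h1 : r < 1) :
    fr c (brPt d c j r) = (j + r) / d := by
  have hd : (0 : ℝ) < d := by exact_mod_cast (by omega : 0 < d)
  have hj' : (j : ℝ) + 1 ≤ d := by exact_mod_cast hj
  apply fr_add_coe
  · positivity
  · rw [div_lt_one hd]; linarith

lemma brPt_zero_zero : brPt d c 0 0 = c := by simp [brPt]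

lemma sigma_brPt_zero (hd : 0 < d) (j : ℕ) : sigma d (brPt d c j 0) = sigma d c := by
  rw [sigma_brPt hd]; simp

lemma critGon_eq_range (hd : 0 < d) :
    critGon d c = (fun j : Fin d => brPt d c j 0) '' univ := by
  ext x
  constructor
  · intro hx
    exact ⟨⟨idx d c x, idx_lt hd x⟩, mem_univ _, (brPt_zero_of_sigma_eq hd hx).symm⟩
  · rintro ⟨j, -, rfl⟩
    exact sigma_brPt_zero hd j

lemma ncard_critGon (hd : 0 < d) : (critGon d c).ncard = d := by
  rw [critGon_eq_range hd, ncard_image_of_injective, ncard_univ, Nat.card_fin]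
  intro i j hij
  by_contra h
  exact brPt_ne hd i.2 j.2 (fun h' => h (Fin.ext h')) 0 hij

lemma allCritical_critGon : AllCritical d (critGon d c) := by
  intro x hx y hy
  exact Eq.trans hx (Eq.symm hy)

lemma finite_critGon (hd : 0 < d) : (critGon d c).Finite := by
  rw [critGon_eq_range hd]; exact finite_univ.image _

/-- Fibres of `σ_d` have exactly `d` points, so an all critical set of `d` points is a whole fibre.
-/
lemma eq_critGon (hd : 0 < d) {Q : Set Circ} (hQ : Q.ncard = d) (hc : AllCritical d Q)
    {q : Circ} (hq : q ∈ Q) : Q = critGon d q := by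
  apply Set.eq_of_subset_of_ncard_le
  · intro x hx; exact hc x hx q hq
  · rw [hQ, ncard_critGon hd]
  · exact finite_critGon hd

lemma consecutive_critGon_iff (hd : 2 ≤ d) {x y : Circ} :
    Consecutive (critGon d c) x y ↔ ∃ j < d, x = brPt d c j 0 ∧ y = brPt d c j 1 := by
  have hd0 : 0 < d := by omega
  have hdr : (0 : ℝ) < d := by exact_mod_cast hd0
  have hd2 : (2 : ℝ) ≤ d := by exact_mod_cast hd
  have hfr : ∀ j : ℕ, ∀ r : ℝ, 0 ≤ r → r ≤ 1 →
      fr (brPt d c j 0) (brPt d c j r) = r / d := by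
    intro j r h0 h1
    have : brPt d c j r = brPt d c j 0 + ((r / d : ℝ) : Circ) := by
      rw [brPt, brPt, add_assoc, ← AddCircle.coe_add]; congr 2; ring
    rw [this]
    exact fr_add_coe (by positivity) (by rw [div_lt_one hdr]; linarith)
  have key : ∀ j < d, Consecutive (critGon d c) (brPt d c j 0) (brPt d c j 1) := by
    intro j hj
    refine ⟨sigma_brPt_zero hd0 j, ?_, ?_, ?_⟩
    · rw [brPt_one]; exact sigma_brPt_zero hd0 _
    · rw [brPt_one]
      intro h
      have h1 := hfr j 1 zero_le_one le_rfl
      rw [brPt_one, ← h, fr_self] at h1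
      have : (0 : ℝ) < 1 / d := by positivity
      linarith
    · intro z hz h
      rw [sbtw_iff_fr, hfr j 1 zero_le_one le_rfl] at h
      have hz' : sigma d z = sigma d (brPt d c j 0) := by
        rw [sigma_brPt_zero hd0]; exact hz
      have h2 := fr_eq_idx (b := brPt d c j 0) hd0 z
      rw [hz', fr_self, add_zero] at h2
      rw [h2] at h
      have h3 := (div_lt_div_iff_of_pos_right hdr).1 h.2
      have h4 := (div_pos_iff_of_pos_right hdr).1 h.1
      have h5 : idx d (brPt d c j 0) z < 1 := by exact_mod_cast h3
      have h6 : 0 < idx d (brPt d c j 0) z := by exact_mod_cast h4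
      omega
  refine ⟨fun h => ?_, fun ⟨j, hj, hx, hy⟩ => hx ▸ hy ▸ key j hj⟩
  have hx := brPt_zero_of_sigma_eq hd0 h.1
  set j := idx d c x
  refine ⟨j, idx_lt hd0 x, hx, ?_⟩
  by_contra hne
  have h1 := h.2.2.2 _ (key j (idx_lt hd0 x)).2.1
  have h2 := (key j (idx_lt hd0 x)).2.2.2 y h.2.1
  rw [← hx] at h2
  rw [sbtw_iff_fr] at h1 h2
  have h3 : 0 < fr x (brPt d c j 1) := fr_pos.2 (by
    have := (key j (idx_lt hd0 x)).2.2.1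
    rw [← hx] at this; exact this.symm)
  have h4 : 0 < fr x y := fr_pos.2 h.2.2.1.symm
  have h5 : fr x (brPt d c j 1) = fr x y := by
    by_contra h6
    rcases lt_or_gt_of_ne h6 with h6 | h6
    · exact h1 ⟨h3, h6⟩
    · exact h2 ⟨h4, h6⟩
  exact hne (fr_inj.1 h5).symm

lemma mem_sides_critGon_iff (hd : 2 ≤ d) {e : Chord} :
    e ∈ sides (critGon d c) ↔ ∃ j < d, e = s(brPt d c j 0, brPt d c j 1) := by
  constructor
  · rintro ⟨x, y, h, rfl⟩
    obtain ⟨j, hj, rfl, rfl⟩ := (consecutive_critGon_iff hd).1 h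
    exact ⟨j, hj, rfl⟩
  · rintro ⟨j, hj, rfl⟩
    exact ⟨_, _, (consecutive_critGon_iff hd).2 ⟨j, hj, rfl, rfl⟩, rfl⟩

lemma vertices_sides_critGon (hd : 2 ≤ d) : vertices (sides (critGon d c)) = critGon d c := by
  have hd0 : 0 < d := by omega
  ext x
  constructor
  · rintro ⟨e, he, hx⟩
    obtain ⟨j, hj, rfl⟩ := (mem_sides_critGon_iff hd).1 he
    rw [Sym2.mem_iff] at hx
    rcases hx with rfl | rfl
    · exact sigma_brPt_zero hd0 j
    · rw [brPt_one]; exact sigma_brPt_zero hd0 _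
  · intro hx
    refine ⟨s(brPt d c (idx d c x) 0, brPt d c (idx d c x) 1),
      (mem_sides_critGon_iff hd).2 ⟨_, idx_lt hd0 x, rfl⟩, ?_⟩
    rw [← brPt_zero_of_sigma_eq hd0 hx]
    exact Sym2.mem_mk_left _ _

lemma crosses_side_iff (hd : 2 ≤ d) {j : ℕ} (hj : j < d) {x y : Circ} :
    Crosses s(brPt d c j 0, brPt d c j 1) s(x, y) ↔
      (j < d * fr c x ∧ d * fr c x < j + 1 ∧ (d * fr c y < j ∨ j + 1 < d * fr c y) ∧
        (j + 1 = d → y ≠ c)) ∨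
      (j < d * fr c y ∧ d * fr c y < j + 1 ∧ (d * fr c x < j ∨ j + 1 < d * fr c x) ∧
        (j + 1 = d → x ≠ c)) := by
  have hdr : (0 : ℝ) < d := by exact_mod_cast (by omega : 0 < d)
  have hd2 : (2 : ℝ) ≤ d := by exact_mod_cast hd
  have hj' : (j : ℝ) + 1 ≤ d := by exact_mod_cast hj
  have h1 := crosses_arc_iff (c := c) (x := x) (y := y) (A := (j + 0) / d) (B := (j + 1) / d)
    (by positivity) (by rw [div_lt_div_iff_of_pos_right hdr]; linarith)
    (by rw [div_le_one hdr]; exact hj')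
    (by rw [← sub_div, div_lt_one hdr]; linarith)
  have e1 : ((j : ℝ) + 1) / d = 1 ↔ j + 1 = d := by
    rw [div_eq_one_iff_eq hdr.ne']; norm_cast
  rw [brPt, brPt, h1]
  simp only [add_zero, e1, ne_eq, fr_eq_zero, lt_div_iff₀ hdr, div_lt_iff₀ hdr, mul_comm (fr c _)]

lemma not_crosses_side_of_idx_eq (hd : 2 ≤ d) {j : ℕ} (hj : j < d) {x y : Circ}
    (h : idx d c x = idx d c y) : ¬ Crosses s(brPt d c j 0, brPt d c j 1) s(x, y) := by
  have hd0 : 0 < d := by omega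
  have hdr : (0 : ℝ) < d := by exact_mod_cast hd0
  have ex := fr_eq_idx (b := c) hd0 x
  have ey := fr_eq_idx (b := c) hd0 y
  rw [eq_div_iff hdr.ne', mul_comm] at ex ey
  have hx0 := fr_nonneg (sigma d c) (sigma d x); have hx1 := fr_lt_one (sigma d c) (sigma d x)
  have hy0 := fr_nonneg (sigma d c) (sigma d y); have hy1 := fr_lt_one (sigma d c) (sigma d y)
  rw [crosses_side_iff hd hj, ex, ey, ← h]
  rcases lt_trichotomy j (idx d c x) with h1 | h1 | h1
  · have : (j : ℝ) + 1 ≤ idx d c x := by exact_mod_cast h1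
    rintro (h | h) <;> linarith [h.2.1]
  · rw [h1]
    rintro (⟨-, -, h | h, -⟩ | ⟨-, -, h | h, -⟩) <;> linarith
  · have : (idx d c x : ℝ) + 1 ≤ j := by exact_mod_cast h1
    rintro (h | h) <;> linarith [h.1]

/-- Only the side over the arc of `t` needs testing. The second alternative is the right end of that
arc, which the half-open numbering gives to the next arc. -/
lemma mem_sector_critGon (hd : 2 ≤ d) {t x : Circ} (ht : t ∉ critGon d c)
    (hx : x ∈ sector (sides (critGon d c)) t) :
    idx d c x = idx d c t ∨ x = brPt d c (idx d c t) 1 := by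
  have hd0 : 0 < d := by omega
  have hdr : (0 : ℝ) < d := by exact_mod_cast hd0
  have hj := idx_lt (b := c) hd0 t
  have h1 := hx _ ((mem_sides_critGon_iff hd).2 ⟨idx d c t, hj, rfl⟩)
  rw [crosses_side_iff hd hj] at h1
  have et := fr_eq_idx (b := c) hd0 t
  have ex := fr_eq_idx (b := c) hd0 x
  rw [eq_div_iff hdr.ne', mul_comm] at et ex
  have ht0 : 0 < fr (sigma d c) (sigma d t) := fr_pos.2 ht
  have ht1 := fr_lt_one (sigma d c) (sigma d t)
  have hx0 := fr_nonneg (sigma d c) (sigma d x); have hx1 := fr_lt_one (sigma d c) (sigma d x)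
  by_contra hne
  push Not at hne
  apply h1
  left
  refine ⟨by rw [et]; linarith, by rw [et]; linarith, ?_, ?_⟩
  · by_contra h2
    push Not at h2
    rcases lt_trichotomy (idx d c x) (idx d c t) with h3 | h3 | h3
    · have : (idx d c x : ℝ) + 1 ≤ idx d c t := by exact_mod_cast h3
      linarith [h2.1]
    · exact hne.1 h3
    · have : (idx d c t : ℝ) + 1 ≤ idx d c x := by exact_mod_cast h3
      have h5 : fr (sigma d c) (sigma d x) = 0 := by linarith [h2.2]
      have h6 : (idx d c x : ℝ) = idx d c t + 1 := by linarith [h2.2]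
      have h7 : idx d c x = idx d c t + 1 := by exact_mod_cast h6
      apply hne.2
      rw [brPt_one, ← h7, ← brPt_zero_of_sigma_eq hd0 (fr_eq_zero.1 h5)]
  · intro h2 h3
    apply hne.2
    rw [h3, brPt_one, h2, brPt_self hd0, brPt_zero_zero]

end

/-! ### Leaves with orbit in the arcs of length `β/d < 1/d` -/

/-- The canonical branches, indexed by `Fin d`. -/
def brF (d : ℕ) (b : Circ) : Fin d → Circ → Circ := fun i => br d b i

/-- The leaf joining `b` to `a = b + β/d` is periodic with noncrossing orbit, and each element of the
orbit lies in one of the arcs `[b + j/d, b + (j+β)/d]`. -/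
structure MACFrame (d : ℕ) (a b : Circ) (β : ℝ) : Prop where
  two_le : 2 ≤ d
  pos : 0 < β
  lt_one : β < 1
  eq_add : a = b + ((β / d : ℝ) : Circ)
  periodic : ∃ n, 0 < n ∧ (sigma d)^[n] a = a ∧ (sigma d)^[n] b = b
  low : ∀ k, fr (sigma d b) ((sigma d)^[k] a) ≤ β ∧ fr (sigma d b) ((sigma d)^[k] b) ≤ β
  same : ∀ k, idx d b ((sigma d)^[k] a) = idx d b ((sigma d)^[k] b)
  noncrossing : ∀ i j, ¬ Crosses (chordIter d i s(a, b)) (chordIter d j s(a, b))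

/-- The pullback of the orbit of the leaf `s(a, b)` under the canonical branches. -/
def macPullback (d : ℕ) (a b : Circ) : Set Chord := pullback (brF d b) (forwardOrbit d {s(a, b)})

lemma mem_forwardOrbit_singleton {d : ℕ} {M e : Chord} :
    e ∈ forwardOrbit d {M} ↔ ∃ k, e = chordIter d k M := by
  simp [forwardOrbit]

lemma sigma_brF {d : ℕ} (hd : 0 < d) (b : Circ) (i : Fin d) (y : Circ) :
    sigma d (brF d b i y) = y := sigma_br hd i y

lemma iterate_mul_of_fixed {α : Type*} {f : α → α} {x : α} {n : ℕ} (h : f^[n] x = x) (m : ℕ) :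
    f^[m * n] x = x := by
  rw [mul_comm, iterate_mul]
  exact iterate_fixed h m

/-- Under a common period, a periodic point is recovered from its image by further iteration. -/
lemma eq_of_periodic {α : Type*} {f : α → α} {x y : α} (hx : x ∈ periodicPts f)
    (hy : y ∈ periodicPts f) (h : f x = f y) : x = y := by
  obtain ⟨m, hm, hx⟩ := hx
  obtain ⟨n, hn, hy⟩ := hy
  have h1 : f^[m * n] x = x := by rw [mul_comm]; exact iterate_mul_of_fixed hx n
  have h2 : f^[m * n] y = y := iterate_mul_of_fixed hy m
  obtain ⟨k, hk⟩ : ∃ k, m * n = k + 1 := ⟨m * n - 1, by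
    have := Nat.mul_pos hm hn; omega⟩
  rw [← h1, ← h2, hk, iterate_succ_apply, iterate_succ_apply, h]

lemma iterate_mem_periodicPts {α : Type*} {f : α → α} {x : α} (hx : x ∈ periodicPts f) (k : ℕ) :
    f^[k] x ∈ periodicPts f := by
  obtain ⟨m, hm, hx⟩ := hx
  exact ⟨m, hm, hx.apply_iterate k⟩

section
variable {d : ℕ} {a b : Circ} {β : ℝ}

/-- On one arc `σ_d` has slope `d`, and a difference of coordinates of at most `1/d ≤ 1/2` is the
length itself. -/
lemma chordLength_of_idx_eq (hd : 2 ≤ d) {x y : Circ} (h : idx d b x = idx d b y) :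
    ‖x - y‖ = |fr (sigma d b) (sigma d x) - fr (sigma d b) (sigma d y)| / d := by
  have hd0 : 0 < d := by omega
  have hdr : (0 : ℝ) < d := by exact_mod_cast hd0
  have hd2 : (2 : ℝ) ≤ d := by exact_mod_cast hd
  rw [norm_sub_eq b, fr_eq_idx hd0 x, fr_eq_idx hd0 y, h, ← sub_div, add_sub_add_left_eq_sub,
    abs_div, abs_of_pos hdr, min_eq_left]
  have h1 : |fr (sigma d b) (sigma d x) - fr (sigma d b) (sigma d y)| ≤ 1 := by
    have := fr_nonneg (sigma d b) (sigma d x); have := fr_lt_one (sigma d b) (sigma d x)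
    have := fr_nonneg (sigma d b) (sigma d y); have := fr_lt_one (sigma d b) (sigma d y)
    rw [abs_le]; constructor <;> linarith
  have h2 : |fr (sigma d b) (sigma d x) - fr (sigma d b) (sigma d y)| / d ≤ 1 / 2 := by
    rw [div_le_div_iff₀ hdr two_pos]; linarith
  linarith

namespace MACFrame

variable (h : MACFrame d a b β)
include h

lemma d_pos : 0 < d := by have := h.two_le; omega

lemma d_posR : (0 : ℝ) < d := by exact_mod_cast h.d_pos

lemma fr_a : fr b a = β / d := by
  have h1 := h.pos; have h2 := h.lt_one; have h3 := h.d_posR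
  have h4 : (2 : ℝ) ≤ d := by exact_mod_cast h.two_le
  exact fr_eq_of (by positivity) (by rw [div_lt_one h3]; linarith) h.eq_add

lemma fr_sigma_a : fr (sigma d b) (sigma d a) = β := by
  rw [fr_sigma, h.fr_a, mul_div_cancel₀ _ h.d_posR.ne']
  exact Int.fract_eq_self.2 ⟨h.pos.le, h.lt_one⟩

lemma idx_a : idx d b a = 0 := by
  rw [idx, h.fr_a, mul_div_cancel₀ _ h.d_posR.ne']
  exact Nat.floor_eq_zero.2 h.lt_one

omit h in
lemma idx_b : idx d b b = 0 := by simp [idx, fr_self]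

lemma ne : a ≠ b := by
  intro h1
  have h2 := h.fr_a
  rw [h1, fr_self] at h2
  have : 0 < β / d := div_pos h.pos h.d_posR
  linarith

lemma a_periodic : a ∈ periodicPts (sigma d) := by
  obtain ⟨n, hn, ha, -⟩ := h.periodic
  exact ⟨n, hn, ha⟩

lemma b_periodic : b ∈ periodicPts (sigma d) := by
  obtain ⟨n, hn, -, hb⟩ := h.periodic
  exact ⟨n, hn, hb⟩

lemma iterate_ne (k : ℕ) : (sigma d)^[k] a ≠ (sigma d)^[k] b := by
  induction k with
  | zero => exact h.ne
  | succ k ih =>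
    rw [iterate_succ_apply', iterate_succ_apply']
    exact fun h1 => ih (eq_of_periodic (iterate_mem_periodicPts h.a_periodic k)
      (iterate_mem_periodicPts h.b_periodic k) h1)

lemma orbit_nondegenerate : ∀ e ∈ forwardOrbit d {s(a, b)}, ¬ e.IsDiag := by
  intro e he
  obtain ⟨k, rfl⟩ := mem_forwardOrbit_singleton.1 he
  simpa using h.iterate_ne k

lemma orbit_fixed : ∀ e ∈ forwardOrbit d {s(a, b)},
    ∃ i, Sym2.map (brF d b i) (chordIter d 1 e) = e := by
  intro e he
  obtain ⟨k, rfl⟩ := mem_forwardOrbit_singleton.1 he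
  refine ⟨⟨_, idx_lt (b := b) h.d_pos ((sigma d)^[k] a)⟩, ?_⟩
  simp only [chordIter_mk, iterate_one, Sym2.map_mk, brF]
  rw [br_idx h.d_pos, h.same k, br_idx h.d_pos]

lemma orbit_pred {e : Chord} (he : e ∈ forwardOrbit d {s(a, b)}) :
    ∃ e' ∈ forwardOrbit d {s(a, b)}, chordIter d 1 e' = e := by
  obtain ⟨k, rfl⟩ := mem_forwardOrbit_singleton.1 he
  obtain ⟨n, hn, ha, hb⟩ := h.periodic
  refine ⟨chordIter d (k + (n - 1)) s(a, b), mem_forwardOrbit_singleton.2 ⟨_, rfl⟩, ?_⟩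
  rw [← chordIter_add, show 1 + (k + (n - 1)) = k + n by omega, chordIter_add]
  simp [ha, hb]

lemma orbit_periodic {e : Chord} (he : e ∈ forwardOrbit d {s(a, b)}) {x : Circ} (hx : x ∈ e) :
    x ∈ periodicPts (sigma d) := by
  obtain ⟨k, rfl⟩ := mem_forwardOrbit_singleton.1 he
  rw [chordIter_mk, Sym2.mem_iff] at hx
  rcases hx with rfl | rfl
  · exact iterate_mem_periodicPts h.a_periodic k
  · exact iterate_mem_periodicPts h.b_periodic k

lemma orbit_low {e : Chord} (he : e ∈ forwardOrbit d {s(a, b)}) {x : Circ} (hx : x ∈ e) :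
    fr (sigma d b) x ≤ β := by
  obtain ⟨k, rfl⟩ := mem_forwardOrbit_singleton.1 he
  rw [chordIter_mk, Sym2.mem_iff] at hx
  rcases hx with rfl | rfl
  · exact (h.low k).1
  · exact (h.low k).2

lemma macPullback_eq_map {e : Chord} (he : e ∈ macPullback d a b) :
    ∃ i, Sym2.map (brF d b i) (chordIter d 1 e) = e :=
  exists_eq_map (sigma_brF h.d_pos b) h.orbit_fixed he

lemma idx_eq_of_mem {x y : Circ} (he : s(x, y) ∈ macPullback d a b) : idx d b x = idx d b y := by
  obtain ⟨i, hi⟩ := h.macPullback_eq_map he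
  have h1 := eq_of_map_eq (fun y => sigma_brF h.d_pos b i y) hi
  rw [← h1.1, ← h1.2, brF, idx_br i.2, idx_br i.2]

lemma forward_macPullback {e : Chord} (he : e ∈ macPullback d a b) :
    chordIter d 1 e ∈ macPullback d a b :=
  chordIter_mem_pullback (sigma_brF h.d_pos b) (fun _ he => chordIter_mem_forwardOrbit he 1) he

/-- Both leaves are mapped forward until they lie in the orbit, where nothing crosses. Going back
one step, leaves from the same branch keep their relative position and leaves from different
branches lie in disjoint arcs. -/
lemma noncrossing_macPullback : ∀ e ∈ macPullback d a b, ∀ f ∈ macPullback d a b,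
    ¬ Crosses e f := by
  have key : ∀ m, ∀ e ∈ macPullback d a b, ∀ f ∈ macPullback d a b,
      chordIter d m e ∈ forwardOrbit d {s(a, b)} → chordIter d m f ∈ forwardOrbit d {s(a, b)} →
      ¬ Crosses e f := by
    intro m
    induction m with
    | zero =>
      intro e _ f _ he hf
      rw [chordIter_zero] at he hf
      obtain ⟨i, rfl⟩ := mem_forwardOrbit_singleton.1 he
      obtain ⟨j, rfl⟩ := mem_forwardOrbit_singleton.1 hf
      exact h.noncrossing i j
    | succ m ih =>
      intro e he f hf he' hf'
      obtain ⟨i, hi⟩ := h.macPullback_eq_map he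
      obtain ⟨j, hj⟩ := h.macPullback_eq_map hf
      rw [← hi, ← hj]
      by_cases hij : i = j
      · subst hij
        rw [brF, crosses_map_br i.2]
        exact ih _ (h.forward_macPullback he) _ (h.forward_macPullback hf)
          (by rwa [← chordIter_succ]) (by rwa [← chordIter_succ])
      · exact not_crosses_map_br i.2 j.2 (fun h => hij (Fin.ext h)) _ _
  intro e he f hf
  obtain ⟨m, hm⟩ := exists_chordIter_mem (sigma_brF h.d_pos b) he
  obtain ⟨n, hn⟩ := exists_chordIter_mem (sigma_brF h.d_pos b) hf
  -- The orbit is forward invariant, so one number of iterates serves both leaves.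
  refine key (n + m) e he f hf ?_ ?_
  · rw [chordIter_add]; exact chordIter_mem_forwardOrbit hm n
  · rw [add_comm, chordIter_add]; exact chordIter_mem_forwardOrbit hn m

lemma branchInvariant : BranchInvariant d b (macPullback d a b) where
  nondegenerate _ he :=
    not_isDiag_of_mem_pullback (sigma_brF h.d_pos b) h.orbit_nondegenerate he
  noncrossing := h.noncrossing_macPullback
  forward _ he := h.forward_macPullback he
  map_mem _ he j hj := map_mem_pullback (τ := brF d b) he ⟨j, hj⟩
  eq_map _ he := by
    obtain ⟨i, hi⟩ := h.macPullback_eq_map he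
    exact ⟨i, i.2, hi⟩

/-- A point of the orbit has only one periodic preimage, and the orbit already contains it. The
branch leading to a periodic end is thus the one that retraces the orbit. -/
lemma mem_orbit_of_periodic {e : Chord} (he : e ∈ macPullback d a b) {x : Circ} (hx : x ∈ e)
    (hp : x ∈ periodicPts (sigma d)) : e ∈ forwardOrbit d {s(a, b)} := by
  refine pullback_induction (τ := brF d b)
    (p := fun e => ∀ x ∈ e, x ∈ periodicPts (sigma d) → e ∈ forwardOrbit d {s(a, b)})
    (fun e he _ _ _ => he) (fun e he ih i x hx hp => ?_) e he x hx hp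
  obtain ⟨z, hz, rfl⟩ := Sym2.mem_map.1 hx
  have hzp : z ∈ periodicPts (sigma d) := by
    have := iterate_mem_periodicPts hp 1
    rwa [iterate_one, sigma_brF h.d_pos] at this
  have hf := ih z hz hzp
  obtain ⟨e', he', h1⟩ := h.orbit_pred hf
  obtain ⟨j, hj⟩ := h.orbit_fixed e' he'
  rw [h1] at hj
  have hz' : brF d b j z ∈ e' := hj ▸ Sym2.mem_map.2 ⟨z, hz, rfl⟩
  have h2 : brF d b i z = brF d b j z := eq_of_periodic hp (h.orbit_periodic he' hz')
    (by rw [sigma_brF h.d_pos, sigma_brF h.d_pos])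
  have h3 : i = j := Fin.ext (br_injective_index i.2 j.2 h2)
  rw [h3, hj]; exact he'

omit h in
lemma sigma_M_mem : s(sigma d a, sigma d b) ∈ macPullback d a b :=
  subset_pullback (mem_forwardOrbit_singleton.2 ⟨1, rfl⟩)

/-- The chord `σ_d(M)` has coordinates `0` and `β`. A leaf from inside this arc to outside would
cross it, and a leaf ending at one of its ends has a periodic end, hence belongs to the orbit and
stays low. -/
lemma low_of_low {x y : Circ} (he : s(x, y) ∈ macPullback d a b) (hx : fr (sigma d b) x ≤ β) :
    fr (sigma d b) y ≤ β := by
  by_contra hy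
  push Not at hy
  have hnp : ∀ z, z ∈ periodicPts (sigma d) → x ≠ z := by
    rintro z hz rfl
    have := h.orbit_low (h.mem_orbit_of_periodic he (Sym2.mem_mk_left _ _) hz)
      (Sym2.mem_mk_right x y)
    linarith
  have h1 : 0 < fr (sigma d b) x := fr_pos.2 (hnp _ (iterate_mem_periodicPts h.b_periodic 1))
  have h2 : fr (sigma d b) x < β := by
    refine lt_of_le_of_ne hx fun h2 => ?_
    rw [← h.fr_sigma_a, fr_inj] at h2
    exact hnp _ (iterate_mem_periodicPts h.a_periodic 1) h2
  apply h.noncrossing_macPullback _ sigma_M_mem _ he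
  rw [crosses_iff_coord (sigma d b), h.fr_sigma_a, fr_self, RCross, min_eq_right h.pos.le,
    max_eq_left h.pos.le]
  exact Or.inl ⟨h1, h2, Or.inr hy⟩

lemma low_iff {x y : Circ} (he : s(x, y) ∈ macPullback d a b) :
    fr (sigma d b) x ≤ β ↔ fr (sigma d b) y ≤ β :=
  ⟨h.low_of_low he, h.low_of_low (by rwa [Sym2.eq_swap])⟩

omit h in
/-- A family of branches that agrees, leaf by leaf, with the canonical ones gives the same
pullback. -/
lemma pullback_eq {τ : Fin d → Circ → Circ} (hinj : ∀ y, Injective fun i => τ i y)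
    (H : ∀ x y, s(x, y) ∈ macPullback d a b → ∀ i, ∃ j, τ i x = brF d b j x ∧ τ i y = brF d b j y) :
    pullback τ (forwardOrbit d {s(a, b)}) = macPullback d a b := by
  refine pullback_congr (fun e he i => ?_) (fun e he i => ?_)
  · induction e using Sym2.ind with | _ x y
    obtain ⟨j, h1, h2⟩ := H x y he i
    exact ⟨j, by simp [h1, h2]⟩
  · induction e using Sym2.ind with | _ x y
    choose f hf using H x y he
    have hfi : Injective f := by
      intro i j hij
      apply hinj x
      simp only
      rw [(hf i).1, (hf j).1, hij]
    obtain ⟨j, rfl⟩ := (Finite.injective_iff_surjective.1 hfi) i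
    exact ⟨j, by simp [hf j]⟩

lemma chordLength_orbit (k : ℕ) :
    chordLength (chordIter d k s(a, b)) =
      |fr (sigma d b) ((sigma d)^[k + 1] a) - fr (sigma d b) ((sigma d)^[k + 1] b)| / d := by
  rw [chordIter_mk, chordLength_mk, chordLength_of_idx_eq h.two_le (h.same k),
    ← iterate_succ_apply' (sigma d), ← iterate_succ_apply' (sigma d)]

lemma chordLength_orbit_le (k : ℕ) : chordLength (chordIter d k s(a, b)) ≤ β / d := by
  rw [h.chordLength_orbit, div_le_div_iff_of_pos_right h.d_posR, abs_le]
  have h1 := h.low (k + 1)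
  have h2 := fr_nonneg (sigma d b) ((sigma d)^[k + 1] a)
  have h3 := fr_nonneg (sigma d b) ((sigma d)^[k + 1] b)
  constructor <;> linarith [h1.1, h1.2]

lemma chordLength_M : chordLength s(a, b) = β / d := by
  have := h.chordLength_orbit 0
  rw [chordIter_zero] at this
  rw [this]
  simp [h.fr_sigma_a, fr_self, abs_of_pos h.pos]

lemma critDist_orbit (k : ℕ) : critDist d (chordIter d k s(a, b)) =
    1 / d - chordLength (chordIter d k s(a, b)) := by
  rw [critDist, abs_sub_comm, abs_of_nonneg]
  have h1 := h.chordLength_orbit_le k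
  have h2 : β / d ≤ 1 / d := by
    rw [div_le_div_iff_of_pos_right h.d_posR]; exact h.lt_one.le
  linarith

lemma isMACLeaf : IsMACLeaf d s(a, b) where
  nondegenerate := by simpa using h.ne
  periodic := by
    obtain ⟨n, hn, ha, hb⟩ := h.periodic
    exact ⟨n, hn, by simp [ha, hb]⟩
  noncrossing := h.noncrossing
  compatible := by
    refine ⟨critGon d b, ncard_critGon h.d_pos, allCritical_critGon, ?_⟩
    intro e he f hf hc
    obtain ⟨k, rfl⟩ := mem_forwardOrbit_singleton.1 he
    obtain ⟨j, hj, rfl⟩ := (mem_sides_critGon_iff h.two_le).1 hf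
    exact not_crosses_side_of_idx_eq h.two_le hj (h.same k) hc.symm
  major i := by
    have := h.critDist_orbit 0
    rw [chordIter_zero, h.chordLength_M] at this
    rw [this, h.critDist_orbit]
    linarith [h.chordLength_orbit_le i]

lemma canonical_scheme :
    IsPullbackScheme d (forwardOrbit d {s(a, b)}) (sides (critGon d b)) (brF d b) where
  right_inverse := sigma_brF h.d_pos b
  sectors := by
    have hd := h.d_posR
    -- The midpoints of the arcs serve as base points of the sectors.
    have h1 : ∀ j : Fin d, idx d b (brPt d b j (1 / 2)) = j := by
      intro j
      rw [idx, fr_brPt j.2 (by norm_num) (by norm_num), mul_div_cancel₀ _ hd.ne',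
        Nat.floor_eq_iff (by positivity)]
      constructor <;> linarith
    refine ⟨fun j => brPt d b j (1 / 2), fun j => ?_, fun j y => ?_, fun s hs => ?_⟩
    · rw [vertices_sides_critGon h.two_le]
      intro h2
      have h3 := sigma_brPt (b := b) h.d_pos j (1 / 2)
      have h2' : sigma d (brPt d b j (1 / 2)) = sigma d b := h2
      rw [h2'] at h3
      have h4 := fr_eq_of (by norm_num) (by norm_num) h3
      rw [fr_self] at h4; norm_num at h4
    · intro c hc
      obtain ⟨i, hi, rfl⟩ := (mem_sides_critGon_iff h.two_le).1 hc
      exact not_crosses_side_of_idx_eq h.two_le hi (by rw [h1, brF, idx_br j.2])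
    · refine ⟨⟨idx d b s, idx_lt h.d_pos s⟩, fun c hc => ?_⟩
      obtain ⟨i, hi, rfl⟩ := (mem_sides_critGon_iff h.two_le).1 hc
      exact not_crosses_side_of_idx_eq h.two_le hi (by rw [h1])
  disjoint_images y i j hij := Fin.ext (br_injective_index i.2 j.2 hij)
  fixes := h.orbit_fixed

end MACFrame

/-! ### Independence of the all critical `d`-gon at an end of the leaf -/

/-- A pullback scheme for an all critical `d`-gon: the branches take values in the closed arcs
between its vertices, with consistent choices at the critical value. -/
lemma scheme_critGon (hd : 2 ≤ d) {q : Circ} {F : Set Chord} {τ : Fin d → Circ → Circ}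
    (hτ : IsPullbackScheme d F (sides (critGon d q)) τ) :
    ∃ f : Fin d → Fin d, Bijective f ∧ (∀ i y, y ≠ sigma d q → τ i y = br d q (f i) y) ∧
      ∀ i, τ i (sigma d q) = brPt d q (f i) 0 ∨ τ i (sigma d q) = brPt d q (f i) 1 := by
  have hd0 : 0 < d := by omega
  obtain ⟨t, ht, hs, -⟩ := hτ.sectors
  rw [vertices_sides_critGon hd] at ht
  have key : ∀ i y, idx d q (τ i y) = idx d q (t i) ∨ τ i y = brPt d q (idx d q (t i)) 1 :=
    fun i y => mem_sector_critGon hd (ht i) (hs i y)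
  have h1 : ∀ i y, y ≠ sigma d q → τ i y = br d q (idx d q (t i)) y := by
    intro i y hy
    rcases key i y with h | h
    · have := br_idx (b := q) hd0 (τ i y)
      rw [hτ.right_inverse, h] at this
      exact this.symm
    · exfalso
      have h2 := hτ.right_inverse i y
      rw [h, brPt_one, sigma_brPt_zero hd0] at h2
      exact hy h2.symm
  refine ⟨fun i => ⟨idx d q (t i), idx_lt hd0 _⟩, ?_, h1, fun i => ?_⟩
  · rw [← Finite.injective_iff_bijective]
    intro i j hij
    simp only [Fin.mk.injEq] at hij
    -- Away from the critical value a branch is determined by its arc, so any such point shows that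
    -- different branches use different arcs.
    obtain ⟨y, hy⟩ : ∃ y, y ≠ sigma d q := ⟨sigma d q + ((1 / 2 : ℝ) : Circ), by
      intro h2
      have h3 := fr_add_coe (c := sigma d q) (r := 1 / 2) (by norm_num) (by norm_num)
      rw [h2, fr_self] at h3; norm_num at h3⟩
    apply hτ.disjoint_images y
    simp only
    rw [h1 i y hy, h1 j y hy, hij]
  · rcases key i (sigma d q) with h | h
    · left
      have := br_idx (b := q) hd0 (τ i (sigma d q))
      rw [hτ.right_inverse, h, ← brPt_fr, fr_self] at this
      exact this.symm
    · exact Or.inr h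

/-- If the lowest arc takes its left endpoint, then all do. -/
lemma left_of_left {g : ℕ → ℕ} (hg : ∀ j < d, g j = j ∨ g j = j + 1)
    (h0 : g 0 = 0) (hinj : ∀ i < d, ∀ j < d, g i % d = g j % d → i = j) : ∀ j < d, g j = j := by
  have key : ∀ m, ∀ j, j + m + 1 = d → g j = j := by
    intro m
    induction m with
    | zero =>
      intro j hj
      rcases hg j (by omega) with h | h
      · exact h
      · exfalso
        have h2 : g j = d := by omega
        have := hinj j (by omega) 0 (by omega) (by rw [h2, h0]; simp)
        rw [this] at h
        omega
    | succ m ih =>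
      intro j hj
      rcases hg j (by omega) with h | h
      · exact h
      · exfalso
        have h3 := ih (j + 1) (by omega)
        have := hinj j (by omega) (j + 1) (by omega) (by rw [h, h3])
        omega
  exact fun j hj => key (d - 1 - j) j (by omega)

/-- If the highest arc takes its right endpoint, then all do. -/
lemma right_of_right {g : ℕ → ℕ} (hg : ∀ j < d, g j = j ∨ g j = j + 1)
    (h0 : g (d - 1) = d) (hinj : ∀ i < d, ∀ j < d, g i % d = g j % d → i = j) :
    ∀ j < d, g j = j + 1 := by
  intro j
  induction j with
  | zero =>
    intro hj
    rcases hg 0 hj with h | h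
    · have h1 := hinj 0 hj (d - 1) (by omega) (by rw [h, h0]; simp)
      rw [← h1] at h0
      omega
    · exact h
  | succ j ih =>
    intro hj
    rcases hg (j + 1) hj with h | h
    · have := hinj (j + 1) hj j (by omega) (by rw [h, ih (by omega)])
      omega
    · exact h

lemma brPt_mod (hd : 0 < d) {j : ℕ} (hj : j ≤ d) (r : ℝ) : brPt d b (j % d) r = brPt d b j r := by
  rcases hj.lt_or_eq with h | h
  · rw [Nat.mod_eq_of_lt h]
  · rw [h, Nat.mod_self, brPt_self hd]

/-- The choices at the critical value in a pullback scheme for an all critical `d`-gon. -/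
lemma exists_choice (hd : 0 < d) {q : Circ} {τ : Fin d → Circ → Circ}
    (hinj : ∀ y, Injective fun i => τ i y) {f : Fin d → Fin d} (hf : Bijective f)
    (h2 : ∀ i, τ i (sigma d q) = brPt d q (f i) 0 ∨ τ i (sigma d q) = brPt d q (f i) 1) :
    ∃ g : ℕ → ℕ, (∀ j < d, g j = j ∨ g j = j + 1) ∧
      (∀ i < d, ∀ j < d, g i % d = g j % d → i = j) ∧
      ∀ i, τ i (sigma d q) = brPt d q (g (f i)) 0 := by
  -- `m` is the number of the chosen vertex: `j` for the left end of the arc, `j + 1` for the right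
  -- end. It can reach `d`, so vertices are later compared modulo `d`.
  have h3 : ∀ j : Fin d, ∃ m : ℕ, (m = j ∨ m = j + 1) ∧
      ∀ i, f i = j → τ i (sigma d q) = brPt d q m 0 := by
    intro j
    obtain ⟨i, rfl⟩ := hf.2 j
    rcases h2 i with h | h
    · exact ⟨f i, Or.inl rfl, fun i' hi' => by rw [hf.1 hi', h]⟩
    · exact ⟨f i + 1, Or.inr rfl, fun i' hi' => by rw [hf.1 hi', h, brPt_one]⟩
  choose g hg hg' using h3
  refine ⟨fun j => if hj : j < d then g ⟨j, hj⟩ else 0, fun j hj => ?_, fun i hi j hj hij => ?_,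
    fun i => ?_⟩
  · simpa [hj] using hg ⟨j, hj⟩
  · simp only [hi, hj, dite_true] at hij
    obtain ⟨i', hi'⟩ := hf.2 ⟨i, hi⟩
    obtain ⟨j', hj'⟩ := hf.2 ⟨j, hj⟩
    have e1 := hg' _ i' hi'
    have e2 := hg' _ j' hj'
    have l1 : g ⟨i, hi⟩ ≤ d := by rcases hg ⟨i, hi⟩ with h | h <;> simp only at h <;> omega
    have l2 : g ⟨j, hj⟩ ≤ d := by rcases hg ⟨j, hj⟩ with h | h <;> simp only at h <;> omega
    have : i' = j' := by
      apply hinj (sigma d q)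
      simp only
      rw [e1, e2, ← brPt_mod hd l1, ← brPt_mod hd l2, hij]
    rw [this, hj'] at hi'
    simpa using hi'.symm
  · simp only [(f i).2, dite_true]
    exact hg' _ i rfl

namespace MACFrame

variable (h : MACFrame d a b β)
include h

lemma sigma_ne : sigma d a ≠ sigma d b := h.iterate_ne 1

/-- All pullbacks with respect to all critical `d`-gons at an endpoint of the leaf coincide. -/
lemma pullback_eq_of_scheme {q : Circ} (hq : q ∈ s(a, b)) {τ : Fin d → Circ → Circ}
    (hτ : IsPullbackScheme d (forwardOrbit d {s(a, b)}) (sides (critGon d q)) τ) :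
    pullback τ (forwardOrbit d {s(a, b)}) = macPullback d a b := by
  have hd0 := h.d_pos
  have hdr := h.d_posR
  obtain ⟨f, hf, h1, h2⟩ := scheme_critGon h.two_le hτ
  obtain ⟨g, hg, hginj, hg'⟩ := exists_choice hd0 hτ.disjoint_images hf h2
  obtain ⟨i₀, hi₀⟩ := hτ.fixes s(a, b) (mem_forwardOrbit_self rfl)
  have hfix := eq_of_map_eq (fun y => hτ.right_inverse i₀ y) hi₀
  refine pullback_eq hτ.disjoint_images fun x y he i => ?_
  rw [Sym2.mem_iff] at hq
  rcases hq with rfl | rfl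
  -- Here `q` is the end `a`. Counted from `a`, the leaf lies in the last arc with `a` as right end;
  -- fixing the leaf forces this branch, and hence all branches, to choose right ends.
  · have hbq : sigma d b ≠ sigma d q := h.sigma_ne.symm
    have hidx : idx d q b = d - 1 := by
      have h3 : fr q b = 1 - β / d := by rw [fr_swap h.ne.symm, h.fr_a]
      rw [idx, h3, Nat.floor_eq_iff (by
        have := h.lt_one
        have : β / d ≤ 1 := by rw [div_le_one hdr]; have := h.two_le; have : (2:ℝ) ≤ d := by exact_mod_cast this
                               linarith
        nlinarith)]
      have h4 : (d : ℝ) * (1 - β / d) = d - β := by field_simp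
      have h5 : ((d - 1 : ℕ) : ℝ) = d - 1 := by
        rw [Nat.cast_sub (by omega)]; simp
      rw [h4, h5]
      constructor <;> linarith [h.pos, h.lt_one]
    have hf0 : (f i₀ : ℕ) = d - 1 := by
      have := h1 i₀ _ hbq
      rw [hfix.2] at this
      rw [← hidx, this, idx_br (f i₀).2]
    have hg0 : g (d - 1) = d := by
      have h3 := hg' i₀
      rw [hf0, hfix.1] at h3
      rcases hg (d - 1) (by omega) with h4 | h4
      · exfalso
        rw [h4] at h3
        rcases Nat.eq_zero_or_pos (d - 1) with h5 | h5
        · have := h.two_le; omega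
        · exact brPt_ne hd0 hd0 (by omega : d - 1 < d) h5.ne 0 (by rw [brPt_zero_zero]; exact h3)
      · omega
    have hall := right_of_right hg hg0 hginj
    -- The arcs from `a` are those from `b` shifted by `β/d`. The branch number thus changes by one
    -- exactly for arguments up to `β`, and no leaf of the pullback straddles `β`.
    have hτi : ∀ w, τ i w = br d b (if fr (sigma d b) w ≤ β then ((f i : ℕ) + 1) % d else f i) w := by
      intro w
      have hw1 := fr_lt_one (sigma d b) w
      have hw0 := fr_nonneg (sigma d b) w
      have hb : b = q - ((β / d : ℝ) : Circ) := by rw [h.eq_add]; abel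
      by_cases hw : w = sigma d q
      · subst hw
        rw [hg' i, hall _ (f i).2, h.fr_sigma_a, if_pos le_rfl, ← brPt_fr, h.fr_sigma_a,
          brPt_mod hd0 (by omega), brPt, brPt, h.eq_add, add_assoc, ← AddCircle.coe_add]
        congr 2; push_cast; ring
      · rw [h1 i w hw]
        have e : fr (sigma d q) w = Int.fract (fr (sigma d b) w - β) := by
          rw [fr_change (sigma d b), h.fr_sigma_a]
        rcases fract_sub_cases h.pos.le h.lt_one hw0 hw1 with ⟨h3, h4⟩ | ⟨h3, h4⟩
        · rw [h4] at e
          have h5 : ¬ fr (sigma d b) w ≤ β := by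
            intro h6
            apply hw
            rw [← fr_inj (c := sigma d b), h.fr_sigma_a]; linarith
          rw [if_neg h5, br, br, e, h.eq_add, add_assoc, ← AddCircle.coe_add]
          congr 2; ring
        · rw [h4] at e
          have h6 := (f i).2
          rw [if_pos h3.le, ← brPt_fr, ← brPt_fr, brPt_mod hd0 (by omega), brPt, brPt, e, h.eq_add, add_assoc,
            ← AddCircle.coe_add]
          congr 2; push_cast; ring
    have hlt : (if fr (sigma d b) x ≤ β then ((f i : ℕ) + 1) % d else f i) < d := by
      split_ifs
      · exact Nat.mod_lt _ hd0
      · exact (f i).2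
    refine ⟨⟨_, hlt⟩, hτi x, ?_⟩
    rw [hτi y]
    simp only [brF, h.low_iff he]
  -- Here `q` is the end `b`, the left end of the arc of the leaf. All branches choose left ends, as
  -- the canonical ones do.
  · have haq : sigma d a ≠ sigma d q := h.sigma_ne
    have hf0 : (f i₀ : ℕ) = 0 := by
      have := h1 i₀ _ haq
      rw [hfix.1] at this
      rw [← h.idx_a, this, idx_br (f i₀).2]
    have hg0 : g 0 = 0 := by
      have h3 := hg' i₀
      rw [hf0, hfix.2] at h3
      rcases hg 0 hd0 with h4 | h4
      · exact h4
      · exfalso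
        rw [h4] at h3
        have := h.two_le
        exact brPt_ne hd0 hd0 (by omega : 0 + 1 < d) (by omega) 0 (by rw [brPt_zero_zero]; exact h3)
    have hall := left_of_left hg hg0 hginj
    have hτi : ∀ w, τ i w = brF d q (f i) w := by
      intro w
      by_cases hw : w = sigma d q
      · subst hw
        rw [hg' i, hall _ (f i).2, brF, ← brPt_fr, fr_self]
      · exact h1 i w hw
    exact ⟨f i, hτi x, hτi y⟩

/-- If the classes are finite and bounded by their leaves, the closure of the pullback is the
canonical MAC lamination. -/
lemma isCanonicalMAC (hfin : ∀ x, (leafClass (chordClosure (macPullback d a b)) x).Finite)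
    (hbd : ∀ x y : Circ, s(x, y) ∈ chordClosure (macPullback d a b) →
      IsSide (leafClass (chordClosure (macPullback d a b)) x) s(x, y)) :
    IsCanonicalMAC d s(a, b) (chordClosure (macPullback d a b)) where
  isMACLeaf := h.isMACLeaf
  isPullback := by
    refine ⟨critGon d b, brF d b, ncard_critGon h.d_pos, allCritical_critGon,
      ⟨b, rfl, Sym2.mem_mk_right _ _⟩, ?_, h.canonical_scheme, rfl⟩
    intro e he f hf hc
    obtain ⟨k, rfl⟩ := mem_forwardOrbit_singleton.1 he
    obtain ⟨j, hj, rfl⟩ := (mem_sides_critGon_iff h.two_le).1 hf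
    exact not_crosses_side_of_idx_eq h.two_le hj (h.same k) hc.symm
  isInvariantLamination :=
    { isLamination := isLamination_chordClosure h.branchInvariant
      forward_invariant := fun e he =>
        forward_chordClosure (fun e he => h.forward_macPullback he) he
      backward_invariant := fun e he => backward_chordClosure h.d_pos h.branchInvariant he
      sibling_invariant := fun e he hs => sibling_chordClosure h.d_pos h.branchInvariant he hs
      finite_classes := hfin
      boundary_leaves := hbd }

lemma eq_of_isCanonicalMAC {L : Set Chord} (hL : IsCanonicalMAC d s(a, b) L) :
    L = chordClosure (macPullback d a b) := by
  obtain ⟨Q, τ, hQ, hcrit, ⟨q, hq, hqM⟩, -, hτ, rfl⟩ := hL.isPullback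
  rw [eq_critGon h.d_pos hQ hcrit hq] at hτ
  rw [h.pullback_eq_of_scheme hqM hτ]

end MACFrame

end

/-! ### The critical portrait under a chain of long sides -/

lemma btw_iff_fr {x y z : Circ} (h : x ≠ z) : btw x y z ↔ fr x y ≤ fr x z := by
  rw [btw_iff_not_sbtw, sbtw_iff_cyc x, fr_self, cyc]
  have h1 := fr_pos.2 h.symm
  have h2 := fr_nonneg x y
  constructor
  · intro h3; by_contra h4; push Not at h4; exact h3 (Or.inr (Or.inr ⟨h1, h4⟩))
  · rintro h3 (⟨h4, h5⟩ | ⟨h4, h5⟩ | ⟨h4, h5⟩) <;> linarith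

section
variable {d : ℕ} {P : Set Circ} {v : ℕ → Circ} {C : Set Chord}

/-- A chain of consecutive vertices that does not contain all vertices runs once around. -/
lemma chain_fr_lt (hc : ∀ i < d - 1, Consecutive P (v i) (v (i + 1))) (hinj : InjOn v (Iio (d - 1)))
    (hcard : d ≤ P.ncard) : ∀ i < d - 1, fr (v 0) (v i) < fr (v 0) (v (i + 1)) := by
  have step : ∀ i < d - 1, v (i + 1) ≠ v 0 → fr (v 0) (v i) < fr (v 0) (v (i + 1)) := by
    intro i hi hne
    by_contra hlt
    push Not at hlt
    have h1 : fr (v 0) (v (i + 1)) ≠ fr (v 0) (v i) := by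
      rw [Ne, fr_inj]; exact (hc i hi).2.2.1.symm
    have h2 := fr_pos.2 hne
    apply (hc i hi).2.2.2 (v 0) (hc 0 (by omega)).1
    rw [sbtw_iff_cyc (v 0), fr_self]
    exact Or.inr (Or.inl ⟨h2, lt_of_le_of_ne hlt h1⟩)
  have hinner : ∀ i, i + 1 < d - 1 → v (i + 1) ≠ v 0 := by
    intro i hi h
    have := hinj (mem_Iio.2 hi) (mem_Iio.2 (by omega : 0 < d - 1)) h
    omega
  intro i hi
  apply step i hi
  rcases (show i + 1 < d - 1 ∨ i + 1 = d - 1 by omega) with h | h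
  · exact hinner i h
  · intro hv
    -- A chain that closed up would exhaust the polygon, which has more than `d - 1` vertices.
    have hP : P ⊆ v '' Iio (d - 1) := by
      intro z hz
      by_contra hz'
      have hz'' : ∀ j < d - 1, z ≠ v j := fun j hj h => hz' ⟨j, hj, h.symm⟩
      have key : ∀ j < d - 1, fr (v 0) (v j) < fr (v 0) z := by
        intro j
        induction j with
        | zero => intro hj; rw [fr_self]; exact fr_pos.2 (hz'' 0 hj)
        | succ j ih =>
          intro hj
          have h1 := ih (by omega)
          by_contra h2
          push Not at h2
          have h3 : fr (v 0) z ≠ fr (v 0) (v (j + 1)) := by rw [Ne, fr_inj]; exact hz'' _ hj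
          apply (hc j (by omega)).2.2.2 z hz
          rw [sbtw_iff_cyc (v 0)]
          exact Or.inl ⟨h1, lt_of_le_of_ne h2 h3⟩
      apply (hc i hi).2.2.2 z hz
      have h1 : 0 < fr (v 0) (v i) := by
        rw [fr_pos, ← hv]; exact (hc i hi).2.2.1
      rw [sbtw_iff_cyc (v 0), hv, fr_self]
      exact Or.inr (Or.inr ⟨h1, key i hi⟩)
    have h1 := (ncard_le_ncard hP ((finite_Iio _).image v)).trans (ncard_image_le (finite_Iio _))
    have h2 : (Iio (d - 1)).ncard = d - 1 := by
      rw [← Finset.coe_Iio, ncard_coe_finset, Nat.card_Iio]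
    omega

lemma sigma_eq_iff_fr (p : Circ) {x y : Circ} :
    sigma d x = sigma d y ↔ ∃ n : ℤ, d * fr p x = d * fr p y + n := by
  conv_lhs => rw [← add_fr p x, ← add_fr p y]
  rw [sigma_add_coe, sigma_add_coe, add_right_inj, coe_eq_coe_iff]

lemma isCritical_mk {x y : Circ} : IsCritical d s(x, y) ↔ x ≠ y ∧ sigma d x = sigma d y := by
  simp [IsCritical]

/-- A critical chord in an arc of length less than `2/d`. -/
lemma critical_in_arc (hd : 0 < d) {p q x y : Circ} (hpq : p ≠ q) (hc : IsCritical d s(x, y))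
    (hx : btw p x q) (hy : btw p y q) :
    1 ≤ d * fr p q ∧ (d * fr p q < 2 →
      (d * fr p y = d * fr p x + 1 ∨ d * fr p x = d * fr p y + 1)) := by
  have hdr : (0 : ℝ) < d := by exact_mod_cast hd
  rw [btw_iff_fr hpq] at hx hy
  obtain ⟨hne, hs⟩ := isCritical_mk.1 hc
  obtain ⟨n, hn⟩ := (sigma_eq_iff_fr p).1 hs
  have hx0 := mul_nonneg hdr.le (fr_nonneg p x)
  have hy0 := mul_nonneg hdr.le (fr_nonneg p y)
  have hx1 := mul_le_mul_of_nonneg_left hx hdr.le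
  have hy1 := mul_le_mul_of_nonneg_left hy hdr.le
  have hn0 : n ≠ 0 := by
    rintro rfl
    apply hne
    rw [← fr_inj (c := p)]
    have : (d : ℝ) * fr p x = d * fr p y := by rw [hn]; simp
    exact mul_left_cancel₀ hdr.ne' this
  rcases lt_or_gt_of_ne hn0 with h | h
  · have h1 : (n : ℝ) ≤ -1 := by exact_mod_cast Int.le_sub_one_of_lt h
    refine ⟨by linarith, fun h2 => Or.inl ?_⟩
    have h3 : (-2 : ℝ) < n := by linarith
    have h4 : -2 < n := by exact_mod_cast h3
    have h5 : n = -1 := by omega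
    rw [hn, h5]; push_cast; ring
  · have h1 : (1 : ℝ) ≤ n := by exact_mod_cast h
    refine ⟨by linarith, fun h2 => Or.inr ?_⟩
    have h3 : (n : ℝ) < 2 := by linarith
    have h4 : n < 2 := by exact_mod_cast h3
    have h5 : n = 1 := by omega
    rw [hn, h5]; push_cast; ring

/-- A chain of `d - 1` sides, each longer than `1/d`, with critical chords under the sides. -/
structure ChainFrame (d : ℕ) (v : ℕ → Circ) (C : Set Chord) (b : Circ) (u g : ℕ → ℝ) : Prop where
  two_le : 2 ≤ d
  pos : 0 < u 0
  lt_succ : ∀ i, i + 1 < d → u i < u (i + 1)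
  last : u (d - 1) = 1
  v_eq : ∀ i < d, v i = brPt d b i (u i)
  g_eq : ∀ m, m + 1 < d → g m = u m ∨ g m = u (m + 1)
  mem : ∀ m, m + 1 < d → s(brPt d b m (g m), brPt d b (m + 1) (g m)) ∈ C

/-- A critical chord needs room `1/d`, equality would collapse the side under `σ_d`, and the total
is less than one turn. So each side of the chain spans more than `1/d` and less than `2/d`. This
pins the chord under it to an arc of exactly `1/d` from the end that it touches. -/
lemma exists_chainFrame (hd : 2 ≤ d) (hc : ∀ i < d - 1, Consecutive P (v i) (v (i + 1)))
    (hinj : InjOn v (Iio (d - 1))) (hcard : d ≤ P.ncard)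
    (hσ : ∀ i < d - 1, sigma d (v i) ≠ sigma d (v (i + 1))) (hg : IsGuiding d v C) :
    ∃ u g, ChainFrame d v C (v (d - 1)) u g := by
  have hd0 : 0 < d := by omega
  have hdr : (0 : ℝ) < d := by exact_mod_cast hd0
  obtain ⟨c, rfl, hg⟩ := hg
  have hlt := chain_fr_lt hc hinj hcard
  -- Positions along the chain, in units of `1/d`.
  set S : ℕ → ℝ := fun i => d * fr (v 0) (v i) with hS
  have hA : ∀ i < d - 1, d * fr (v i) (v (i + 1)) = S (i + 1) - S i := by
    intro i hi
    rcases fr_cases (v 0) (v i) (v (i + 1)) with h | h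
    · rw [h.2, mul_sub]
    · linarith [hlt i hi, h.1]
  have hcrit : ∀ i < d - 1, 1 ≤ S (i + 1) - S i ∧ (S (i + 1) - S i < 2 →
      c i = s(v i, v i + ((1 / d : ℝ) : Circ)) ∨
      ∃ y, y + ((1 / d : ℝ) : Circ) = v (i + 1) ∧ c i = s(y, v (i + 1))) := by
    intro i hi
    obtain ⟨h1, h2, h3⟩ := hg i hi
    have hne := (hc i hi).2.2.1
    rw [← hA i hi]
    rcases h2 with h2 | h2
    · obtain ⟨y, hy⟩ := Sym2.mem_iff_exists.1 h2
      rw [hy] at h1 h3 ⊢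
      obtain ⟨h4, h5⟩ := critical_in_arc hd0 hne h1 (h3 _ (by simp)) (h3 _ (by simp))
      refine ⟨h4, fun h6 => Or.inl ?_⟩
      rw [fr_self, mul_zero] at h5
      have hy0 := mul_nonneg hdr.le (fr_nonneg (v i) y)
      have h7 : (d : ℝ) * fr (v i) y = 1 := by rcases h5 h6 with h | h <;> linarith
      have h8 : fr (v i) y = 1 / d := by field_simp; linarith
      rw [← h8, add_fr]
    · obtain ⟨y, hy⟩ := Sym2.mem_iff_exists.1 h2
      rw [hy] at h1 h3 ⊢
      obtain ⟨h4, h5⟩ := critical_in_arc hd0 hne h1 (h3 _ (by simp)) (h3 _ (by simp))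
      refine ⟨h4, fun h6 => Or.inr ⟨y, ?_, Sym2.eq_swap⟩⟩
      have hy1 := mul_le_mul_of_nonneg_left
        ((btw_iff_fr hne).1 (h3 y (by simp))) hdr.le
      have h7 : (d : ℝ) * fr (v i) (v (i + 1)) = d * fr (v i) y + 1 := by
        rcases h5 h6 with h | h <;> linarith
      have h8 : fr (v i) (v (i + 1)) = fr (v i) y + 1 / d := by
        field_simp; linarith
      rw [← add_fr (v i) (v (i + 1)), h8, AddCircle.coe_add, ← add_assoc, add_fr]
  have hne1 : ∀ i < d - 1, 1 < S (i + 1) - S i := by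
    intro i hi
    refine lt_of_le_of_ne (hcrit i hi).1 fun h => hσ i hi ?_
    rw [eq_comm, sigma_eq_iff_fr (v 0)]
    exact ⟨1, by simp only [hS] at h; push_cast; linarith⟩
  have hSmono : ∀ k i, i + k ≤ d - 1 → S i + k ≤ S (i + k) := by
    intro k
    induction k with
    | zero => intro i _; simp
    | succ k ih =>
      intro i hi
      have := ih i (by omega)
      have := (hcrit (i + k) (by omega)).1
      rw [← add_assoc]; push_cast; linarith
  have hSlast : S (d - 1) < d := by
    have := fr_lt_one (v 0) (v (d - 1))
    simp only [hS]; nlinarith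
  have hS0 : S 0 = 0 := by simp [hS, fr_self]
  -- The other `d - 2` sides take at least `d - 2` of fewer than `d` units.
  have hlt2 : ∀ i < d - 1, S (i + 1) - S i < 2 := by
    intro i hi
    have h1 := hSmono i 0 (by omega)
    have h2 := hSmono (d - 1 - (i + 1)) (i + 1) (by omega)
    rw [zero_add, hS0] at h1
    rw [show i + 1 + (d - 1 - (i + 1)) = d - 1 by omega] at h2
    have h3 : ((d - 1 - (i + 1) : ℕ) : ℝ) = d - 1 - (i + 1) := by
      rw [Nat.cast_sub (by omega), Nat.cast_sub (by omega)]; push_cast; ring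
    rw [h3] at h2
    linarith
  -- The arc from the last vertex on to `v 0` measures `d - S (d - 1)` units; `u i` is the position
  -- of `v i` counted from the last vertex, less `i`.
  set u : ℕ → ℝ := fun i => S i + (d - S (d - 1)) - i with hu
  have hvb : v 0 = v (d - 1) + (((d - S (d - 1)) / d : ℝ) : Circ) := by
    conv_rhs => rw [← add_fr (v 0) (v (d - 1))]
    rw [add_assoc, ← AddCircle.coe_add]
    have : fr (v 0) (v (d - 1)) + (d - S (d - 1)) / d = 1 := by
      simp only [hS]; field_simp; ring
    rw [this, coe_one_eq_zero, add_zero]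
  have hv : ∀ i < d, v i = brPt d (v (d - 1)) i (u i) := by
    intro i hi
    refine (add_fr (v 0) (v i)).symm.trans ((congrArg (· + _) hvb).trans ?_)
    rw [brPt, add_assoc, ← AddCircle.coe_add]
    congr 2
    simp only [hu, hS]; field_simp; ring
  -- A guiding chord at the left vertex has offset `u m`, one at the right vertex `u (m + 1)`. Out
  -- of range, `0` is a default.
  have hgex : ∀ m, ∃ gm : ℝ, m + 1 < d → (gm = u m ∨ gm = u (m + 1)) ∧
      s(brPt d (v (d - 1)) m gm, brPt d (v (d - 1)) (m + 1) gm) ∈ c '' Iio (d - 1) := by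
    intro m
    by_cases hm : m + 1 < d
    · have hm' : m < d - 1 := by omega
      rcases (hcrit m hm').2 (hlt2 m hm') with h | ⟨y, hy, h⟩
      · refine ⟨u m, fun _ => ⟨Or.inl rfl, m, hm', ?_⟩⟩
        have h1 : v m + ((1 / d : ℝ) : Circ) = brPt d (v (d - 1)) (m + 1) (u m) := by
          rw [hv m (by omega), brPt, brPt, add_assoc, ← AddCircle.coe_add]
          congr 2; push_cast; ring
        rw [h, h1, ← hv m (by omega)]
      · refine ⟨u (m + 1), fun _ => ⟨Or.inr rfl, m, hm', ?_⟩⟩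
        rw [h, ← hv (m + 1) hm]
        congr 2
        rw [hv (m + 1) hm, brPt] at hy
        rw [eq_sub_of_add_eq hy, brPt, add_sub_assoc, ← AddCircle.coe_sub]
        congr 2; push_cast; ring
    · exact ⟨0, fun h => absurd h hm⟩
  choose g hg' using hgex
  refine ⟨u, g, hd, by simp only [hu, hS0]; push_cast; linarith, fun i hi => ?_, ?_, hv,
    fun m hm => (hg' m hm).1, fun m hm => (hg' m hm).2⟩
  · have := hne1 i (by omega)
    simp only [hu]; push_cast; linarith
  · simp only [hu]; rw [Nat.cast_sub (by omega)]; push_cast; ring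

end

/-! ### Branches into the sectors of a guiding critical portrait -/

/-- Seen from `t`, the hypotheses keep both points out of the open arc under `s(p, q)` on the side
away from `t`. -/
lemma not_crosses_trans {p q t x y : Circ} (hp : t ≠ p) (hq : t ≠ q)
    (hx : ¬ Crosses s(p, q) s(t, x)) (hy : ¬ Crosses s(p, q) s(t, y)) :
    ¬ Crosses s(p, q) s(x, y) := by
  intro hxy
  have hp' : 0 ≠ fr t p := (fr_pos.2 hp.symm).ne
  have hq' : 0 ≠ fr t q := (fr_pos.2 hq.symm).ne
  rw [crosses_iff_coord t] at hx hy hxy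
  rw [fr_self] at hx hy
  have h1 := fr_nonneg t p
  have h2 := fr_nonneg t q
  have h3 : 0 < min (fr t p) (fr t q) := lt_min (lt_of_le_of_ne h1 hp') (lt_of_le_of_ne h2 hq')
  rcases hxy with ⟨h4, h5, -⟩ | ⟨h4, h5, -⟩
  · exact hx (Or.inr ⟨h4, h5, Or.inl h3⟩)
  · exact hy (Or.inr ⟨h4, h5, Or.inl h3⟩)

lemma IsPullbackScheme.not_crosses {d : ℕ} {F C : Set Chord} {τ : Fin d → Circ → Circ}
    (hτ : IsPullbackScheme d F C τ) {c : Chord} (hc : c ∈ C) (i : Fin d) (x y : Circ) :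
    ¬ Crosses c s(τ i x, τ i y) := by
  obtain ⟨t, ht, hs, -⟩ := hτ.sectors
  induction c using Sym2.ind with | _ p q
  have hp : t i ≠ p := fun h => ht i ⟨_, hc, by simp [h]⟩
  have hq : t i ≠ q := fun h => ht i ⟨_, hc, by simp [h]⟩
  exact not_crosses_trans hp hq (hs i x _ hc) (hs i y _ hc)

/-- Branches map into sectors, so pullbacks cross no chord of `C`, and crossing is an open
condition. -/
lemma not_crosses_of_mem_chordClosure_pullback {d : ℕ} {F C : Set Chord} {τ : Fin d → Circ → Circ}
    (hτ : IsPullbackScheme d F C τ) (hF : Compatible F C) {c e : Chord} (hc : c ∈ C)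
    (he : e ∈ chordClosure (pullback τ F)) : ¬ Crosses c e := by
  intro h
  refine not_crosses_chordClosure (f := c) ?_ e he h.symm
  refine pullback_induction (fun e he => hF e he c hc) fun e _ _ i => ?_
  induction e using Sym2.ind with | _ x y
  exact fun h => hτ.not_crosses hc i x y h.symm

namespace ChainFrame

variable {d : ℕ} {v : ℕ → Circ} {C : Set Chord} {b : Circ} {u g : ℕ → ℝ}
variable (h : ChainFrame d v C b u g)
include h

lemma d_pos : 0 < d := by have := h.two_le; omega

lemma d_posR : (0 : ℝ) < d := by exact_mod_cast h.d_pos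

lemma u_lt {i j : ℕ} (hij : i < j) (hj : j < d) : u i < u j := by
  induction j with
  | zero => omega
  | succ j ih =>
    rcases Nat.lt_succ_iff_lt_or_eq.1 hij with h1 | rfl
    · exact (ih h1 (by omega)).trans (h.lt_succ j hj)
    · exact h.lt_succ _ hj

lemma u_le {i j : ℕ} (hij : i ≤ j) (hj : j < d) : u i ≤ u j := by
  rcases hij.lt_or_eq with h1 | rfl
  · exact (h.u_lt h1 hj).le
  · exact le_rfl

lemma u_pos {i : ℕ} (hi : i < d) : 0 < u i := h.pos.trans_le (h.u_le (Nat.zero_le i) hi)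

lemma u_lt_one {i : ℕ} (hi : i + 1 < d) : u i < 1 := by
  rw [← h.last]; exact h.u_lt (by omega) (by omega)

lemma u_le_one {i : ℕ} (hi : i < d) : u i ≤ 1 := by
  rw [← h.last]; exact h.u_le (by omega) (by omega)

lemma le_g {m : ℕ} (hm : m + 1 < d) : u m ≤ g m := by
  rcases h.g_eq m hm with h1 | h1
  · exact h1.ge
  · rw [h1]; exact (h.lt_succ m hm).le

lemma g_le {m : ℕ} (hm : m + 1 < d) : g m ≤ u (m + 1) := by
  rcases h.g_eq m hm with h1 | h1
  · rw [h1]; exact (h.lt_succ m hm).le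
  · exact h1.le

lemma g_pos {m : ℕ} (hm : m + 1 < d) : 0 < g m := (h.u_pos (by omega)).trans_le (h.le_g hm)

lemma u_zero_le_g {m : ℕ} (hm : m + 1 < d) : u 0 ≤ g m :=
  (h.u_le (Nat.zero_le m) (by omega)).trans (h.le_g hm)

lemma g_le_one {m : ℕ} (hm : m + 1 < d) : g m ≤ 1 := (h.g_le hm).trans (h.u_le_one hm)

lemma g_mono {m n : ℕ} (hmn : m ≤ n) (hn : n + 1 < d) : g m ≤ g n := by
  rcases hmn.lt_or_eq with h1 | rfl
  · exact (h.g_le (by omega)).trans ((h.u_le h1 (by omega)).trans (h.le_g hn))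
  · exact le_rfl

lemma crosses_guide_iff {m : ℕ} (hm : m + 1 < d) {x y : Circ} :
    Crosses s(brPt d b m (g m), brPt d b (m + 1) (g m)) s(x, y) ↔
      (m + g m < d * fr b x ∧ d * fr b x < m + 1 + g m ∧
        (d * fr b y < m + g m ∨ m + 1 + g m < d * fr b y) ∧ (m + 1 + g m = d → y ≠ b)) ∨
      (m + g m < d * fr b y ∧ d * fr b y < m + 1 + g m ∧
        (d * fr b x < m + g m ∨ m + 1 + g m < d * fr b x) ∧ (m + 1 + g m = d → x ≠ b)) := by
  have hd := h.d_posR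
  have h1 := h.g_pos hm
  have h2 := h.g_le_one hm
  have h3 : (m : ℝ) + 1 + 1 ≤ d := by exact_mod_cast (by omega : m + 1 + 1 ≤ d)
  have h4 : (2 : ℝ) ≤ d := by exact_mod_cast h.two_le
  rw [brPt, brPt, crosses_arc_iff (by positivity)]
  · push_cast
    simp only [div_lt_iff₀ hd, lt_div_iff₀ hd, div_eq_one_iff_eq hd.ne', mul_comm _ (d : ℝ), Ne,
      fr_eq_zero]
  · push_cast; rw [div_lt_div_iff_of_pos_right hd]; linarith
  · push_cast; rw [div_le_one hd]; linarith
  · push_cast; rw [← sub_div, div_lt_one hd]; linarith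

lemma mul_fr (x : Circ) : d * fr b x = idx d b x + fr (sigma d b) (sigma d x) := by
  rw [fr_eq_idx h.d_pos x, mul_div_cancel₀ _ h.d_posR.ne']

omit h in
lemma ne_of_fr_sigma_pos {x : Circ} (hx : 0 < fr (sigma d b) (sigma d x)) : x ≠ b := by
  rintro rfl; rw [fr_self] at hx; exact lt_irrefl _ hx

/-- Points which are not separated by the guiding chords lie in the same arc of length `1/d`, if
their images are on the same side of all critical values. -/
lemma idx_eq_of_not_crosses {x y : Circ} (hC : ∀ c ∈ C, ¬ Crosses c s(x, y))
    (hx : 0 < fr (sigma d b) (sigma d x)) (hy : 0 < fr (sigma d b) (sigma d y))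
    (hg : ∀ m, m + 1 < d →
      (fr (sigma d b) (sigma d x) < g m ∧ fr (sigma d b) (sigma d y) < g m) ∨
      (g m < fr (sigma d b) (sigma d x) ∧ g m < fr (sigma d b) (sigma d y))) :
    idx d b x = idx d b y := by
  wlog hlt : idx d b x < idx d b y generalizing x y
  · rcases (not_lt.1 hlt).lt_or_eq with h1 | h1
    · refine (this (x := y) (y := x) (fun c hc => ?_) hy hx (fun m hm => ?_) h1).symm
      · rw [Sym2.eq_swap]; exact hC c hc
      · exact (hg m hm).imp And.symm And.symm
    · exact h1.symm
  exfalso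
  have hjd := idx_lt (b := b) h.d_pos y
  set ξ := fr (sigma d b) (sigma d x) with hξ
  set ζ := fr (sigma d b) (sigma d y) with hζ
  have hX := h.mul_fr x
  have hY := h.mul_fr y
  rw [← hξ] at hX
  rw [← hζ] at hY
  have hξ1 : ξ < 1 := fr_lt_one _ _
  have hζ1 : ζ < 1 := fr_lt_one _ _
  have hle : (idx d b x : ℝ) + 1 ≤ idx d b y := by exact_mod_cast hlt
  have hm : idx d b x + 1 < d := by omega
  have h1 := hC _ (h.mem _ hm)
  rw [h.crosses_guide_iff hm] at h1
  have hg0 := hg _ hm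
  -- With the images below the critical value, `y` is under the guiding chord numbered `idx d b y -
  -- 1` and `x` comes before it. With the images above, `x` is under the chord numbered `idx d b x`
  -- and `y` comes after it.
  rcases hg0 with ⟨h2, h3⟩ | ⟨h2, h3⟩
  · obtain ⟨m, hm'⟩ : ∃ m, idx d b y = m + 1 := ⟨idx d b y - 1, by omega⟩
    have hmd : m + 1 < d := by omega
    have h4 := hC _ (h.mem _ hmd)
    rw [h.crosses_guide_iff hmd] at h4
    have h5 := h.g_mono (m := idx d b x) (n := m) (by omega) hmd
    have h6 := h.g_le_one hmd
    have h7 : (idx d b y : ℝ) = m + 1 := by exact_mod_cast hm'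
    apply h4
    right
    refine ⟨by linarith, by linarith, Or.inl (by linarith), fun _ => ne_of_fr_sigma_pos hx⟩
  · have h4 := h.g_pos hm
    apply h1
    left
    exact ⟨by linarith, by linarith, Or.inr (by linarith), fun _ => ne_of_fr_sigma_pos hy⟩

lemma sigma_v (i : ℕ) (hi : i < d) : sigma d (v i) = sigma d b + (u i : Circ) := by
  rw [h.v_eq i hi, sigma_brPt h.d_pos]

lemma v_last : v (d - 1) = b := by
  rw [h.v_eq _ (by have := h.d_pos; omega), h.last, brPt_one,
    show d - 1 + 1 = d by have := h.d_pos; omega, brPt_self h.d_pos, brPt_zero_zero]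

lemma fr_sigma_v {i : ℕ} (hi : i + 1 < d) : fr (sigma d b) (sigma d (v i)) = u i :=
  fr_eq_of (h.u_pos (by omega)).le (h.u_lt_one hi) (h.sigma_v i (by omega))

/-- The images of the sides in the chain confine chords that do not cross them. -/
lemma same_side {x y : Circ} (hx : ∀ i < d, x ≠ sigma d (v i)) (hy : ∀ i < d, y ≠ sigma d (v i))
    (hc : ∀ i, i + 1 < d → ¬ Crosses s(sigma d (v i), sigma d (v (i + 1))) s(x, y)) :
    ∀ i < d, (fr (sigma d b) x < u i ∧ fr (sigma d b) y < u i) ∨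
      (u i < fr (sigma d b) x ∧ u i < fr (sigma d b) y) := by
  have hlastx : 0 < fr (sigma d b) x := by
    rw [fr_pos, ← h.v_last]; exact hx _ (by have := h.d_pos; omega)
  have hlasty : 0 < fr (sigma d b) y := by
    rw [fr_pos, ← h.v_last]; exact hy _ (by have := h.d_pos; omega)
  -- Downward induction on `i`: at the top `u (d - 1) = 1` exceeds every coordinate, and the image
  -- of side `i` carries the claim from `i + 1` to `i`.
  have key : ∀ n i, i + n + 1 = d → (fr (sigma d b) x < u i ∧ fr (sigma d b) y < u i) ∨
      (u i < fr (sigma d b) x ∧ u i < fr (sigma d b) y) := by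
    intro n
    induction n with
    | zero =>
      intro i hi
      rw [show i = d - 1 by omega, h.last]
      exact Or.inl ⟨fr_lt_one _ _, fr_lt_one _ _⟩
    | succ n ih =>
      intro i hi
      have h1 := ih (i + 1) (by omega)
      have hne : ∀ z, z ≠ sigma d (v i) → fr (sigma d b) z ≠ u i := by
        intro z hz h2
        rw [← h.fr_sigma_v (by omega : i + 1 < d), fr_inj] at h2
        exact hz h2
      have hx' := hne x (hx i (by omega))
      have hy' := hne y (hy i (by omega))
      have h2 := hc i (by omega)
      rw [crosses_iff_coord (sigma d b), h.fr_sigma_v (by omega : i + 1 < d)] at h2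
      have h3 : fr (sigma d b) (sigma d (v (i + 1))) = u (i + 1) ∨
          fr (sigma d b) (sigma d (v (i + 1))) = 0 ∧ u (i + 1) = 1 := by
        rcases (show i + 1 + 1 < d ∨ i + 1 = d - 1 by omega) with h4 | h4
        · exact Or.inl (h.fr_sigma_v h4)
        · right
          rw [h4, h.v_last, fr_self]; exact ⟨rfl, h.last⟩
      have h4 := h.lt_succ i (by omega)
      have h5 := h.u_pos (i := i) (by omega)
      by_contra h6
      apply h2
      rcases h3 with h3 | ⟨h3, h3'⟩
      · rw [h3, RCross, min_eq_left h4.le, max_eq_right h4.le]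
        rcases lt_or_gt_of_ne hx' with h7 | h7 <;> rcases lt_or_gt_of_ne hy' with h8 | h8
        · exact absurd (Or.inl ⟨h7, h8⟩) h6
        · refine Or.inr ⟨h8, ?_, Or.inl h7⟩
          rcases h1 with h1 | h1 <;> linarith [h1.1, h1.2]
        · refine Or.inl ⟨h7, ?_, Or.inl h8⟩
          rcases h1 with h1 | h1 <;> linarith [h1.1, h1.2]
        · exact absurd (Or.inr ⟨h7, h8⟩) h6
      · rw [h3, RCross, min_eq_right h5.le, max_eq_left h5.le]
        rcases lt_or_gt_of_ne hx' with h7 | h7 <;> rcases lt_or_gt_of_ne hy' with h8 | h8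
        · exact absurd (Or.inl ⟨h7, h8⟩) h6
        · exact Or.inl ⟨hlastx, h7, Or.inr h8⟩
        · exact Or.inr ⟨hlasty, h8, Or.inr h7⟩
        · exact absurd (Or.inr ⟨h7, h8⟩) h6
  exact fun i hi => key (d - 1 - i) i (by omega)

lemma same_side_g {r s : ℝ}
    (hu : ∀ i < d, (r < u i ∧ s < u i) ∨ (u i < r ∧ u i < s)) (m : ℕ) (hm : m + 1 < d) :
    (r < g m ∧ s < g m) ∨ (g m < r ∧ g m < s) := by
  rcases h.g_eq m hm with h1 | h1 <;> rw [h1]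
  · exact hu m (by omega)
  · exact hu _ hm

/-- Leaves of an invariant family avoiding the critical chords have endpoints in the same arc, if
their images avoid the images of the chain. -/
lemma idx_eq {x y : Circ} (hC : ∀ c ∈ C, ¬ Crosses c s(x, y))
    (hx : ∀ i < d, sigma d x ≠ sigma d (v i)) (hy : ∀ i < d, sigma d y ≠ sigma d (v i))
    (hc : ∀ i, i + 1 < d →
      ¬ Crosses s(sigma d (v i), sigma d (v (i + 1))) s(sigma d x, sigma d y)) :
    idx d b x = idx d b y := by
  have hl := h.d_pos
  refine h.idx_eq_of_not_crosses hC ?_ ?_ fun m hm =>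
    h.same_side_g (h.same_side hx hy hc) m hm
  · rw [fr_pos, ← h.v_last]; exact hx _ (by omega)
  · rw [fr_pos, ← h.v_last]; exact hy _ (by omega)

lemma fr_v {i : ℕ} (hi : i + 1 < d) : d * fr b (v i) = i + u i := by
  rw [h.v_eq i (by omega), fr_brPt (by omega) (h.u_pos (by omega)).le (h.u_lt_one hi),
    mul_div_cancel₀ _ h.d_posR.ne']

lemma fr_v_zero : fr b (v 0) = u 0 / d := by
  have h1 := h.fr_v (i := 0) (by have := h.two_le; omega)
  have h2 := h.d_posR
  field_simp; push_cast at h1; linarith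

section
variable {F : Set Chord} {τ : Fin d → Circ → Circ} (hτ : IsPullbackScheme d F C τ)
include hτ

omit h in
lemma br_idx_scheme (hd : 0 < d) (i : Fin d) (w : Circ) : br d b (idx d b (τ i w)) w = τ i w := by
  conv_rhs => rw [← br_idx (b := b) hd (τ i w), hτ.right_inverse]

lemma mul_fr_scheme (i : Fin d) (w : Circ) :
    d * fr b (τ i w) = idx d b (τ i w) + fr (sigma d b) w := by
  rw [h.mul_fr, hτ.right_inverse]

/-- Neighbouring sides share a vertex, and only one branch reaches that vertex from its image; so
one branch fixes the whole chain. -/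
lemma exists_fixing_branch (hF : ∀ i, i + 1 < d → s(v i, v (i + 1)) ∈ F) :
    ∃ i₀, ∀ m < d, τ i₀ (sigma d (v m)) = v m := by
  have key : ∀ m, m + 1 < d →
      ∃ i, τ i (sigma d (v m)) = v m ∧ τ i (sigma d (v (m + 1))) = v (m + 1) := by
    intro m hm
    obtain ⟨i, hi⟩ := hτ.fixes _ (hF m hm)
    exact ⟨i, eq_of_map_eq (hτ.right_inverse i) hi⟩
  obtain ⟨i₀, hi₀, -⟩ := key 0 h.two_le
  refine ⟨i₀, fun m => ?_⟩
  induction m with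
  | zero => exact fun _ => hi₀
  | succ m ih =>
    intro hm
    obtain ⟨i, hi, hi'⟩ := key m hm
    have : i = i₀ := hτ.disjoint_images (sigma d (v m)) (hi.trans (ih (by omega)).symm)
    rwa [← this]

/-- Below the first critical value, the branches are the canonical ones up to numbering. -/
lemma exists_branch_index (hF : ∀ i, i + 1 < d → s(v i, v (i + 1)) ∈ F) :
    ∃ r : Fin d → Fin d, Bijective r ∧
      ∀ i w, fr (sigma d b) w ≤ u 0 → τ i w = br d b (r i) w := by
  have hd0 := h.d_pos
  have h2 := h.two_le
  have hu0 := h.pos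
  have hu1 : u 0 < 1 := h.u_lt_one h2
  -- A test point strictly below the first critical value; it numbers the branches.
  set w₀ : Circ := sigma d b + ((u 0 / 2 : ℝ) : Circ) with hw₀
  have hfw₀ : fr (sigma d b) w₀ = u 0 / 2 := fr_add_coe (by linarith) (by linarith)
  set R : Fin d → ℕ := fun i => idx d b (τ i w₀) with hR
  have hopen : ∀ i w, 0 < fr (sigma d b) w → fr (sigma d b) w < u 0 → idx d b (τ i w) = R i := by
    intro i w hw hw'
    refine h.idx_eq_of_not_crosses (fun c hc => hτ.not_crosses hc i _ _) ?_ ?_ fun m hm => ?_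
    · rwa [hτ.right_inverse]
    · rw [hτ.right_inverse, hfw₀]; linarith
    · rw [hτ.right_inverse, hτ.right_inverse, hfw₀]
      have := h.u_zero_le_g hm
      exact Or.inl ⟨by linarith, by linarith⟩
  have hRd : ∀ i, R i < d := fun i => idx_lt hd0 _
  have hRinj : Injective R := by
    intro i j hij
    apply hτ.disjoint_images w₀
    change τ i w₀ = τ j w₀
    rw [← br_idx_scheme (b := b) hτ hd0, ← br_idx_scheme (b := b) hτ hd0 j]
    exact congrArg (fun k => br d b k w₀) hij
  have hz : ∀ i, d * fr b (τ i w₀) = R i + u 0 / 2 := by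
    intro i; rw [h.mul_fr_scheme hτ, hfw₀]
  have hzb : ∀ i, τ i w₀ ≠ b := by
    intro i
    apply ne_of_fr_sigma_pos (d := d)
    rw [hτ.right_inverse, hfw₀]; linarith
  have hfix := h.exists_fixing_branch hτ hF
  obtain ⟨i₀, hi₀⟩ := hfix
  -- Otherwise the preimage of the test point would be under a guiding chord, with a vertex of the
  -- chain, reached by the same branch, outside it.
  have hR0 : R i₀ = 0 := by
    by_contra hne
    obtain ⟨m, hm⟩ : ∃ m, R i₀ = m + 1 := ⟨R i₀ - 1, by omega⟩
    have hmd : m + 1 < d := by have := hRd i₀; omega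
    have hzi := hz i₀
    rw [hm] at hzi
    push_cast at hzi
    have hg0 := h.u_zero_le_g hmd
    have hg1 := h.g_le_one hmd
    have hno : ∀ k < d, ¬ Crosses s(brPt d b m (g m), brPt d b (m + 1) (g m)) s(τ i₀ w₀, v k) := by
      intro k hk
      have := hτ.not_crosses (h.mem _ hmd) i₀ w₀ (sigma d (v k))
      rwa [hi₀ k hk] at this
    rcases h.g_eq m hmd with hg | hg
    · apply hno (m + 1) hmd
      rw [h.crosses_guide_iff hmd]
      have hu := h.u_lt_one hmd
      have hd1 : (m : ℝ) + 1 + 1 ≤ d := by exact_mod_cast hmd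
      refine Or.inl ⟨by linarith, by linarith, ?_, fun hB => by linarith⟩
      rcases (show m + 1 + 1 < d ∨ m + 1 = d - 1 by omega) with h3 | h3
      · right
        rw [h.fr_v h3]
        have := h.lt_succ m hmd
        push_cast; linarith
      · left
        rw [h3, h.v_last, fr_self, mul_zero]
        have : (0 : ℝ) ≤ m := Nat.cast_nonneg m
        linarith
    · apply hno m (by omega)
      rw [h.crosses_guide_iff hmd]
      refine Or.inl ⟨by linarith, by linarith, Or.inl ?_, fun _ => ?_⟩
      · rw [h.fr_v hmd]
        have := h.lt_succ m hmd
        linarith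
      · apply ne_of_fr_sigma_pos (d := d)
        rw [h.fr_sigma_v hmd]
        exact h.u_pos (by omega)
  have hRsurj : ∀ j < d, ∃ i, R i = j := by
    have : Injective fun i => (⟨R i, hRd i⟩ : Fin d) := fun i j hij => hRinj (by simpa using hij)
    intro j hj
    obtain ⟨i, hi⟩ := (Finite.injective_iff_surjective.1 this) ⟨j, hj⟩
    exact ⟨i, by simpa using hi⟩
  have hinjτ : ∀ i j w, idx d b (τ i w) = idx d b (τ j w) → i = j := by
    intro i j w hij
    apply hτ.disjoint_images w
    change τ i w = τ j w
    rw [← br_idx_scheme (b := b) hτ hd0, ← br_idx_scheme (b := b) hτ hd0 j, hij]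
  -- At `σ_d b` the guiding chords leave a few exceptions, all involving the last arc. They are then
  -- excluded by counting: distinct branches take distinct values, and `i₀` already takes `b`.
  have hlow : ∀ i, idx d b (τ i (sigma d b)) = R i ∨ (idx d b (τ i (sigma d b)) = d - 1) ∨
      (R i = d - 1 ∧ idx d b (τ i (sigma d b)) = 0) := by
    intro i
    set y := τ i (sigma d b) with hy
    have hyD : d * fr b y = idx d b y := by
      rw [h.mul_fr_scheme hτ, fr_self, add_zero]
    have hzi := hz i
    rcases lt_trichotomy (idx d b y) (R i) with h3 | h3 | h3
    · right; right
      obtain ⟨m, hm⟩ : ∃ m, R i = m + 1 := ⟨R i - 1, by omega⟩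
      have hmd : m + 1 < d := by have := hRd i; omega
      have hno := hτ.not_crosses (h.mem _ hmd) i w₀ (sigma d b)
      rw [h.crosses_guide_iff hmd, ← hy, hzi, hyD] at hno
      have hg0 := h.u_zero_le_g hmd
      have hg1 := h.g_le_one hmd
      have h4 : (idx d b y : ℝ) ≤ m := by exact_mod_cast (by omega : idx d b y ≤ m)
      have h5 : (R i : ℝ) = m + 1 := by exact_mod_cast hm
      have hd1 : (m : ℝ) + 1 + 1 ≤ d := by exact_mod_cast hmd
      by_cases h6 : (m : ℝ) + 1 + g m = d → y ≠ b
      · exact absurd (Or.inl ⟨by linarith, by linarith, Or.inl (by linarith), h6⟩) hno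
      · push Not at h6
        have h7 : (m : ℝ) + 1 + 1 = d := by linarith [h6.1]
        have h8 : m + 1 + 1 = d := by exact_mod_cast h7
        refine ⟨by omega, ?_⟩
        rw [h6.2, MACFrame.idx_b]
    · exact Or.inl h3
    · right; left
      have hyd : idx d b y < d := idx_lt hd0 y
      obtain ⟨m, hm⟩ : ∃ m, idx d b y = m + 1 := ⟨idx d b y - 1, by omega⟩
      have hmd : m + 1 < d := by omega
      have hno := hτ.not_crosses (h.mem _ hmd) i w₀ (sigma d b)
      rw [h.crosses_guide_iff hmd, ← hy, hzi, hyD] at hno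
      have hg0 := h.u_zero_le_g hmd
      have h4 : (R i : ℝ) ≤ m := by exact_mod_cast (by omega : R i ≤ m)
      have h5 : (idx d b y : ℝ) = m + 1 := by exact_mod_cast hm
      by_contra h6
      have hg1 : g m < 1 := (h.g_le hmd).trans_lt (h.u_lt_one (by omega))
      exact hno (Or.inr ⟨by linarith, by linarith, Or.inl (by linarith), fun _ => hzb i⟩)
  have hb : ∀ i, idx d b (τ i (sigma d b)) = R i := by
    have h3 : idx d b (τ i₀ (sigma d b)) = 0 := by
      have := hi₀ (d - 1) (by omega)
      rw [h.v_last] at this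
      rw [this, MACFrame.idx_b]
    obtain ⟨i₁, hi₁⟩ := hRsurj (d - 1) (by omega)
    have h4 : idx d b (τ i₁ (sigma d b)) = d - 1 := by
      rcases hlow i₁ with h5 | h5 | h5
      · rw [h5, hi₁]
      · exact h5
      · have := hinjτ i₁ i₀ _ (h5.2.trans h3.symm)
        rw [this, hR0] at hi₁; omega
    intro i
    rcases hlow i with h5 | h5 | h5
    · exact h5
    · rw [hinjτ i i₁ _ (h5.trans h4.symm), h4, hi₁]
    · rw [hRinj (h5.1.trans hi₁.symm), h4, hi₁]
  have hσa : fr (sigma d b) (sigma d (v 0)) = u 0 := h.fr_sigma_v h2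
  -- The upper end `σ_d (v 0)` may be the critical value of the first guiding chord, so only the
  -- first two arcs could be confused; `i₀`, which takes `v 0`, settles this.
  have hhigh : ∀ i, idx d b (τ i (sigma d (v 0))) = R i ∨
      (R i = 1 ∧ idx d b (τ i (sigma d (v 0))) = 0) ∨ R i = 0 := by
    intro i
    set y := τ i (sigma d (v 0)) with hy
    have hyD : d * fr b y = idx d b y + u 0 := by
      rw [h.mul_fr_scheme hτ, hσa]
    have hyb : y ≠ b := by
      apply ne_of_fr_sigma_pos (d := d)
      rw [hτ.right_inverse, hσa]; exact hu0
    have hzi := hz i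
    have hgm : ∀ m, m + 1 < d → m ≠ 0 → u 0 < g m := fun m hm hm0 =>
      (h.u_lt (by omega) (by omega)).trans_le (h.le_g hm)
    rcases lt_trichotomy (idx d b y) (R i) with h3 | h3 | h3
    · obtain ⟨m, hm⟩ : ∃ m, R i = m + 1 := ⟨R i - 1, by omega⟩
      have hmd : m + 1 < d := by have := hRd i; omega
      by_cases h6 : m = 0
      · right; left; omega
      · exfalso
        have hno := hτ.not_crosses (h.mem _ hmd) i w₀ (sigma d (v 0))
        rw [h.crosses_guide_iff hmd, ← hy, hzi, hyD] at hno
        have hg0 := hgm m hmd h6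
        have hg1 := h.g_le_one hmd
        have h4 : (idx d b y : ℝ) ≤ m := by exact_mod_cast (by omega : idx d b y ≤ m)
        have h5 : (R i : ℝ) = m + 1 := by exact_mod_cast hm
        exact hno (Or.inl ⟨by linarith, by linarith, Or.inl (by linarith), fun _ => hyb⟩)
    · exact Or.inl h3
    · have hyd : idx d b y < d := idx_lt hd0 y
      obtain ⟨m, hm⟩ : ∃ m, idx d b y = m + 1 := ⟨idx d b y - 1, by omega⟩
      have hmd : m + 1 < d := by omega
      by_cases h6 : m = 0
      · right; right; omega
      · exfalso
        have hno := hτ.not_crosses (h.mem _ hmd) i w₀ (sigma d (v 0))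
        rw [h.crosses_guide_iff hmd, ← hy, hzi, hyD] at hno
        have hg0 := hgm m hmd h6
        have hg1 := h.g_le_one hmd
        have h4 : (R i : ℝ) ≤ m := by exact_mod_cast (by omega : R i ≤ m)
        have h5 : (idx d b y : ℝ) = m + 1 := by exact_mod_cast hm
        exact hno (Or.inr ⟨by linarith, by linarith, Or.inl (by linarith), fun _ => hzb i⟩)
  have ha : ∀ i, idx d b (τ i (sigma d (v 0))) = R i := by
    have h3 : idx d b (τ i₀ (sigma d (v 0))) = 0 := by
      rw [hi₀ 0 hd0, idx, h.fr_v h2]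
      simpa using hu1
    intro i
    rcases hhigh i with h5 | h5 | h5
    · exact h5
    · have := hinjτ i i₀ _ (h5.2.trans h3.symm)
      rw [this, hR0] at h5; omega
    · rw [hRinj (h5.trans hR0.symm), h3, hR0]
  refine ⟨fun i => ⟨R i, hRd i⟩, ?_, fun i w hw => ?_⟩
  · rw [← Finite.injective_iff_bijective]
    exact fun i j hij => hRinj (by simpa using hij)
  · have h3 : idx d b (τ i w) = R i := by
      rcases (fr_nonneg (sigma d b) w).lt_or_eq with h4 | h4
      · rcases hw.lt_or_eq with h5 | h5
        · exact hopen i w h4 h5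
        · rw [← hσa, fr_inj] at h5
          rw [h5]; exact ha i
      · rw [eq_comm, fr_eq_zero] at h4
        rw [h4]; exact hb i
    rw [← br_idx_scheme (b := b) hτ hd0, h3]

end

end ChainFrame

/-! ### Pullbacks of the closing leaf against the sides of the chain -/

namespace ChainFrame

variable {d : ℕ} {v : ℕ → Circ} {C : Set Chord} {b : Circ} {u g : ℕ → ℝ}
variable (h : ChainFrame d v C b u g)
include h

lemma crosses_chain_iff {m : ℕ} (hm : m + 1 < d) {x y : Circ} :
    Crosses s(v m, v (m + 1)) s(x, y) ↔
      (m + u m < d * fr b x ∧ d * fr b x < m + 1 + u (m + 1) ∧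
        (d * fr b y < m + u m ∨ m + 1 + u (m + 1) < d * fr b y) ∧
        (m + 1 + u (m + 1) = d → y ≠ b)) ∨
      (m + u m < d * fr b y ∧ d * fr b y < m + 1 + u (m + 1) ∧
        (d * fr b x < m + u m ∨ m + 1 + u (m + 1) < d * fr b x) ∧
        (m + 1 + u (m + 1) = d → x ≠ b)) := by
  have hd := h.d_posR
  have h1 := h.u_pos (i := m) (by omega)
  have h2 := h.u_le_one hm
  have h5 := h.lt_succ m hm
  have h3 : (m : ℝ) + 1 + 1 ≤ d := by exact_mod_cast (by omega : m + 1 + 1 ≤ d)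
  have h4 : (2 : ℝ) ≤ d := by exact_mod_cast h.two_le
  rw [h.v_eq m (by omega), h.v_eq _ hm, brPt, brPt, crosses_arc_iff (by positivity)]
  · push_cast
    simp only [div_lt_iff₀ hd, lt_div_iff₀ hd, div_eq_one_iff_eq hd.ne', mul_comm _ (d : ℝ), Ne,
      fr_eq_zero]
  · push_cast; rw [div_lt_div_iff_of_pos_right hd]; linarith
  · push_cast; rw [div_le_one hd]; linarith
  · push_cast; rw [← sub_div, div_lt_one hd]; linarith

/-- A chord in one of the arcs of length `1/d` crosses no side in the chain if no critical value is
below its image. -/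
lemma not_crosses_chain {x y : Circ} (hxy : idx d b x = idx d b y)
    (hu : ∀ m < d, ¬ (fr (sigma d b) (sigma d x) < u m ∧ u m < fr (sigma d b) (sigma d y)) ∧
      ¬ (fr (sigma d b) (sigma d y) < u m ∧ u m < fr (sigma d b) (sigma d x)))
    {m : ℕ} (hm : m + 1 < d) : ¬ Crosses s(v m, v (m + 1)) s(x, y) := by
  have key : ∀ i : ℕ, ∀ r s : ℝ, 0 ≤ r → r < 1 → 0 ≤ s → s < 1 →
      (∀ m < d, ¬ (r < u m ∧ u m < s) ∧ ¬ (s < u m ∧ u m < r)) →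
      ¬ (m + u m < i + r ∧ i + r < m + 1 + u (m + 1) ∧
        (i + s < m + u m ∨ m + 1 + u (m + 1) < i + s)) := by
    rintro i r s hr hr' hs hs' hu ⟨h1, h2, h3⟩
    have hm0 := h.u_pos (i := m) (by omega)
    have hm1 := h.u_le_one hm
    have hlt := h.lt_succ m hm
    have him : i < m + 2 := by
      have : (i : ℝ) < m + 2 := by linarith
      exact_mod_cast this
    have hmi : m < i + 1 := by
      have : (m : ℝ) < i + 1 := by linarith
      exact_mod_cast this
    rcases (show i = m ∨ i = m + 1 by omega) with rfl | rfl
    · rcases h3 with h3 | h3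
      · exact (hu i (by omega)).2 ⟨by linarith, by linarith⟩
      · linarith
    · push_cast at h1 h2 h3
      rcases h3 with h3 | h3
      · linarith
      · exact (hu (m + 1) hm).1 ⟨by linarith, by linarith⟩
  rw [h.crosses_chain_iff hm, h.mul_fr x, h.mul_fr y, hxy]
  rintro (⟨h1, h2, h3, -⟩ | ⟨h1, h2, h3, -⟩)
  · exact key _ _ _ (fr_nonneg _ _) (fr_lt_one _ _) (fr_nonneg _ _) (fr_lt_one _ _) hu ⟨h1, h2, h3⟩
  · exact key _ _ _ (fr_nonneg _ _) (fr_lt_one _ _) (fr_nonneg _ _) (fr_lt_one _ _)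
      (fun m hm => (hu m hm).symm) ⟨h1, h2, h3⟩

section
variable (hM : MACFrame d (v 0) b (u 0)) (hper : ∀ i < d, v i ∈ periodicPts (sigma d))
include hM hper

omit h in
-- Images of vertices in the chain are periodic, so a pullback leaf ending there is in the orbit of
-- the MAC leaf, all of which is low.
lemma ne_sigma_v_of_high {x y : Circ} (he : s(x, y) ∈ macPullback d (v 0) b)
    (hx : u 0 < fr (sigma d b) x) (i : ℕ) (hi : i < d) : x ≠ sigma d (v i) := by
  rintro rfl
  have := hM.orbit_low (hM.mem_orbit_of_periodic he (Sym2.mem_mk_left _ _)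
    (iterate_mem_periodicPts (hper i hi) 1)) (Sym2.mem_mk_left _ _)
  linarith

/-- The images of the vertices in the chain are not below the leaves in the pullback. -/
lemma not_between {x y : Circ} (he : s(x, y) ∈ macPullback d (v 0) b)
    (hc : ∀ i, i + 1 < d → ¬ Crosses s(sigma d (v i), sigma d (v (i + 1))) s(x, y)) :
    ∀ m < d, ¬ (fr (sigma d b) x < u m ∧ u m < fr (sigma d b) y) ∧
      ¬ (fr (sigma d b) y < u m ∧ u m < fr (sigma d b) x) := by
  intro m hm
  have hum := h.u_le (Nat.zero_le m) hm
  by_cases hx : fr (sigma d b) x ≤ u 0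
  · have hy := (hM.low_iff he).1 hx
    exact ⟨fun h1 => by linarith [h1.2], fun h1 => by linarith [h1.2]⟩
  · have hy := mt (hM.low_iff he).2 hx
    push Not at hx hy
    have := h.same_side (ne_sigma_v_of_high hM hper he hx)
      (ne_sigma_v_of_high hM hper (by rwa [Sym2.eq_swap]) hy) hc m hm
    constructor
    · rintro ⟨h1, h2⟩
      rcases this with h3 | h3 <;> linarith [h3.1, h3.2]
    · rintro ⟨h1, h2⟩
      rcases this with h3 | h3 <;> linarith [h3.1, h3.2]

/-- The pullback of the orbit of the leaf `s(v 0, b)` crosses no image of a side. -/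
lemma not_crosses_macPullback {X : Set Chord}
    (h1 : ∀ i, i + 1 < d → s(sigma d (v i), sigma d (v (i + 1))) ∈ X)
    (h2 : ∀ x y, s(x, y) ∈ X → (∃ i, i + 1 < d ∧ s(x, y) = s(v i, v (i + 1))) ∨
      (idx d b x = idx d b y ∧ s(sigma d x, sigma d y) ∈ X))
    (h3 : ∀ e ∈ forwardOrbit d {s(v 0, b)}, ∀ s ∈ X, ¬ Crosses s e) :
    ∀ e ∈ macPullback d (v 0) b, ∀ s ∈ X, ¬ Crosses s e := by
  refine pullback_induction h3 fun e he ih i s hs => ?_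
  induction e using Sym2.ind with | _ x' y'
  induction s using Sym2.ind with | _ x y
  rcases h2 x y hs with ⟨m, hm, hxy⟩ | ⟨hxy, hσ⟩
  · rw [hxy, Sym2.map_mk]
    refine h.not_crosses_chain (by rw [brF, idx_br i.2, idx_br i.2]) ?_ hm
    rw [sigma_brF h.d_pos, sigma_brF h.d_pos]
    exact h.not_between hM hper he fun i hi => ih _ (h1 i hi)
  · have e1 : s(x, y) = Sym2.map (br d b (idx d b x)) s(sigma d x, sigma d y) := by
      rw [Sym2.map_mk, br_idx h.d_pos, hxy, br_idx h.d_pos]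
    rw [e1, brF]
    by_cases hi : idx d b x = i
    · rw [hi, crosses_map_br i.2]
      exact ih _ hσ
    · exact not_crosses_map_br (idx_lt h.d_pos x) i.2 hi _ _

/-- On low leaves the branches are canonical up to numbering. A high leaf crosses no image of the
chain, so no critical value separates its ends and each branch sends both into one arc, with a
number that may depend on the leaf. -/
lemma pullback_eq_macPullback {F : Set Chord} {τ : Fin d → Circ → Circ}
    (hτ : IsPullbackScheme d F C τ) (hF : ∀ i, i + 1 < d → s(v i, v (i + 1)) ∈ F)
    (hc : ∀ e ∈ macPullback d (v 0) b, ∀ i, i + 1 < d →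
      ¬ Crosses s(sigma d (v i), sigma d (v (i + 1))) e) :
    pullback τ (forwardOrbit d {s(v 0, b)}) = macPullback d (v 0) b := by
  obtain ⟨r, hr, hlow⟩ := h.exists_branch_index hτ hF
  refine MACFrame.pullback_eq hτ.disjoint_images fun x y he i => ?_
  by_cases hx : fr (sigma d b) x ≤ u 0
  · exact ⟨r i, hlow i x hx, hlow i y ((hM.low_iff he).1 hx)⟩
  · have hy := mt (hM.low_iff he).2 hx
    push Not at hx hy
    have hidx : idx d b (τ i x) = idx d b (τ i y) := by
      refine h.idx_eq (fun c hc => hτ.not_crosses hc i x y) ?_ ?_ ?_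
      · rw [hτ.right_inverse]; exact ne_sigma_v_of_high hM hper he hx
      · rw [hτ.right_inverse]
        exact ne_sigma_v_of_high hM hper (by rwa [Sym2.eq_swap]) hy
      · rw [hτ.right_inverse, hτ.right_inverse]; exact hc _ he
    refine ⟨⟨_, idx_lt h.d_pos (τ i x)⟩, (br_idx_scheme hτ h.d_pos i x).symm, ?_⟩
    simp only [brF]
    rw [hidx, br_idx_scheme hτ h.d_pos i y]

end

/-! ### The leaf closing the chain of an identity return polygon -/

lemma eq_add : v 0 = b + ((u 0 / d : ℝ) : Circ) := by
  rw [h.v_eq 0 h.d_pos, brPt]; simp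

lemma idx_v_zero : idx d b (v 0) = 0 := by
  rw [idx, h.fr_v_zero, mul_div_cancel₀ _ h.d_posR.ne', Nat.floor_eq_zero]
  exact h.u_lt_one h.two_le

/-- If the iterates of the leaf `s(v 0, b)` avoid the vertices in the chain except at the multiples
of a period, then they lie in the arcs of the length of the leaf. -/
lemma macFrame_of_return {n : ℕ} (hn : 0 < n) (ha : (sigma d)^[n] (v 0) = v 0)
    (hb : (sigma d)^[n] b = b)
    (hne : ∀ k, ¬ n ∣ k → ∀ i < d, (sigma d)^[k + 1] (v 0) ≠ sigma d (v i) ∧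
      (sigma d)^[k + 1] b ≠ sigma d (v i))
    (hcr : ∀ k i, i + 1 < d →
      ¬ Crosses s(sigma d (v i), sigma d (v (i + 1))) (chordIter d (k + 1) s(v 0, b)))
    (hC : ∀ k, ∀ c ∈ C, ¬ Crosses c (chordIter d k s(v 0, b)))
    (hnc : ∀ i j, ¬ Crosses (chordIter d i s(v 0, b)) (chordIter d j s(v 0, b))) :
    MACFrame d (v 0) b (u 0) := by
  have hd := h.d_posR
  have hd2 : (2 : ℝ) ≤ d := by exact_mod_cast h.two_le
  have hu0 := h.pos
  have hu1 := h.u_lt_one h.two_le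
  have hper : ∀ k, n ∣ k → (sigma d)^[k] (v 0) = v 0 ∧ (sigma d)^[k] b = b := by
    rintro k ⟨m, rfl⟩
    rw [mul_comm]
    exact ⟨iterate_mul_of_fixed ha m, iterate_mul_of_fixed hb m⟩
  have hσa : fr (sigma d b) (sigma d (v 0)) = u 0 := h.fr_sigma_v h.two_le
  have hsame : ∀ k, idx d b ((sigma d)^[k] (v 0)) = idx d b ((sigma d)^[k] b) := by
    intro k
    by_cases hk : n ∣ k
    · rw [(hper k hk).1, (hper k hk).2, h.idx_v_zero, MACFrame.idx_b]
    · refine h.idx_eq (hC k) ?_ ?_ fun i hi => ?_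
      · simpa only [iterate_succ_apply'] using fun i hi => (hne k hk i hi).1
      · simpa only [iterate_succ_apply'] using fun i hi => (hne k hk i hi).2
      · simpa only [chordIter_mk, iterate_succ_apply'] using hcr k i hi
  set X : ℕ → ℝ := fun k => fr (sigma d b) ((sigma d)^[k] (v 0)) with hX
  set Y : ℕ → ℝ := fun k => fr (sigma d b) ((sigma d)^[k] b) with hY
  set len : ℕ → ℝ := fun k => ‖(sigma d)^[k] (v 0) - (sigma d)^[k] b‖ with hlen
  have hlen1 : ∀ k, d * len k = |X (k + 1) - Y (k + 1)| := by
    intro k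
    simp only [hlen, hX, hY]
    rw [chordLength_of_idx_eq h.two_le (hsame k), iterate_succ_apply', iterate_succ_apply']
    field_simp
  have hlen2 : ∀ k, len (k + 1) = min (d * len k) (1 - d * len k) := by
    intro k
    rw [hlen1]
    exact norm_sub_eq (sigma d b) _ _
  have hside : ∀ k, ¬ n ∣ k → (X (k + 1) < u 0 ∧ Y (k + 1) < u 0) ∨
      (u 0 < X (k + 1) ∧ u 0 < Y (k + 1)) := fun k hk =>
    h.same_side (fun i hi => (hne k hk i hi).1) (fun i hi => (hne k hk i hi).2) (hcr k) 0 h.d_pos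
  have hX0 : ∀ k, 0 ≤ X k := fun k => fr_nonneg _ _
  have hX1 : ∀ k, X k < 1 := fun k => fr_lt_one _ _
  have hY0 : ∀ k, 0 ≤ Y k := fun k => fr_nonneg _ _
  have hY1 : ∀ k, Y k < 1 := fun k => fr_lt_one _ _
  have hlow_len : ∀ k, X (k + 1) < u 0 → Y (k + 1) < u 0 → d * len k < u 0 := by
    intro k h1 h2
    rw [hlen1, abs_lt]; constructor <;> linarith [hX0 (k + 1), hY0 (k + 1)]
  have hhigh_len : ∀ k, u 0 < X (k + 1) → u 0 < Y (k + 1) → d * len k < 1 - u 0 := by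
    intro k h1 h2
    rw [hlen1, abs_lt]; constructor <;> linarith [hX1 (k + 1), hY1 (k + 1)]
  have hlenper : ∀ k, n ∣ k → d * len k = u 0 := by
    intro k hk
    rw [hlen1]
    simp only [hX, hY]
    rw [iterate_succ_apply', iterate_succ_apply', (hper k hk).1, (hper k hk).2, hσa, fr_self,
      sub_zero, abs_of_pos hu0]
  have hmul : ∀ r : ℝ, 0 ≤ r → 2 * r ≤ d * r := fun r hr => mul_le_mul_of_nonneg_right hd2 hr
  -- If `u 0 ≤ 1/2`, lengths start at `u 0` after one step and cannot drop below it during the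
  -- period; but on return the length must be `u 0 / d`.
  have hhalf : 1 / 2 < u 0 := by
    by_contra hle
    push Not at hle
    have key : ∀ k, k < n → u 0 ≤ len (k + 1) := by
      intro k
      induction k with
      | zero =>
        intro _
        rw [hlen2, hlenper 0 (dvd_zero n), le_min_iff]
        exact ⟨le_rfl, by linarith⟩
      | succ k ih =>
        intro hk
        have h1 := ih (by omega)
        have h2 := hmul (len (k + 1)) (by linarith)
        have hnd : ¬ n ∣ k + 1 := fun hdvd => by
          have := Nat.le_of_dvd (by omega) hdvd; omega
        rw [hlen2, le_min_iff]
        rcases hside (k + 1) hnd with h3 | h3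
        · have := hlow_len (k + 1) h3.1 h3.2; linarith
        · have := hhigh_len (k + 1) h3.1 h3.2
          exact ⟨by linarith, by linarith⟩
    have h1 := key (n - 1) (by omega)
    rw [Nat.sub_add_cancel hn] at h1
    have h2 := hlenper n dvd_rfl
    have h3 := hmul (len n) (by linarith)
    linarith
  -- The bound `1 - u 0` is the length of the image of the leaf itself, and later lengths never fall
  -- below it.
  have hlong : ∀ k, 1 - u 0 ≤ len (k + 1) := by
    intro k
    induction k with
    | zero =>
      rw [hlen2, hlenper 0 (dvd_zero n), le_min_iff]
      exact ⟨by linarith, le_rfl⟩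
    | succ k ih =>
      rw [hlen2, le_min_iff]
      by_cases hk : n ∣ k + 1
      · rw [hlenper _ hk]; exact ⟨by linarith, le_rfl⟩
      · have h2 := hmul (len (k + 1)) (by linarith)
        rcases hside (k + 1) hk with h3 | h3
        · have := hlow_len (k + 1) h3.1 h3.2
          exact ⟨by linarith, by linarith⟩
        · have := hhigh_len (k + 1) h3.1 h3.2; linarith
  have hlow : ∀ k, X (k + 1) ≤ u 0 ∧ Y (k + 1) ≤ u 0 := by
    intro k
    by_cases hk : n ∣ k
    · simp only [hX, hY]
      rw [iterate_succ_apply', iterate_succ_apply', (hper k hk).1, (hper k hk).2, hσa, fr_self]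
      exact ⟨le_rfl, hu0.le⟩
    · rcases hside k hk with h3 | h3
      · exact ⟨h3.1.le, h3.2.le⟩
      -- Above `u 0` there is room for less than `1 - u 0`, but a chord at least that long has just
      -- been stretched by `d ≥ 2`.
      · exfalso
        have h4 := hhigh_len k h3.1 h3.2
        obtain ⟨m, rfl⟩ : ∃ m, k = m + 1 := ⟨k - 1, by
          have : k ≠ 0 := by rintro rfl; exact hk (dvd_zero n)
          omega⟩
        have h5 := hlong m
        have h6 := hmul (len (m + 1)) (by linarith)
        linarith
  refine ⟨h.two_le, hu0, hu1, h.eq_add, ⟨n, hn, ha, hb⟩, fun k => ?_, hsame, hnc⟩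
  -- The bound was shown for positive iterates; a full period covers the zeroth one as well.
  have h1 := hlow (k + (n - 1))
  simp only [hX, hY] at h1
  rw [show k + (n - 1) + 1 = k + n by omega, iterate_add_apply, iterate_add_apply, ha, hb] at h1
  exact h1

end ChainFrame

/-! ### Vertices of polygons in circular order -/

lemma Consecutive.sbtw_false {P : Set Circ} {x y z : Circ} (h : Consecutive P x y) (hz : z ∈ P) :
    ¬ sbtw x z y := h.2.2.2 z hz

lemma Consecutive.mono {P Q : Set Circ} {x y : Circ} (h : Consecutive P x y) (hQ : Q ⊆ P)
    (hx : x ∈ Q) (hy : y ∈ Q) : Consecutive Q x y :=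
  ⟨hx, hy, h.2.2.1, fun z hz => h.2.2.2 z (hQ hz)⟩

lemma Consecutive.right_unique {P : Set Circ} {x y y' : Circ} (h : Consecutive P x y)
    (h' : Consecutive P x y') : y = y' := by
  rw [← fr_inj (c := x)]
  rcases lt_trichotomy (fr x y) (fr x y') with h1 | h1 | h1
  · exact absurd (sbtw_iff_fr.2 ⟨fr_pos.2 h.2.2.1.symm, h1⟩) (h'.sbtw_false h.2.1)
  · exact h1
  · exact absurd (sbtw_iff_fr.2 ⟨fr_pos.2 h'.2.2.1.symm, h1⟩) (h.sbtw_false h'.2.1)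

lemma Consecutive.left_unique {P : Set Circ} {x x' y : Circ} (h : Consecutive P x y)
    (h' : Consecutive P x' y) : x = x' := by
  rw [← fr_inj (c := y)]
  have key : ∀ {x x'}, Consecutive P x y → Consecutive P x' y → ¬ fr y x < fr y x' := by
    intro x x' h h' h1
    apply h.sbtw_false h'.1
    rw [sbtw_iff_cyc y, fr_self]
    exact Or.inr (Or.inr ⟨fr_pos.2 h.2.2.1, h1⟩)
  exact le_antisymm (not_lt.1 (key h' h)) (not_lt.1 (key h h'))

lemma Consecutive.not_crosses {P : Set Circ} {p q x y : Circ} (h : Consecutive P p q)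
    (hx : x ∈ P) (hy : y ∈ P) : ¬ Crosses s(p, q) s(x, y) := by
  rw [crosses_mk_iff]
  rintro (⟨h1, -⟩ | ⟨h1, -⟩)
  · exact h.sbtw_false hx h1
  · exact h.sbtw_false hy h1

lemma IsSide.mono {P Q : Set Circ} {x y : Circ} (h : IsSide P s(x, y)) (hQ : Q ⊆ P)
    (hx : x ∈ Q) (hy : y ∈ Q) : IsSide Q s(x, y) := by
  obtain ⟨p, q, h1, h2⟩ := h
  rcases Sym2.eq_iff.1 h2 with ⟨rfl, rfl⟩ | ⟨rfl, rfl⟩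
  · exact ⟨x, y, h1.mono hQ hx hy, rfl⟩
  · exact ⟨y, x, h1.mono hQ hy hx, h2⟩

/-- A polygon has at most two sides at each vertex. -/
lemma eq_or_eq_of_isSide {P : Set Circ} {x y y₁ y₂ : Circ} (h1 : IsSide P s(x, y₁))
    (h2 : IsSide P s(x, y₂)) (h12 : y₁ ≠ y₂) (h : IsSide P s(x, y)) : y = y₁ ∨ y = y₂ := by
  have key : ∀ {z}, IsSide P s(x, z) → Consecutive P x z ∨ Consecutive P z x := by
    rintro z ⟨p, q, h1, h2⟩
    rcases Sym2.eq_iff.1 h2 with ⟨rfl, rfl⟩ | ⟨rfl, rfl⟩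
    · exact Or.inl h1
    · exact Or.inr h1
  rcases key h1 with h1 | h1 <;> rcases key h2 with h2 | h2 <;> rcases key h with h | h
  · exact absurd (h1.right_unique h2) h12
  · exact absurd (h1.right_unique h2) h12
  · exact Or.inl (h.right_unique h1)
  · exact Or.inr (h.left_unique h2)
  · exact Or.inr (h.right_unique h2)
  · exact Or.inl (h.left_unique h1)
  · exact absurd (h1.left_unique h2) h12
  · exact absurd (h1.left_unique h2) h12

/-- Enumeration of the vertices of a polygon in circular order, with period `N`. -/
structure CyclicEnum (P : Set Circ) (N : ℕ) (p : ℕ → Circ) : Prop where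
  two_le : 2 ≤ N
  range_eq : range p = P
  mod : ∀ i, p (i % N) = p i
  fr_lt : ∀ i j, i < j → j < N → fr (p 0) (p i) < fr (p 0) (p j)

/-- Sort the coordinates counted from `b` and extend periodically. -/
lemma exists_cyclicEnum {P : Set Circ} (hP : 2 ≤ P.ncard) {b : Circ} (hb : b ∈ P) :
    ∃ p, CyclicEnum P P.ncard p ∧ p 0 = b := by
  classical
  have hfin : P.Finite := finite_of_ncard_pos (by omega)
  obtain ⟨A, rfl⟩ := hfin.exists_finset_coe
  rw [ncard_coe_finset] at *
  have hcard : (A.image (fr b)).card = A.card :=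
    Finset.card_image_of_injective _ fun x y h => fr_inj.1 h
  set e := (A.image (fr b)).orderEmbOfFin hcard with he
  have hN : 0 < A.card := by omega
  have hmem : ∀ i, ∃ x ∈ A, fr b x = e i := fun i =>
    Finset.mem_image.1 (Finset.orderEmbOfFin_mem _ hcard i)
  choose q hqA hq using hmem
  have hsurj : ∀ x ∈ A, ∃ i, q i = x := by
    intro x hx
    have h1 : fr b x ∈ range e := by
      rw [he, Finset.range_orderEmbOfFin]
      exact Finset.mem_coe.2 (Finset.mem_image_of_mem _ hx)
    obtain ⟨i, hi⟩ := h1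
    exact ⟨i, fr_inj.1 ((hq i).trans hi)⟩
  have hq0 : q ⟨0, hN⟩ = b := by
    obtain ⟨i, hi⟩ := hsurj b hb
    have h1 : e ⟨0, hN⟩ ≤ e i := e.monotone (Fin.mk_le_of_le_val (Nat.zero_le _))
    rw [← hq, ← hq, hi, fr_self] at h1
    exact fr_eq_zero.1 (le_antisymm h1 (fr_nonneg _ _))
  have hp0 : q ⟨0 % A.card, Nat.mod_lt _ hN⟩ = b := by
    rw [← hq0]; congr 1
  refine ⟨fun i => q ⟨i % A.card, Nat.mod_lt _ hN⟩, ⟨hP, ?_, fun i => ?_, fun i j hij hj => ?_⟩, hp0⟩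
  · ext x
    constructor
    · rintro ⟨i, rfl⟩; exact hqA _
    · intro hx
      obtain ⟨i, hi⟩ := hsurj x hx
      exact ⟨i, by simpa [Nat.mod_eq_of_lt i.2] using hi⟩
  · exact congrArg q (Fin.ext (Nat.mod_mod _ _))
  · rw [hp0, hq, hq]
    apply e.strictMono
    rw [Fin.mk_lt_mk, Nat.mod_eq_of_lt hj, Nat.mod_eq_of_lt (hij.trans hj)]
    exact hij

namespace CyclicEnum

variable {P : Set Circ} {N : ℕ} {p : ℕ → Circ} (h : CyclicEnum P N p)
include h

lemma pos : 0 < N := by have := h.two_le; omega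

lemma mem (i : ℕ) : p i ∈ P := h.range_eq ▸ mem_range_self i

lemma exists_lt {x : Circ} (hx : x ∈ P) : ∃ i < N, p i = x := by
  rw [← h.range_eq] at hx
  obtain ⟨i, rfl⟩ := hx
  exact ⟨i % N, Nat.mod_lt _ h.pos, h.mod i⟩

lemma eq_of_modEq {i j : ℕ} (hij : i ≡ j [MOD N]) : p i = p j := by
  rw [← h.mod i, ← h.mod j]; exact congrArg p hij

lemma eq_iff {i j : ℕ} : p i = p j ↔ i ≡ j [MOD N] := by
  refine ⟨fun hij => ?_, h.eq_of_modEq⟩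
  rw [← h.mod i, ← h.mod j] at hij
  have hi := Nat.mod_lt i h.pos
  have hj := Nat.mod_lt j h.pos
  rcases lt_trichotomy (i % N) (j % N) with h1 | h1 | h1
  · have := h.fr_lt _ _ h1 hj; rw [hij] at this; exact absurd this (lt_irrefl _)
  · exact h1
  · have := h.fr_lt _ _ h1 hi; rw [hij] at this; exact absurd this (lt_irrefl _)

lemma fr_lt_iff {i j : ℕ} (hi : i < N) (hj : j < N) :
    fr (p 0) (p i) < fr (p 0) (p j) ↔ i < j := by
  refine ⟨fun h1 => ?_, fun h1 => h.fr_lt _ _ h1 hj⟩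
  by_contra h2
  rcases (not_lt.1 h2).lt_or_eq with h3 | rfl
  · exact lt_asymm h1 (h.fr_lt _ _ h3 hi)
  · exact lt_irrefl _ h1

lemma fr_le_iff {i j : ℕ} (hi : i < N) (hj : j < N) :
    fr (p 0) (p i) ≤ fr (p 0) (p j) ↔ i ≤ j := by
  rw [← not_lt, h.fr_lt_iff hj hi, not_lt]

lemma add_self (i : ℕ) : p (i + N) = p i := h.eq_of_modEq (Nat.add_modEq_right)

lemma consecutive (i : ℕ) : Consecutive P (p i) (p (i + 1)) := by
  have h2 := h.two_le
  have hne : p i ≠ p (i + 1) := by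
    rw [Ne, h.eq_iff]
    intro h1
    have : (i + 1) ≡ i + 0 [MOD N] := h1.symm
    have := Nat.ModEq.add_left_cancel' i this
    rw [Nat.ModEq, Nat.mod_eq_of_lt (by omega), Nat.zero_mod] at this
    omega
  refine ⟨h.mem _, h.mem _, hne, fun z hz => ?_⟩
  obtain ⟨j, hj, rfl⟩ := h.exists_lt hz
  have hi := Nat.mod_lt i h.pos
  rw [← h.mod i, ← h.mod (i + 1), ← Nat.mod_add_mod]
  rw [sbtw_iff_cyc (p 0), cyc]
  rcases (show i % N + 1 < N ∨ i % N + 1 = N by omega) with h1 | h1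
  · rw [Nat.mod_eq_of_lt h1, h.fr_lt_iff hi hj, h.fr_lt_iff hj h1, h.fr_lt_iff h1 hi]
    omega
  · rw [h1, Nat.mod_self, h.fr_lt_iff hi hj, h.fr_lt_iff hj h.pos, h.fr_lt_iff h.pos hi]
    omega

lemma eq_of_consecutive {x y : Circ} (hxy : Consecutive P x y) :
    ∃ i < N, x = p i ∧ y = p (i + 1) := by
  obtain ⟨i, hi, rfl⟩ := h.exists_lt hxy.1
  exact ⟨i, hi, rfl, hxy.right_unique (h.consecutive i)⟩

lemma mem_sides_iff {e : Chord} : e ∈ sides P ↔ ∃ i < N, e = s(p i, p (i + 1)) := by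
  constructor
  · rintro ⟨x, y, hxy, rfl⟩
    obtain ⟨i, hi, rfl, rfl⟩ := h.eq_of_consecutive hxy
    exact ⟨i, hi, rfl⟩
  · rintro ⟨i, hi, rfl⟩
    exact ⟨_, _, h.consecutive i, rfl⟩

/-- A map preserving consecutivity is a rotation. -/
lemma rotation {f : Circ → Circ} {s : ℕ} (hf : ∀ x y, Consecutive P x y → Consecutive P (f x) (f y))
    (h0 : f (p 0) = p s) (i : ℕ) : f (p i) = p (i + s) := by
  induction i with
  | zero => rw [h0, zero_add]
  | succ i ih =>
    have h1 := hf _ _ (h.consecutive i)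
    rw [ih] at h1
    rw [h1.right_unique (h.consecutive (i + s))]
    congr 1; omega

omit h in
lemma iterate_rotation {f : Circ → Circ} {s : ℕ} (hf : ∀ i, f (p i) = p (i + s)) (m i : ℕ) :
    f^[m] (p i) = p (i + m * s) := by
  induction m with
  | zero => simp
  | succ m ih =>
    rw [iterate_succ_apply', ih, hf]
    congr 1; ring

/-- A diagonal crosses the diagonal that joins the next vertices. -/
lemma crosses_succ {i j : ℕ} (hij : i + 1 < j) (hj : j < N) (hN : ¬ (i = 0 ∧ j + 1 = N)) :
    Crosses s(p i, p j) s(p (i + 1), p (j + 1)) := by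
  rw [crosses_iff_coord (p 0), RCross]
  have h1 := h.fr_lt i j (by omega) hj
  have h2 := h.fr_lt i (i + 1) (by omega) (by omega)
  have h3 := h.fr_lt (i + 1) j hij hj
  rw [min_eq_left h1.le, max_eq_right h1.le]
  refine Or.inl ⟨h2, h3, ?_⟩
  rcases (show j + 1 < N ∨ j + 1 = N by omega) with h4 | h4
  · exact Or.inr (h.fr_lt j (j + 1) (by omega) h4)
  · left
    have : p (j + 1) = p 0 := by rw [h4, ← zero_add N, h.add_self]
    rw [this]
    exact h.fr_lt 0 i (by omega) (by omega)

end CyclicEnum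

/-- A vertex between the images of `x` and `y` would come from a vertex beyond `y`, whose image is
beyond the image of `y` by preservation of order. -/
lemma PreservesOrder.consecutive {d : ℕ} {P : Set Circ} (hσ : sigma d '' P = P)
    (hinj : InjOn (sigma d) P) (ho : PreservesOrder d P) {x y : Circ} (h : Consecutive P x y) :
    Consecutive P (sigma d x) (sigma d y) := by
  obtain ⟨hx, hy, hne, hb⟩ := h
  refine ⟨hσ ▸ mem_image_of_mem _ hx, hσ ▸ mem_image_of_mem _ hy, fun h1 => hne (hinj hx hy h1),
    fun w hw hs => ?_⟩
  rw [← hσ] at hw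
  obtain ⟨z, hz, rfl⟩ := hw
  have hs' := sbtw_iff_fr.1 hs
  rcases lt_trichotomy (fr x z) (fr x y) with h1 | h1 | h1
  · by_cases hzx : z = x
    · rw [hzx, fr_self] at hs'; exact lt_irrefl _ hs'.1
    · exact hb z hz (sbtw_iff_fr.2 ⟨fr_pos.2 hzx, h1⟩)
  · rw [fr_inj] at h1; rw [h1] at hs'; exact lt_irrefl _ hs'.2
  · have := sbtw_iff_fr.1 (ho x hx y hy z hz (sbtw_iff_fr.2 ⟨fr_pos.2 hne.symm, h1⟩))
    exact lt_asymm this.2 hs'.2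

/-! ### Rotational polygons with `k (d - 1)` vertices of period `k` -/

/-- The vertices of a rotational `k (d - 1)`-gon in circular order, starting from the end of the
chain `v`. -/
structure RotFrame (d k t : ℕ) (P : Set Circ) (v p : ℕ → Circ) : Prop where
  two_le : 2 ≤ d
  two_le_period : 2 ≤ k
  enum : CyclicEnum P (k * (d - 1)) p
  rot : ∀ i, sigma d (p i) = p (i + t * (d - 1))
  v_eq : ∀ i < d, v i = p ((k - 1) * (d - 1) + i)
  unit : ∃ t', t * t' ≡ 1 [MOD k]

/-- `σ_d` permutes the vertices in circular order, so it shifts their numbers by some `s`. Exact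
period `k` says that `k * (d - 1)` divides `m * s` precisely for the multiples `m` of `k`. Hence `s
= t * (d - 1)` with `t` invertible modulo `k`. -/
lemma exists_rotFrame {d k : ℕ} (hd : 2 ≤ d) {P : Set Circ} {v : ℕ → Circ}
    (hP : IsRotational d P) (hk : ∀ x ∈ P, minimalPeriod (sigma d) x = k)
    (hcard : P.ncard = k * (d - 1))
    (hv : ∀ i < d - 1, Consecutive P (v i) (v (i + 1))) :
    ∃ t p, RotFrame d k t P v p ∧ p 0 = v (d - 1) := by
  obtain ⟨h2, hσ, ho, hne⟩ := hP
  have hb : v (d - 1) ∈ P := by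
    have := (hv (d - 2) (by omega)).2.1
    rwa [show d - 2 + 1 = d - 1 by omega] at this
  obtain ⟨p, hp, hp0⟩ := exists_cyclicEnum h2 hb
  rw [hcard] at hp h2
  have hk0 : k ≠ 0 := by rintro rfl; simp at h2
  have hk1 : k ≠ 1 := by
    intro h1
    have := hk _ hb
    rw [h1, minimalPeriod_eq_one_iff_isFixedPt] at this
    exact hne _ hb this
  have hper : ∀ x ∈ P, x ∈ periodicPts (sigma d) := fun x hx =>
    minimalPeriod_pos_iff_mem_periodicPts.1 (by rw [hk x hx]; omega)
  have hinj : InjOn (sigma d) P := fun x hx y hy h => eq_of_periodic (hper x hx) (hper y hy) h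
  have hcons : ∀ x y, Consecutive P x y → Consecutive P (sigma d x) (sigma d y) :=
    fun x y h => ho.consecutive hσ hinj h
  obtain ⟨s, -, hs⟩ := hp.exists_lt (x := sigma d (p 0)) (by
    rw [← hσ]; exact mem_image_of_mem _ (hp.mem 0))
  have hrot := hp.rotation hcons hs.symm
  have hit := CyclicEnum.iterate_rotation hrot
  have hdvd : ∀ m, k ∣ m ↔ k * (d - 1) ∣ m * s := by
    intro m
    rw [← hk _ (hp.mem 0), ← isPeriodicPt_iff_minimalPeriod_dvd, IsPeriodicPt, IsFixedPt, hit,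
      hp.eq_iff, zero_add, hk _ (hp.mem 0), Nat.modEq_zero_iff_dvd]
  obtain ⟨t, ht⟩ : d - 1 ∣ s := by
    have := (hdvd k).1 dvd_rfl
    exact Nat.dvd_of_mul_dvd_mul_left (by omega) this
  have ht' : s = t * (d - 1) := by rw [ht, mul_comm]
  have hdvd' : ∀ m, k ∣ m ↔ k ∣ m * t := by
    intro m
    rw [hdvd m, ht', ← mul_assoc, Nat.mul_dvd_mul_iff_right (by omega)]
  have hcop : Nat.Coprime k t := by
    have h1 := Nat.gcd_pos_of_pos_left t (by omega : 0 < k)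
    -- Dividing `k` by a common factor with `t` would already give a period.
    have h3 : k ∣ k / k.gcd t := by
      rw [hdvd']
      obtain ⟨a, ha⟩ := Nat.gcd_dvd_left k t
      obtain ⟨c, hc⟩ := Nat.gcd_dvd_right k t
      have h4 : k / k.gcd t = a := Nat.div_eq_of_eq_mul_right h1 ha
      rw [h4]
      exact ⟨c, by rw [hc]; conv_rhs => rw [ha]
                   ring⟩
    have h4 := Nat.le_of_dvd (Nat.div_pos (Nat.le_of_dvd (by omega) (Nat.gcd_dvd_left k t)) h1) h3
    by_contra h5
    have : k / k.gcd t < k := Nat.div_lt_self (by omega) (by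
      have : k.gcd t ≠ 1 := h5
      omega)
    omega
  refine ⟨t, p, ⟨hd, by omega, hp, fun i => by rw [hrot, ht'], ?_, ?_⟩, hp0⟩
  -- The chain is read backwards, since its last vertex is numbered `0`.
  · have key : ∀ j, j < d → v (d - 1 - j) = p (k * (d - 1) - j) := by
      intro j
      induction j with
      | zero =>
        intro _
        rw [Nat.sub_zero, Nat.sub_zero, ← hp0, ← zero_add (k * (d - 1)), hp.add_self]
      | succ j ih =>
        intro hj
        have h3 := hv (d - 1 - (j + 1)) (by omega)
        rw [show d - 1 - (j + 1) + 1 = d - 1 - j by omega, ih (by omega)] at h3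
        have h5 : d - 1 ≤ k * (d - 1) := Nat.le_mul_of_pos_left _ (by omega)
        have h4 := hp.consecutive (k * (d - 1) - (j + 1))
        rw [show k * (d - 1) - (j + 1) + 1 = k * (d - 1) - j by omega] at h4
        exact h3.left_unique h4
    intro i hi
    have h1 := key (d - 1 - i) (by omega)
    have h5 : d - 1 ≤ k * (d - 1) := Nat.le_mul_of_pos_left _ (by omega)
    rw [show d - 1 - (d - 1 - i) = i by omega] at h1
    rw [h1, Nat.sub_one_mul]
    congr 1; omega
  · obtain ⟨m, -, hm⟩ := Nat.exists_mul_mod_eq_one_of_coprime hcop.symm (by omega)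
    exact ⟨m, by rw [Nat.ModEq, hm, Nat.mod_eq_of_lt (by omega)]⟩

namespace RotFrame

variable {d k t : ℕ} {P : Set Circ} {v p : ℕ → Circ} (h : RotFrame d k t P v p)
include h

lemma k_pos : 0 < k := by have := h.two_le_period; omega

lemma iterate_p (m i : ℕ) : (sigma d)^[m] (p i) = p (i + m * (t * (d - 1))) :=
  CyclicEnum.iterate_rotation h.rot m i

lemma iterate_q (m j : ℕ) :
    (sigma d)^[m] (p (j * (d - 1))) = p ((j + m * t) * (d - 1)) := by
  rw [h.iterate_p]; congr 1; ring

/-- The polygon spanned by the orbit of an end of the chain. -/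
lemma subEnum : CyclicEnum (range fun j => p (j * (d - 1))) k (fun j => p (j * (d - 1))) where
  two_le := h.two_le_period
  range_eq := rfl
  mod j := by
    apply h.enum.eq_of_modEq
    rw [Nat.ModEq, Nat.mul_mod_mul_right, Nat.mul_mod_mul_right, Nat.mod_mod]
  fr_lt i j hij hj := by
    have hd : 0 < d - 1 := by have := h.two_le; omega
    simp only [zero_mul]
    exact h.enum.fr_lt _ _ (Nat.mul_lt_mul_of_pos_right hij hd) (Nat.mul_lt_mul_of_pos_right hj hd)

lemma v_zero : v 0 = p ((k - 1) * (d - 1)) := by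
  rw [h.v_eq 0 (by have := h.two_le; omega), add_zero]

lemma k_mul : (k - 1) * (d - 1) + (d - 1) = k * (d - 1) := by
  rw [← Nat.succ_mul]; congr 1; have := h.k_pos; omega

lemma v_last : v (d - 1) = p 0 := by
  rw [h.v_eq _ (by have := h.two_le; omega), h.k_mul, ← zero_add (k * (d - 1)), h.enum.add_self]

lemma iterate_v_zero (m : ℕ) : (sigma d)^[m] (v 0) = p ((k - 1 + m * t) * (d - 1)) := by
  rw [h.v_zero, h.iterate_q]

lemma iterate_p_zero (m : ℕ) : (sigma d)^[m] (p 0) = p ((k - 1 + m * t + 1) * (d - 1)) := by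
  have := h.iterate_q m 0
  rw [zero_mul] at this
  rw [this]
  apply h.enum.eq_of_modEq
  have : (k - 1 + m * t + 1) * (d - 1) = (0 + m * t) * (d - 1) + k * (d - 1) := by
    rw [← add_mul]; congr 1; have := h.k_pos; omega
  rw [this]
  exact Nat.add_modEq_right.symm

lemma chordIter_M (m : ℕ) : chordIter d m s(v 0, p 0) =
    s(p ((k - 1 + m * t) * (d - 1)), p ((k - 1 + m * t + 1) * (d - 1))) := by
  rw [chordIter_mk, h.iterate_v_zero, h.iterate_p_zero]

lemma iterate_k (i : ℕ) : (sigma d)^[k] (p i) = p i := by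
  rw [h.iterate_p]
  apply h.enum.eq_of_modEq
  have : i + k * (t * (d - 1)) = i + k * (d - 1) * t := by ring
  rw [this]
  exact (Nat.modEq_zero_iff_dvd.2 ⟨t, rfl⟩).add_left i

/-- The last point of the orbit of `p 0` in circular order is `v 0`; the chain behind it contains no
further ones. -/
lemma fr_q_le (j : ℕ) : fr (p 0) (p (j * (d - 1))) ≤ fr (p 0) (v 0) := by
  have hd : 0 < d - 1 := by have := h.two_le; omega
  have h1 := Nat.mod_lt j h.k_pos
  rw [h.v_zero, ← h.subEnum.mod j]
  have := h.k_pos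
  exact (h.enum.fr_le_iff (Nat.mul_lt_mul_of_pos_right h1 hd)
    (Nat.mul_lt_mul_of_pos_right (by omega) hd)).2 (Nat.mul_le_mul_right _ (by omega))

lemma noncrossing_orbit (i j : ℕ) :
    ¬ Crosses (chordIter d i s(v 0, p 0)) (chordIter d j s(v 0, p 0)) := by
  rw [h.chordIter_M, h.chordIter_M]
  exact (h.subEnum.consecutive (k - 1 + i * t)).not_crosses (mem_range_self _) (mem_range_self _)

/-- Each leaf of the polygon spanned by the orbit of an end of the chain is in the orbit of one. -/
lemma mem_orbit (j : ℕ) :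
    ∃ m, s(p (j * (d - 1)), p ((j + 1) * (d - 1))) = chordIter d m s(v 0, p 0) := by
  obtain ⟨t', ht'⟩ := h.unit
  refine ⟨t' * (j + 1), ?_⟩
  rw [h.chordIter_M]
  have hk := h.k_pos
  have h1 : k - 1 + t' * (j + 1) * t ≡ j [MOD k] := by
    have h2 : t * t' * (j + 1) ≡ 1 * (j + 1) [MOD k] := ht'.mul_right _
    have h3 : k - 1 + t * t' * (j + 1) ≡ k - 1 + 1 * (j + 1) [MOD k] := h2.add_left _
    have h4 : k - 1 + 1 * (j + 1) = j + k := by omega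
    rw [h4] at h3
    have h5 : k - 1 + t' * (j + 1) * t = k - 1 + t * t' * (j + 1) := by ring
    rw [h5]
    exact h3.trans Nat.add_modEq_right
  have e1 := h.subEnum.eq_of_modEq h1
  have e2 := h.subEnum.eq_of_modEq (h1.add_right 1)
  rw [e1, e2]

/-- The leaf that closes the chain is no side, nor are its images. -/
lemma not_isSide (hd : 3 ≤ d) (m : ℕ) : chordIter d m s(v 0, p 0) ∉ sides P := by
  rw [h.chordIter_M, h.enum.mem_sides_iff]
  rintro ⟨i, -, hi⟩
  generalize k - 1 + m * t = j at hi
  have h2 : 2 * (d - 1) ≤ k * (d - 1) := Nat.mul_le_mul_right _ h.two_le_period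
  rw [add_mul, one_mul] at hi
  rcases Sym2.eq_iff.1 hi with ⟨h3, h4⟩ | ⟨h3, h4⟩
  · rw [h.enum.eq_iff] at h3 h4
    have h5 : i + (d - 1) ≡ i + 1 [MOD k * (d - 1)] := (h3.symm.add_right _).trans h4
    have h6 := Nat.ModEq.add_left_cancel' i h5
    rw [Nat.ModEq, Nat.mod_eq_of_lt (by omega), Nat.mod_eq_of_lt (by omega)] at h6
    omega
  · rw [h.enum.eq_iff] at h3 h4
    have h5 : i + (1 + (d - 1)) ≡ i + 0 [MOD k * (d - 1)] := by
      rw [← add_assoc]; exact (h3.symm.add_right _).trans h4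
    have h6 := Nat.ModEq.add_left_cancel' i h5
    rw [Nat.ModEq, Nat.mod_eq_of_lt (by omega), Nat.zero_mod] at h6
    omega

lemma periodic {x : Circ} (hx : x ∈ P) : x ∈ periodicPts (sigma d) := by
  obtain ⟨i, -, rfl⟩ := h.enum.exists_lt hx
  exact ⟨k, h.k_pos, h.iterate_k i⟩

lemma iterate_mem {x : Circ} (hx : x ∈ P) (m : ℕ) : (sigma d)^[m] x ∈ P := by
  obtain ⟨i, -, rfl⟩ := h.enum.exists_lt hx
  rw [h.iterate_p]; exact h.enum.mem _

lemma chordIter_side {e : Chord} (he : e ∈ sides P) (m : ℕ) : chordIter d m e ∈ sides P := by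
  obtain ⟨i, -, rfl⟩ := h.enum.mem_sides_iff.1 he
  rw [chordIter_mk, h.iterate_p, h.iterate_p]
  rw [show i + 1 + m * (t * (d - 1)) = i + m * (t * (d - 1)) + 1 by ring]
  exact ⟨_, _, h.enum.consecutive (i + m * (t * (d - 1))), rfl⟩

/-- Each vertex moves under iteration to each vertex in its residue class. -/
lemma exists_iterate (i r : ℕ) (hr : r ≡ i [MOD d - 1]) (hr' : r ≤ d - 1) :
    ∃ m, i + m * (t * (d - 1)) ≡ (k - 1) * (d - 1) + r [MOD k * (d - 1)] := by
  obtain ⟨t', ht'⟩ := h.unit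
  have hd := h.two_le
  have hk := h.two_le_period
  have hle : r ≤ i + (d - 1) := by omega
  obtain ⟨c, hc⟩ : ∃ c, i + (d - 1) = r + c * (d - 1) := by
    have : r ≡ i + (d - 1) [MOD d - 1] := hr.trans Nat.add_modEq_right.symm
    obtain ⟨c, hc⟩ := (Nat.modEq_iff_dvd' hle).1 this
    exact ⟨c, by rw [mul_comm]; omega⟩
  obtain ⟨e, he⟩ : ∃ e, c + e ≡ 0 [MOD k] := ⟨(k - 1) * c, by
    have : c + (k - 1) * c = k * c := by
      rw [Nat.sub_one_mul]; have : c ≤ k * c := Nat.le_mul_of_pos_left _ (by omega)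
      omega
    rw [this]; exact Nat.modEq_zero_iff_dvd.2 ⟨c, rfl⟩⟩
  refine ⟨t' * e, ?_⟩
  have h1 : (c + t * t' * e) * (d - 1) ≡ 0 [MOD k * (d - 1)] := by
    have h2 : c + t * t' * e ≡ c + 1 * e [MOD k] := (ht'.mul_right e).add_left c
    rw [one_mul] at h2
    obtain ⟨z, hz⟩ := Nat.modEq_zero_iff_dvd.1 (h2.trans he)
    exact Nat.modEq_zero_iff_dvd.2 ⟨z, by rw [hz]; ring⟩
  have h3 : i + t' * e * (t * (d - 1)) + (d - 1) ≡
      (k - 1) * (d - 1) + r + (d - 1) [MOD k * (d - 1)] := by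
    have e1 : i + t' * e * (t * (d - 1)) + (d - 1) = r + (c + t * t' * e) * (d - 1) := by
      calc i + t' * e * (t * (d - 1)) + (d - 1) = (i + (d - 1)) + t * t' * e * (d - 1) := by ring
        _ = _ := by rw [hc]; ring
    have e2 : (k - 1) * (d - 1) + r + (d - 1) = r + k * (d - 1) := by
      rw [← h.k_mul]; ring
    rw [e1, e2]
    exact (h1.add_left r).trans Nat.add_modEq_right.symm
  exact h3.add_right_cancel'

end RotFrame

/-! ### Closedness and classes of pullbacks -/

section
variable {d : ℕ} {b : Circ}

lemma sbtw_br {j : ℕ} (hj : j < d) {x y z : Circ} :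
    sbtw (br d b j x) (br d b j y) (br d b j z) ↔ sbtw x y z := by
  have hd : (0 : ℝ) < d := by exact_mod_cast (by omega : 0 < d)
  rw [sbtw_iff_cyc b, sbtw_iff_cyc (sigma d b), fr_br hj, fr_br hj, fr_br hj, cyc, cyc]
  simp only [div_lt_div_iff_of_pos_right hd, add_lt_add_iff_left]

lemma finite_pullbackStage {τ : Fin d → Circ → Circ} {F : Set Chord} (hF : F.Finite) (n : ℕ) :
    (pullbackStage τ F n).Finite := by
  induction n with
  | zero => exact hF
  | succ n ih => exact ih.union (finite_iUnion fun i => ih.image _)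

/-- A set of chords only finitely many of which have length at least `ε`, for each `ε`, contains its
nondegenerate limits. -/
lemma chordClosure_subset_of_finite {E : Set Chord}
    (h : ∀ ε > 0, {e ∈ E | ε ≤ chordLength e}.Finite) : chordClosure E ⊆ E := by
  rintro e ⟨x, y, hne, rfl, hcl⟩
  have hpos : 0 < ‖x - y‖ := by rw [norm_pos_iff, sub_ne_zero]; exact hne
  have hfin := h (‖x - y‖ / 2) (by linarith)
  set T : Set (Circ × Circ) := {p | s(p.1, p.2) ∈ {e ∈ E | ‖x - y‖ / 2 ≤ chordLength e}} with hT
  have hTfin : T.Finite := by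
    have : T = ⋃ e ∈ {e ∈ E | ‖x - y‖ / 2 ≤ chordLength e}, {p : Circ × Circ | s(p.1, p.2) = e} := by
      ext p; simp [hT]
    rw [this]
    refine hfin.biUnion fun e _ => ?_
    induction e using Sym2.ind with | _ z w
    refine (({(z, w), (w, z)} : Set (Circ × Circ)).toFinite).subset fun p hp => ?_
    rcases Sym2.eq_iff.1 hp with ⟨h1, h2⟩ | ⟨h1, h2⟩
    · exact Or.inl (Prod.ext h1 h2)
    · exact Or.inr (Prod.ext h1 h2)
  have hopen : IsOpen {p : Circ × Circ | ‖x - y‖ / 2 < ‖p.1 - p.2‖} :=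
    isOpen_lt continuous_const (by fun_prop)
  have h1 : (x, y) ∈ closure ({p : Circ × Circ | ‖x - y‖ / 2 < ‖p.1 - p.2‖} ∩
      {p : Circ × Circ | s(p.1, p.2) ∈ E}) :=
    hopen.inter_closure ⟨show ‖x - y‖ / 2 < ‖x - y‖ by linarith, hcl⟩
  have h2 : (x, y) ∈ closure T :=
    closure_mono (show _ ∩ _ ⊆ T from fun p hp =>
      show _ ∈ E ∧ _ from ⟨hp.2, by rw [chordLength_mk]; exact hp.1.le⟩) h1
  rw [hTfin.isClosed.closure_eq] at h2
  exact h2.1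

end

lemma leafClass_mono {L L' : Set Chord} (h : L ⊆ L') (x : Circ) : leafClass L x ⊆ leafClass L' x :=
  fun _ hy => Relation.ReflTransGen.mono (fun _ _ hab => h hab) _ _ hy

lemma mem_leafClass_self (L : Set Chord) (x : Circ) : x ∈ leafClass L x := Relation.ReflTransGen.refl

lemma mem_leafClass_of_mem {L : Set Chord} {x y : Circ} (h : s(x, y) ∈ L) : y ∈ leafClass L x :=
  Relation.ReflTransGen.single h

namespace MACFrame

variable {d : ℕ} {a b : Circ} {β : ℝ} (h : MACFrame d a b β)
include h

lemma finite_orbit : (forwardOrbit d {s(a, b)}).Finite := by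
  obtain ⟨n, hn, ha, hb⟩ := h.periodic
  refine ((finite_Iio n).image fun k => chordIter d k s(a, b)).subset fun e he => ?_
  obtain ⟨k, rfl⟩ := mem_forwardOrbit_singleton.1 he
  refine ⟨k % n, Nat.mod_lt _ hn, ?_⟩
  simp only [chordIter_mk]
  rw [IsPeriodicPt.iterate_mod_apply ha, IsPeriodicPt.iterate_mod_apply hb]

/-- If the canonical branches contract all leaves but those in the orbit, then long leaves are
finitely many. -/
lemma chordClosure_subset (hc : ∀ x y, s(x, y) ∈ macPullback d a b →
      s(x, y) ∉ forwardOrbit d {s(a, b)} →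
      |fr (sigma d b) x - fr (sigma d b) y| ≤ |fr b x - fr b y|) :
    chordClosure (macPullback d a b) ⊆ macPullback d a b := by
  have hd := h.d_posR
  have hd2 : (2 : ℝ) ≤ d := by exact_mod_cast h.two_le
  -- A leaf absent from the first `n` stages has been divided by `d ≥ 2` at least `n` times, without
  -- growth from changing the base point in between.
  have key : ∀ n x y, s(x, y) ∈ macPullback d a b →
      s(x, y) ∉ pullbackStage (brF d b) (forwardOrbit d {s(a, b)}) n →
      |fr b x - fr b y| ≤ (1 / 2) ^ n := by
    intro n
    induction n with
    | zero =>
      intro x y _ _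
      rw [pow_zero, abs_le]
      have := fr_nonneg b x; have := fr_lt_one b x
      have := fr_nonneg b y; have := fr_lt_one b y
      constructor <;> linarith
    | succ n ih =>
      intro x y he hn
      have hi := h.idx_eq_of_mem he
      have hσ := h.forward_macPullback he
      have hσn : chordIter d 1 s(x, y) ∉ pullbackStage (brF d b) (forwardOrbit d {s(a, b)}) n := by
        intro h1
        obtain ⟨i, hi⟩ := h.macPullback_eq_map he
        exact hn (Or.inr (mem_iUnion.2 ⟨i, _, h1, hi⟩))
      have hσ0 : chordIter d 1 s(x, y) ∉ forwardOrbit d {s(a, b)} := by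
        intro h1
        apply hσn
        clear ih hn hσn
        induction n with
        | zero => exact h1
        | succ n ih => exact Or.inl ih
      have h1 := hc _ _ hσ hσ0
      have h2 := ih _ _ hσ hσn
      rw [fr_eq_idx h.d_pos x, fr_eq_idx h.d_pos y, hi, ← sub_div, add_sub_add_left_eq_sub,
        abs_div, abs_of_pos hd, div_le_iff₀ hd]
      have h3 : (0 : ℝ) ≤ (1 / 2) ^ n := by positivity
      rw [pow_succ]
      simp only [iterate_one] at h1 h2
      nlinarith
  refine chordClosure_subset_of_finite fun ε hε => ?_
  obtain ⟨n, hn⟩ := exists_pow_lt_of_lt_one hε (by norm_num : (1 / 2 : ℝ) < 1)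
  refine (finite_pullbackStage (τ := brF d b) h.finite_orbit n).subset fun e he => ?_
  induction e using Sym2.ind with | _ x y
  by_contra h1
  have h2 := key n x y he.1 h1
  have h3 := he.2
  rw [chordLength_mk, norm_sub_eq b] at h3
  linarith [min_le_left |fr b x - fr b y| (1 - |fr b x - fr b y|)]

/-- A leaf with a periodic end is in the orbit, so a concatenation of leaves starting in `Q` never
leaves it. -/
lemma leafClass_orbit_subset {Q : Set Circ}
    (hQ : ∀ e ∈ forwardOrbit d {s(a, b)}, ∀ x ∈ e, x ∈ Q) (hQp : Q ⊆ periodicPts (sigma d))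
    {x : Circ} (hx : x ∈ Q) : leafClass (macPullback d a b) x ⊆ Q := by
  intro y hy
  induction hy with
  | refl => exact hx
  | tail _ h2 ih =>
    exact hQ _ (h.mem_orbit_of_periodic h2 (Sym2.mem_mk_left _ _) (hQp ih)) _ (Sym2.mem_mk_right _ _)

lemma leafClass_idx {x z : Circ} (hz : z ∈ leafClass (macPullback d a b) x) :
    idx d b z = idx d b x ∧ sigma d z ∈ leafClass (macPullback d a b) (sigma d x) := by
  induction hz with
  | refl => exact ⟨rfl, mem_leafClass_self _ _⟩
  | tail _ h2 ih => exact ⟨(h.idx_eq_of_mem h2).symm.trans ih.1, ih.2.tail (h.forward_macPullback h2)⟩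

/-- `Q` contains the classes of the orbit leaves. The image of any class is contained in a class,
and one canonical branch undoes `σ_d` on it, preserving circular order; so finiteness and boundary
position go back along preimages. -/
lemma isSide_leafClass {Q : Set Circ} (hQfin : Q.Finite)
    (hQ : ∀ e ∈ forwardOrbit d {s(a, b)}, ∀ x ∈ e, x ∈ Q) (hQp : Q ⊆ periodicPts (sigma d))
    (hside : ∀ e ∈ forwardOrbit d {s(a, b)}, IsSide Q e) {x y : Circ}
    (he : s(x, y) ∈ macPullback d a b) :
    (leafClass (macPullback d a b) x).Finite ∧
      IsSide (leafClass (macPullback d a b) x) s(x, y) := by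
  obtain ⟨n, hn⟩ := exists_chordIter_mem (sigma_brF h.d_pos b) he
  induction n generalizing x y with
  | zero =>
    rw [chordIter_zero] at hn
    have hsub := h.leafClass_orbit_subset hQ hQp (hQ _ hn x (Sym2.mem_mk_left _ _))
    exact ⟨hQfin.subset hsub,
      (hside _ hn).mono hsub (mem_leafClass_self _ _) (mem_leafClass_of_mem he)⟩
  | succ n ih =>
    obtain ⟨h1, h2⟩ := ih (x := sigma d x) (y := sigma d y) (h.forward_macPullback he)
      (by rw [chordIter_succ] at hn; exact hn)
    have hbr : ∀ z ∈ leafClass (macPullback d a b) x, br d b (idx d b x) (sigma d z) = z := by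
      intro z hz
      rw [← (h.leafClass_idx hz).1, br_idx h.d_pos]
    refine ⟨Finite.of_finite_image (f := sigma d) (h1.subset ?_) ?_, ?_⟩
    · rintro _ ⟨z, hz, rfl⟩; exact (h.leafClass_idx hz).2
    · intro z hz w hw hzw
      rw [← hbr z hz, ← hbr w hw, hzw]
    · have hcons : ∀ p ∈ leafClass (macPullback d a b) x, ∀ q ∈ leafClass (macPullback d a b) x,
          Consecutive (leafClass (macPullback d a b) (sigma d x)) (sigma d p) (sigma d q) →
          Consecutive (leafClass (macPullback d a b) x) p q := by
        intro p hp q hq hc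
        refine ⟨hp, hq, fun h3 => hc.2.2.1 (congrArg _ h3), fun z hz hs => ?_⟩
        apply hc.sbtw_false (h.leafClass_idx hz).2
        rwa [← hbr p hp, ← hbr q hq, ← hbr z hz, sbtw_br (idx_lt h.d_pos x)] at hs
      obtain ⟨p, q, hc, hpq⟩ := h2
      have hx := mem_leafClass_self (macPullback d a b) x
      have hy := mem_leafClass_of_mem he
      rcases Sym2.eq_iff.1 hpq with ⟨rfl, rfl⟩ | ⟨rfl, rfl⟩
      · exact ⟨x, y, hcons _ hx _ hy hc, rfl⟩
      · exact ⟨y, x, hcons _ hy _ hx hc, Sym2.eq_swap⟩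

lemma finite_leafClass {Q : Set Circ} (hQfin : Q.Finite)
    (hQ : ∀ e ∈ forwardOrbit d {s(a, b)}, ∀ x ∈ e, x ∈ Q) (hQp : Q ⊆ periodicPts (sigma d))
    (hside : ∀ e ∈ forwardOrbit d {s(a, b)}, IsSide Q e) (x : Circ) :
    (leafClass (macPullback d a b) x).Finite := by
  by_cases hx : ∃ y, s(x, y) ∈ macPullback d a b
  · obtain ⟨y, hy⟩ := hx
    exact (h.isSide_leafClass hQfin hQ hQp hside hy).1
  · refine (finite_singleton x).subset fun z hz => ?_
    rcases Relation.ReflTransGen.cases_head hz with rfl | ⟨w, hw, -⟩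
    · rfl
    · exact absurd ⟨w, hw⟩ hx

end MACFrame

/-! ### The leaf closing the chain of a rotational polygon -/

section
variable {d k t : ℕ} {P : Set Circ} {v p : ℕ → Circ} {C : Set Chord} {u g : ℕ → ℝ}
variable (h : ChainFrame d v C (p 0) u g) (R : RotFrame d k t P v p)
include h R

namespace RotFrame

lemma d_mul_fr_q_le (j : ℕ) : d * fr (p 0) (p (j * (d - 1))) ≤ u 0 := by
  have h1 := R.fr_q_le j
  rwa [h.fr_v_zero, le_div_iff₀ h.d_posR, mul_comm] at h1

lemma idx_q (j : ℕ) : idx d (p 0) (p (j * (d - 1))) = 0 :=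
  Nat.floor_eq_zero.2 ((R.d_mul_fr_q_le h j).trans_lt (h.u_lt_one h.two_le))

/-- Every point of the orbit is the image of another one, which lies on the arc of length `u 0 / d`
from `p 0`; that arc is stretched by `d`. -/
lemma q_low (j : ℕ) : fr (sigma d (p 0)) (p (j * (d - 1))) ≤ u 0 := by
  obtain ⟨m, hm⟩ : ∃ m, k = m + 1 := ⟨k - 1, by have := R.k_pos; omega⟩
  have h1 := R.iterate_k (j * (d - 1))
  rw [hm, iterate_succ_apply', R.iterate_q] at h1
  rw [← h1]
  have h2 := h.mul_fr (p ((j + m * t) * (d - 1)))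
  rw [R.idx_q h, Nat.cast_zero, zero_add] at h2
  rw [← h2]
  exact R.d_mul_fr_q_le h _

/-- The whole orbit lies on the single arc from `p 0` to `v 0`, so no estimate of lengths is needed.
-/
lemma macFrame : MACFrame d (v 0) (p 0) (u 0) where
  two_le := R.two_le
  pos := h.pos
  lt_one := h.u_lt_one h.two_le
  eq_add := h.eq_add
  periodic := ⟨k, R.k_pos, by rw [R.v_zero]; exact R.iterate_k _, R.iterate_k 0⟩
  low m := by
    rw [R.iterate_v_zero, R.iterate_p_zero]
    exact ⟨R.q_low h _, R.q_low h _⟩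
  same m := by rw [R.iterate_v_zero, R.iterate_p_zero, R.idx_q h, R.idx_q h]
  noncrossing := R.noncrossing_orbit

omit h in
lemma forwardOrbit_sides : forwardOrbit d (sides P) = sides P := by
  refine Subset.antisymm ?_ fun e he => mem_forwardOrbit_self he
  rintro _ ⟨e, he, m, rfl⟩
  exact R.chordIter_side he m

/-- Sides outside the chain lie on the arc from `p 0` to `v 0`, inside the first arc of length
`1/d`. -/
lemma side_cases {x y : Circ} (hxy : s(x, y) ∈ sides P) :
    (∃ i, i + 1 < d ∧ s(x, y) = s(v i, v (i + 1))) ∨ idx d (p 0) x = idx d (p 0) y := by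
  obtain ⟨i, hi, hxy⟩ := R.enum.mem_sides_iff.1 hxy
  have hk := R.k_mul
  have hd := R.two_le
  by_cases h1 : (k - 1) * (d - 1) ≤ i
  · left
    refine ⟨i - (k - 1) * (d - 1), by omega, ?_⟩
    rw [hxy, R.v_eq _ (by omega), R.v_eq _ (by omega), ← add_assoc, Nat.add_sub_cancel' h1]
  · right
    have key : ∀ j, j ≤ (k - 1) * (d - 1) → idx d (p 0) (p j) = 0 := by
      intro j hj
      refine Nat.floor_eq_zero.2 (lt_of_le_of_lt ?_ (h.u_lt_one h.two_le))
      have h2 := (R.enum.fr_le_iff (i := j) (j := (k - 1) * (d - 1)) (by omega) (by omega)).2 hj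
      rw [← R.v_zero, h.fr_v_zero, le_div_iff₀ h.d_posR] at h2
      linarith
    rcases Sym2.eq_iff.1 hxy with ⟨rfl, rfl⟩ | ⟨rfl, rfl⟩ <;>
    rw [key _ (by omega), key _ (by omega)]

/-- The orbit of the leaf bounds the polygon spanned by the orbit of `p 0`, so any other leaf has
both ends behind one of its sides. Moving the base point from `p 0` to `σ_d (p 0)`, another vertex
of it, then leaves the distance of coordinates unchanged. -/
lemma chordClosure_subset :
    chordClosure (macPullback d (v 0) (p 0)) ⊆ macPullback d (v 0) (p 0) := by
  have hM := R.macFrame h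
  refine hM.chordClosure_subset fun x y he hno => ?_
  have hne : ∀ x y, s(x, y) ∈ macPullback d (v 0) (p 0) →
      s(x, y) ∉ forwardOrbit d {s(v 0, p 0)} → ∀ i, x ≠ p i := by
    rintro x y he hno i rfl
    exact hno (hM.mem_orbit_of_periodic he (Sym2.mem_mk_left _ _) (R.periodic (R.enum.mem i)))
  have key : ∀ x y, s(x, y) ∈ macPullback d (v 0) (p 0) →
      s(x, y) ∉ forwardOrbit d {s(v 0, p 0)} → ∀ j < k,
      ¬ (fr (p 0) x < fr (p 0) (p (j * (d - 1))) ∧ fr (p 0) (p (j * (d - 1))) < fr (p 0) y) := by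
    intro x y he hno j
    have hx := hne x y he hno
    have hy := hne y x (by rwa [Sym2.eq_swap]) (by rwa [Sym2.eq_swap (a := y)])
    induction j with
    | zero => rintro - ⟨h1, -⟩; rw [zero_mul, fr_self] at h1; linarith [fr_nonneg (p 0) x]
    | succ j ih =>
      rintro hj ⟨h1, h2⟩
      have h3 := ih (by omega)
      have h4 := R.subEnum.fr_lt j (j + 1) (by omega) hj
      simp only [zero_mul] at h4
      have h5 : fr (p 0) (p (j * (d - 1))) < fr (p 0) x := by
        rcases lt_trichotomy (fr (p 0) (p (j * (d - 1)))) (fr (p 0) x) with h6 | h6 | h6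
        · exact h6
        · exact absurd (fr_inj.1 h6).symm (hx _)
        · exact absurd ⟨h6, h4.trans h2⟩ h3
      obtain ⟨m, hm⟩ := R.mem_orbit j
      apply hM.noncrossing_macPullback _
        (subset_pullback (mem_forwardOrbit_singleton.2 ⟨m, hm⟩)) _ he
      rw [crosses_iff_coord (p 0), RCross, min_eq_left h4.le, max_eq_right h4.le]
      exact Or.inl ⟨h5, h1, Or.inr h2⟩
  -- The new base point is one of the points just shown not to separate the ends.
  obtain ⟨j, hj, hjs⟩ := R.subEnum.exists_lt (x := sigma d (p 0))
    ⟨t, by simpa using (R.rot 0).symm⟩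
  have hx := hne x y he hno
  have hy := hne y x (by rwa [Sym2.eq_swap]) (by rwa [Sym2.eq_swap (a := y)])
  have k1 := key x y he hno j hj
  have k2 := key y x (by rwa [Sym2.eq_swap]) (by rwa [Sym2.eq_swap (a := y)]) j hj
  rw [hjs] at k1 k2
  have hx' : fr (p 0) x ≠ fr (p 0) (sigma d (p 0)) := by
    rw [Ne, fr_inj, ← hjs]; exact hx _
  have hy' : fr (p 0) y ≠ fr (p 0) (sigma d (p 0)) := by
    rw [Ne, fr_inj, ← hjs]; exact hy _
  apply le_of_eq
  rcases fr_cases (p 0) (sigma d (p 0)) x with ⟨a1, a2⟩ | ⟨a1, a2⟩ <;>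
  rcases fr_cases (p 0) (sigma d (p 0)) y with ⟨b1, b2⟩ | ⟨b1, b2⟩
  · rw [a2, b2]; congr 1; ring
  · exact absurd ⟨b1, lt_of_le_of_ne a1 hx'.symm⟩ k2
  · exact absurd ⟨a1, lt_of_le_of_ne b1 hy'.symm⟩ k1
  · rw [a2, b2]; congr 1; ring

lemma isCanonicalMAC :
    IsCanonicalMAC d s(v 0, p 0) (chordClosure (macPullback d (v 0) (p 0))) := by
  have hM := R.macFrame h
  have hcl : chordClosure (macPullback d (v 0) (p 0)) = macPullback d (v 0) (p 0) :=
    Subset.antisymm (R.chordClosure_subset h) fun e he =>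
      mem_chordClosure_of_mem he (hM.branchInvariant.nondegenerate e he)
  have hside : ∀ e ∈ forwardOrbit d {s(v 0, p 0)}, IsSide (range fun j => p (j * (d - 1))) e := by
    intro e he
    obtain ⟨m, rfl⟩ := mem_forwardOrbit_singleton.1 he
    rw [R.chordIter_M]
    exact ⟨_, _, R.subEnum.consecutive _, rfl⟩
  have hQfin : (range fun j => p (j * (d - 1))).Finite := by
    refine ((finite_Iio k).image fun j => p (j * (d - 1))).subset fun x hx => ?_
    obtain ⟨j, hj, rfl⟩ := R.subEnum.exists_lt hx
    exact ⟨j, hj, rfl⟩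
  have hQ : ∀ e ∈ forwardOrbit d {s(v 0, p 0)}, ∀ x ∈ e, x ∈ range fun j => p (j * (d - 1)) := by
    intro e he x hx
    obtain ⟨m, rfl⟩ := mem_forwardOrbit_singleton.1 he
    rw [R.chordIter_M, Sym2.mem_iff] at hx
    rcases hx with rfl | rfl <;> exact mem_range_self (f := fun j => p (j * (d - 1))) _
  have hQp : (range fun j => p (j * (d - 1))) ⊆ periodicPts (sigma d) := by
    rintro _ ⟨j, rfl⟩; exact R.periodic (R.enum.mem _)
  refine hM.isCanonicalMAC ?_ ?_
  · rw [hcl]; exact hM.finite_leafClass hQfin hQ hQp hside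
  · rw [hcl]; exact fun x y he => (hM.isSide_leafClass hQfin hQ hQp hside he).2

end RotFrame

end

/-! ### Uniqueness of the MAC leaf in a rotational polygon -/

/-- A chord that crosses no side of an all critical `d`-gon is not longer than `1/d`. -/
lemma norm_sub_le_of_not_crosses {d : ℕ} (hd : 2 ≤ d) {c x y : Circ} (hxy : sigma d x ≠ sigma d y)
    (h : ∀ e ∈ sides (critGon d c), ¬ Crosses e s(x, y)) : ‖x - y‖ ≤ 1 / d := by
  have hd0 : 0 < d := by omega
  have hdr : (0 : ℝ) < d := by exact_mod_cast hd0
  have hd2 : (2 : ℝ) ≤ d := by exact_mod_cast hd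
  wlog hx : x ∉ critGon d c generalizing x y
  · have hy : y ∉ critGon d c := fun hy => hxy ((not_not.1 hx : sigma d x = sigma d c).trans hy.symm)
    rw [norm_sub_rev]
    exact this hxy.symm (fun e he => by rw [Sym2.eq_swap]; exact h e he) hy
  have hξ0 := fr_nonneg (sigma d c) (sigma d x)
  have hξ1 := fr_lt_one (sigma d c) (sigma d x)
  rcases mem_sector_critGon hd hx (x := y) h with h1 | h1
  · rw [chordLength_of_idx_eq hd h1.symm, div_le_div_iff_of_pos_right hdr, abs_le]
    have := fr_nonneg (sigma d c) (sigma d y)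
    have := fr_lt_one (sigma d c) (sigma d y)
    constructor <;> linarith
  · have h2 : y - x = (((1 - fr (sigma d c) (sigma d x)) / d : ℝ) : Circ) := by
      rw [h1]
      conv_lhs => rw [← br_idx (b := c) hd0 x, idx_br (idx_lt hd0 x), ← brPt_fr]
      rw [brPt, brPt, add_sub_add_left_eq_sub, ← AddCircle.coe_sub]
      congr 1; ring
    have h3 : |(1 - fr (sigma d c) (sigma d x)) / d| ≤ 1 / d := by
      rw [abs_div, abs_of_pos hdr, div_le_div_iff_of_pos_right hdr, abs_le]
      constructor <;> linarith
    have h4 : (1 : ℝ) / d ≤ 1 / 2 := one_div_le_one_div_of_le two_pos hd2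
    rw [norm_sub_rev, h2, norm_coe_of_le (h3.trans h4)]
    exact h3

section
variable {d k t : ℕ} {P : Set Circ} {v p : ℕ → Circ} {C : Set Chord} {u g : ℕ → ℝ}
variable (h : ChainFrame d v C (p 0) u g) (R : RotFrame d k t P v p)

namespace RotFrame

include R in
lemma consecutive_v {i : ℕ} (hi : i + 1 < d) : Consecutive P (v i) (v (i + 1)) := by
  rw [R.v_eq i (by omega), R.v_eq _ hi, ← add_assoc]
  exact R.enum.consecutive _

include R in
lemma v_mem {i : ℕ} (hi : i < d) : v i ∈ P := by
  rw [R.v_eq i hi]; exact R.enum.mem _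

include h R

/-- The inner vertices of the chain have distance more than `1/d` from all other vertices. -/
lemma lt_norm_sub {r : ℕ} (hr : 0 < r) (hrd : r + 1 < d) {x : Circ} (hx : x ∈ P) (hxv : x ≠ v r) :
    1 / d < ‖v r - x‖ := by
  have hd := h.d_posR
  obtain ⟨q, rfl⟩ : ∃ q, r = q + 1 := ⟨r - 1, by omega⟩
  have h1 := (R.consecutive_v (i := q) (by omega)).sbtw_false hx
  have h2 := (R.consecutive_v hrd).sbtw_false hx
  have hq := h.fr_v (i := q) (by omega)
  have hq1 := h.fr_v hrd
  have hu0 := h.u_pos (i := q) (by omega)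
  have hu1 := h.lt_succ q (by omega)
  have hu2 := h.u_lt_one hrd
  have hu3 := h.lt_succ _ hrd
  have hqd : (q : ℝ) + 1 + 2 ≤ d := by exact_mod_cast (by omega : q + 1 + 2 ≤ d)
  have hq0 : (0 : ℝ) ≤ q := Nat.cast_nonneg q
  push_cast at hq1
  rw [sbtw_iff_cyc (p 0)] at h1 h2
  have hX0 := fr_nonneg (p 0) x
  have hX1 := fr_lt_one (p 0) x
  have hdX0 : 0 ≤ d * fr (p 0) x := by positivity
  have hdX1 : d * fr (p 0) x < d := by nlinarith
  have hne : fr (p 0) x ≠ fr (p 0) (v (q + 1)) := by rwa [Ne, fr_inj]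
  have hlt : fr (p 0) (v q) < fr (p 0) (v (q + 1)) := by
    apply lt_of_mul_lt_mul_left _ hd.le; rw [hq, hq1]; linarith
  have key : 1 < d * |fr (p 0) (v (q + 1)) - fr (p 0) x| ∧
      d * |fr (p 0) (v (q + 1)) - fr (p 0) x| < d - 1 := by
    rcases lt_or_gt_of_ne hne with h3 | h3
    · have h4 : fr (p 0) x ≤ fr (p 0) (v q) := by
        by_contra h4; push Not at h4; exact h1 (Or.inl ⟨h4, h3⟩)
      have h5 := mul_le_mul_of_nonneg_left h4 hd.le
      rw [abs_of_pos (by linarith), mul_sub, hq1]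
      rw [hq] at h5
      constructor <;> linarith
    · have h4 : q + 1 + 1 + 1 < d := by
        by_contra h4
        have h5 : q + 1 + 1 = d - 1 := by omega
        rw [h5, h.v_last, fr_self] at h2
        refine h2 (Or.inr (Or.inr ⟨?_, h3⟩))
        exact pos_of_mul_pos_right (by rw [hq1]; linarith) hd.le
      have hq2 := h.fr_v h4
      push_cast at hq2
      have h5 : fr (p 0) (v (q + 1 + 1)) ≤ fr (p 0) x := by
        by_contra h5; push Not at h5; exact h2 (Or.inl ⟨h3, h5⟩)
      have h6 := mul_le_mul_of_nonneg_left h5 hd.le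
      rw [abs_of_neg (by linarith), neg_sub, mul_sub, hq1]
      rw [hq2] at h6
      constructor <;> linarith
  rw [norm_sub_eq (p 0), lt_min_iff]
  constructor
  · rw [div_lt_iff₀ hd]; linarith [key.1]
  · rw [div_lt_iff₀ hd]; linarith [key.2]

/-- The MAC leaf spanned by the vertices of the polygon is unique. -/
lemma eq_of_isMACLeaf {M : Chord} (hM : IsMACLeaf d M) (hP : IsChordOf P M) : M = s(v 0, p 0) := by
  have hd := h.d_posR
  have hF := R.macFrame h
  obtain ⟨x, hx, y, hy, hxy, rfl⟩ := hP
  obtain ⟨Q, hQ, hcrit, hcomp⟩ := hM.compatible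
  obtain ⟨c, hc⟩ : Q.Nonempty := by
    rw [nonempty_iff_ne_empty]; rintro rfl
    rw [ncard_empty] at hQ; have := h.two_le; omega
  rw [eq_critGon h.d_pos hQ hcrit hc] at hcomp
  have hper : ∀ x ∈ P, ∀ m, (sigma d)^[m] x ∈ periodicPts (sigma d) := fun x hx m =>
    iterate_mem_periodicPts (R.periodic hx) m
  have hne : ∀ m, (sigma d)^[m] x ≠ (sigma d)^[m] y := by
    intro m
    induction m with
    | zero => exact hxy
    | succ m ih =>
      rw [iterate_succ_apply', iterate_succ_apply']
      exact fun h1 => ih (eq_of_periodic (hper x hx m) (hper y hy m) h1)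
  have hlen : ∀ m, ‖(sigma d)^[m] x - (sigma d)^[m] y‖ ≤ 1 / d := by
    intro m
    refine norm_sub_le_of_not_crosses (c := c) h.two_le ?_ fun e he hcr => ?_
    · rw [← iterate_succ_apply' (sigma d), ← iterate_succ_apply' (sigma d)]; exact hne (m + 1)
    · exact hcomp _ (mem_forwardOrbit_singleton.2 ⟨m, rfl⟩) e he hcr.symm
  -- An end in another residue class modulo `d - 1` would be carried to an inner vertex of the
  -- chain, more than `1/d` away from every other vertex.
  have hdiv : ∀ x ∈ P, ∀ y ∈ P, (∀ m, (sigma d)^[m] x ≠ (sigma d)^[m] y) →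
      (∀ m, ‖(sigma d)^[m] x - (sigma d)^[m] y‖ ≤ 1 / d) → ∃ j < k, x = p (j * (d - 1)) := by
    intro x hx y hy hne hlen
    obtain ⟨i, hi, rfl⟩ := R.enum.exists_lt hx
    have hd1 : 0 < d - 1 := by have := h.two_le; omega
    have hi0 : i % (d - 1) = 0 := by
      by_contra hr
      have hrlt := Nat.mod_lt i hd1
      obtain ⟨m, hm⟩ := R.exists_iterate i (i % (d - 1)) (Nat.mod_modEq _ _) hrlt.le
      have h1 : (sigma d)^[m] (p i) = v (i % (d - 1)) := by
        rw [R.iterate_p, R.v_eq _ (by omega)]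
        exact R.enum.eq_of_modEq hm
      have h2 := R.lt_norm_sub h (r := i % (d - 1)) (by omega) (by omega) (R.iterate_mem hy m)
        (by rw [← h1]; exact (hne m).symm)
      rw [← h1] at h2
      linarith [hlen m]
    refine ⟨i / (d - 1), (Nat.div_lt_iff_lt_mul hd1).2 hi, ?_⟩
    rw [Nat.div_mul_cancel (Nat.dvd_of_mod_eq_zero hi0)]
  obtain ⟨i, hi, rfl⟩ := hdiv x hx y hy hne hlen
  obtain ⟨j, hj, rfl⟩ := hdiv y hy _ hx (fun m => (hne m).symm) fun m => by
    rw [norm_sub_rev]; exact hlen m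
  obtain ⟨t', ht'⟩ := R.unit
  -- In the polygon spanned by the orbit of `p 0`, a diagonal crosses its rotation by one vertex.
  -- That rotation is the iterate `t'`, where `t'` inverts `t` modulo `k`.
  have hadj : ∀ i j, i < k → j < k → i < j →
      (∀ m n, ¬ Crosses (chordIter d m s(p (i * (d - 1)), p (j * (d - 1))))
        (chordIter d n s(p (i * (d - 1)), p (j * (d - 1))))) →
      ∃ m, s(p (i * (d - 1)), p (j * (d - 1))) = chordIter d m s(v 0, p 0) := by
    intro i j hi hj hij hnc
    by_cases h1 : j = i + 1
    · subst h1; exact R.mem_orbit i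
    · by_cases h2 : i = 0 ∧ j + 1 = k
      · obtain ⟨rfl, h2⟩ := h2
        obtain ⟨m, hm⟩ := R.mem_orbit j
        refine ⟨m, ?_⟩
        rw [← hm, h2, Sym2.eq_swap, zero_mul, ← zero_add (k * (d - 1)), R.enum.add_self]
      · exfalso
        have h3 := R.subEnum.crosses_succ (i := i) (j := j) (by omega) hj h2
        apply hnc 0 t'
        rw [chordIter_zero, chordIter_mk, R.iterate_q, R.iterate_q]
        have e : ∀ i, p ((i + t' * t) * (d - 1)) = p ((i + 1) * (d - 1)) := fun i =>
          R.subEnum.eq_of_modEq (by rw [mul_comm t']; exact ht'.add_left i)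
        rw [e, e]
        exact h3
  have hM' : ∃ m, s(p (i * (d - 1)), p (j * (d - 1))) = chordIter d m s(v 0, p 0) := by
    rcases lt_trichotomy i j with hij | rfl | hij
    · exact hadj i j hi hj hij hM.noncrossing
    · exact absurd rfl hxy
    · rw [Sym2.eq_swap]
      refine hadj j i hj hi hij ?_
      rw [Sym2.eq_swap]; exact hM.noncrossing
  obtain ⟨m, hm⟩ := hM'
  have hback : chordIter d (m * (k - 1)) s(p (i * (d - 1)), p (j * (d - 1))) = s(v 0, p 0) := by
    rw [hm, ← chordIter_add, show m * (k - 1) + m = m * k by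
      rw [Nat.mul_sub_one]; have := R.k_pos; have : m ≤ m * k := Nat.le_mul_of_pos_right _ this
      omega]
    rw [chordIter_mk, R.v_zero, iterate_mul_of_fixed (R.iterate_k _),
      iterate_mul_of_fixed (R.iterate_k _)]
  have h1 := hM.major (m * (k - 1))
  have h2 := hF.critDist_orbit 0
  rw [chordIter_zero, hF.chordLength_M] at h2
  rw [hback, h2, hm, hF.critDist_orbit, ← hm, chordLength_mk, norm_sub_eq (p 0)] at h1
  -- Being closest to critical length, the leaf is at least as long as the closing one, yet its ends
  -- lie on an arc of exactly that length.
  have h3 : u 0 / d ≤ |fr (p 0) (p (i * (d - 1))) - fr (p 0) (p (j * (d - 1)))| := by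
    linarith [min_le_left |fr (p 0) (p (i * (d - 1))) - fr (p 0) (p (j * (d - 1)))|
      (1 - |fr (p 0) (p (i * (d - 1))) - fr (p 0) (p (j * (d - 1)))|)]
  have hi1 := R.fr_q_le i
  have hj1 := R.fr_q_le j
  have hi0 := fr_nonneg (p 0) (p (i * (d - 1)))
  have hj0 := fr_nonneg (p 0) (p (j * (d - 1)))
  rw [← h.fr_v_zero] at h3
  rcases le_abs.1 h3 with h4 | h4
  · rw [fr_inj.1 (by linarith : fr (p 0) (p (i * (d - 1))) = fr (p 0) (v 0)),
      fr_eq_zero.1 (by linarith : fr (p 0) (p (j * (d - 1))) = 0)]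
  · rw [fr_inj.1 (by linarith : fr (p 0) (p (j * (d - 1))) = fr (p 0) (v 0)),
      fr_eq_zero.1 (by linarith : fr (p 0) (p (i * (d - 1))) = 0), Sym2.eq_swap]

lemma not_crosses_side : ∀ e ∈ macPullback d (v 0) (p 0), ∀ s ∈ sides P, ¬ Crosses s e := by
  refine h.not_crosses_macPullback (R.macFrame h) (fun i hi => R.periodic (R.v_mem hi)) ?_ ?_ ?_
  · intro i hi
    exact R.chordIter_side ⟨_, _, R.consecutive_v hi, rfl⟩ 1
  · intro x y hxy
    exact (R.side_cases h hxy).imp_right fun h1 => ⟨h1, R.chordIter_side hxy 1⟩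
  · rintro e he _ ⟨x, y, hxy, rfl⟩
    obtain ⟨m, rfl⟩ := mem_forwardOrbit_singleton.1 he
    rw [R.chordIter_M]
    exact hxy.not_crosses (R.enum.mem _) (R.enum.mem _)

lemma pullback_eq {τ : Fin d → Circ → Circ} (hτ : IsPullbackScheme d (forwardOrbit d (sides P)) C τ) :
    pullback τ (forwardOrbit d {s(v 0, p 0)}) = macPullback d (v 0) (p 0) :=
  h.pullback_eq_macPullback (R.macFrame h) (fun _ hi => R.periodic (R.v_mem hi)) hτ
    (fun _ hi => mem_forwardOrbit_self ⟨_, _, R.consecutive_v hi, rfl⟩)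
    fun e he _ hi => R.not_crosses_side h e he _ (R.chordIter_side ⟨_, _, R.consecutive_v hi, rfl⟩ 1)

end RotFrame

end

/-- Return time one would fix the vertices; a larger one would make the polygon disjoint from its
image, which is itself. -/
lemma not_isIdentityReturn_of_isRotational {d : ℕ} {P : Set Circ} (hP : IsRotational d P) :
    ¬ IsIdentityReturn d P := by
  rintro ⟨h2, n, hn, hdis, hid, -⟩
  obtain ⟨x, hx⟩ : P.Nonempty := by
    rw [nonempty_iff_ne_empty]; rintro rfl
    rw [ncard_empty] at h2; omega
  rcases (show n = 1 ∨ 1 < n by omega) with rfl | h1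
  · exact hP.2.2.2 x hx (hid x hx)
  · have h3 := (hdis 0 1 one_pos h1).1
    rw [iterate_zero, image_id, iterate_one, hP.2.1] at h3
    exact disjoint_left.1 h3 hx hx

/-! ### Canonical SCM laminations -/

section
variable {d : ℕ} {P : Set Circ} {v : ℕ → Circ} {C : Set Chord} {τ : Fin d → Circ → Circ}
  {S : Set Chord}

lemma orbit_nondegenerate_of_periodic (hper : P ⊆ periodicPts (sigma d)) {x y : Circ} (hx : x ∈ P)
    (hy : y ∈ P) (hxy : x ≠ y) (m : ℕ) : (sigma d)^[m] x ≠ (sigma d)^[m] y := by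
  induction m with
  | zero => exact hxy
  | succ m ih =>
    rw [iterate_succ_apply', iterate_succ_apply']
    exact fun h => ih (eq_of_periodic (iterate_mem_periodicPts (hper hx) m)
      (iterate_mem_periodicPts (hper hy) m) h)

namespace IsCanonicalSCM

variable (hS : IsCanonicalSCM d P v C τ S) (hper : P ⊆ periodicPts (sigma d))
include hS

lemma noncrossing {e f : Chord} (he : e ∈ S) (hf : f ∈ S) : ¬ Crosses e f :=
  hS.isInvariantLamination.isLamination.noncrossing e he f hf

lemma not_crosses_portrait {e c : Chord} (hc : c ∈ C) (he : e ∈ S) : ¬ Crosses c e := by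
  rw [hS.isPullback] at he
  exact not_crosses_of_mem_chordClosure_pullback hS.isPullbackScheme hS.compatible hc he

lemma v_mem (hd : 2 ≤ d) {i : ℕ} (hi : i < d) : v i ∈ P := by
  rcases (show i < d - 1 ∨ i = d - 2 + 1 by omega) with h | rfl
  · exact (hS.isLongestChain.consecutive i h).1
  · exact (hS.isLongestChain.consecutive (d - 2) (by omega)).2.1

lemma chain_mem {i : ℕ} (hi : i + 1 < d) : s(v i, v (i + 1)) ∈ sides P :=
  ⟨_, _, hS.isLongestChain.consecutive i (by omega), rfl⟩

lemma chain_image_mem {i : ℕ} (hi : i + 1 < d) :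
    s(sigma d (v i), sigma d (v (i + 1))) ∈ forwardOrbit d (sides P) :=
  ⟨_, hS.chain_mem hi, 1, rfl⟩

include hper

lemma pullback_nondegenerate : ∀ e ∈ pullback τ (forwardOrbit d (sides P)), ¬ e.IsDiag := by
  refine fun e he => not_isDiag_of_mem_pullback hS.isPullbackScheme.right_inverse ?_ he
  rintro _ ⟨_, ⟨x, y, hxy, rfl⟩, m, rfl⟩
  rw [chordIter_mk, Sym2.mk_isDiag_iff]
  exact orbit_nondegenerate_of_periodic hper hxy.1 hxy.2.1 hxy.2.2.1 m

lemma pullback_subset : pullback τ (forwardOrbit d (sides P)) ⊆ S := by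
  intro e he
  rw [hS.isPullback]
  exact mem_chordClosure_of_mem he (hS.pullback_nondegenerate hper e he)

lemma orbit_subset : forwardOrbit d (sides P) ⊆ S :=
  subset_pullback.trans (hS.pullback_subset hper)

lemma exists_chainFrame (hd : 2 ≤ d) (hcard : d ≤ P.ncard) :
    ∃ u g, ChainFrame d v C (v (d - 1)) u g :=
  Lam.exists_chainFrame hd hS.isLongestChain.consecutive hS.isLongestChain.distinct hcard
    (fun i hi => orbit_nondegenerate_of_periodic hper (hS.v_mem hd (by omega))
      (hS.v_mem hd (by omega)) (hS.isLongestChain.consecutive i hi).2.2.1 1) hS.isGuiding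

end IsCanonicalSCM

/-! ### The leaf closing the chain of an identity return polygon -/

/-- The vertices of an identity return `d`-gon are those in the chain, and the polygons in the orbit
are disjoint. -/
structure ReturnFrame (d n : ℕ) (P : Set Circ) (v : ℕ → Circ) : Prop where
  pos : 0 < n
  fixed : ∀ x ∈ P, (sigma d)^[n] x = x
  eq_image : P = v '' Iio d
  ne : ∀ k, ¬ n ∣ k → ∀ x ∈ P, ∀ y ∈ P, (sigma d)^[k] x ≠ y

namespace ReturnFrame

variable {n : ℕ} (R : ReturnFrame d n P v)
include R

lemma periodic : P ⊆ periodicPts (sigma d) := fun _ hx => ⟨n, R.pos, R.fixed _ hx⟩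

lemma iterate_of_dvd {m : ℕ} (hm : n ∣ m) {x : Circ} (hx : x ∈ P) : (sigma d)^[m] x = x := by
  obtain ⟨c, rfl⟩ := hm
  rw [mul_comm]
  exact iterate_mul_of_fixed (R.fixed x hx) c

/-- The images of different sides are different. -/
lemma chordIter_ne {e f : Chord} (he : e ∈ sides P) (hf : f ∈ sides P) (hne : e ≠ f) (l m : ℕ) :
    chordIter d l e ≠ chordIter d m f := by
  intro h
  obtain ⟨x, y, hxy, rfl⟩ := he
  obtain ⟨z, w, hzw, rfl⟩ := hf
  obtain ⟨c, hc⟩ : ∃ c, n ∣ c + l := ⟨l * (n - 1), l, by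
    have := R.pos
    obtain ⟨n', rfl⟩ : ∃ n', n = n' + 1 := ⟨n - 1, by omega⟩
    rw [Nat.add_sub_cancel]; ring⟩
  have h1 := congrArg (chordIter d c) h
  rw [← chordIter_add, ← chordIter_add, chordIter_mk, chordIter_mk, R.iterate_of_dvd hc hxy.1,
    R.iterate_of_dvd hc hxy.2.1] at h1
  by_cases hm : n ∣ c + m
  · rw [R.iterate_of_dvd hm hzw.1, R.iterate_of_dvd hm hzw.2.1] at h1
    exact hne h1
  · rcases Sym2.eq_iff.1 h1 with ⟨h2, -⟩ | ⟨h2, -⟩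
    · exact R.ne _ hm _ hzw.1 _ hxy.1 h2.symm
    · exact R.ne _ hm _ hzw.2.1 _ hxy.1 h2.symm

end ReturnFrame

/-- The `d` vertices in the chain have different coordinates, so they exhaust the `d`-gon. -/
lemma exists_returnFrame {b : Circ} {u g : ℕ → ℝ} (h : ChainFrame d v C b u g)
    (hP : IsIdentityReturn d P) (hcard : P.ncard = d) (hv : ∀ i < d, v i ∈ P) :
    ∃ n, ReturnFrame d n P v := by
  obtain ⟨h2, n, hn, hdis, hid, -⟩ := hP
  refine ⟨n, hn, hid, ?_, ?_⟩
  · symm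
    have hfin : P.Finite := finite_of_ncard_pos (by omega)
    apply eq_of_subset_of_ncard_le
    · rintro _ ⟨i, hi, rfl⟩; exact hv i hi
    · have hinj : InjOn v (Iio d) := by
        have hne : ∀ i j, i < j → j < d → v i ≠ v j := by
          intro i j hij hj hv
          rcases (show j + 1 < d ∨ j = d - 1 by omega) with hj' | hj'
          · have h1 := h.fr_v hj'
            rw [← hv, h.fr_v (by omega)] at h1
            have := h.u_lt hij hj
            have : (i : ℝ) < j := by exact_mod_cast hij
            linarith
          · have h1 := h.fr_v (i := i) (by omega)
            rw [hv, hj', h.v_last, fr_self, mul_zero] at h1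
            have := h.u_pos (i := i) (by omega)
            have : (0 : ℝ) ≤ i := Nat.cast_nonneg i
            linarith
        intro i hi j hj hij
        rcases lt_trichotomy i j with h3 | h3 | h3
        · exact absurd hij (hne i j h3 hj)
        · exact h3
        · exact absurd hij.symm (hne j i h3 hi)
      rw [hinj.ncard_image, hcard, ← Finset.coe_Iio, ncard_coe_finset, Nat.card_Iio]
    · exact hfin
  · intro k hk x hx y hy hxy
    have h3 : 0 < k % n := Nat.pos_of_ne_zero fun h3 => hk (Nat.dvd_of_mod_eq_zero h3)
    have h4 := (hdis 0 (k % n) h3 (Nat.mod_lt _ hn)).1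
    have h5 : y ∈ (sigma d)^[0] '' P := by simpa using hy
    refine disjoint_left.1 h4 h5 ⟨x, hx, ?_⟩
    rw [IsPeriodicPt.iterate_mod_apply (hid x hx), hxy]

namespace ReturnFrame

variable {n : ℕ} {b : Circ} {u g : ℕ → ℝ} (R : ReturnFrame d n P v)
  (h : ChainFrame d v C b u g)
include R h

omit h in
lemma v_mem {i : ℕ} (hi : i < d) : v i ∈ P := by
  rw [R.eq_image]; exact mem_image_of_mem v hi

lemma b_mem : b ∈ P := by
  rw [← h.v_last]; exact R.v_mem (by have := h.d_pos; omega)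

lemma consecutive : Consecutive P b (v 0) := by
  have hd := h.d_posR
  have h0 : v 0 ≠ b := by
    apply ChainFrame.ne_of_fr_sigma_pos (d := d)
    rw [h.fr_sigma_v h.two_le]; exact h.pos
  refine ⟨R.b_mem h, R.v_mem h.d_pos, h0.symm, fun z hz hs => ?_⟩
  rw [R.eq_image] at hz
  obtain ⟨i, hi, rfl⟩ := hz
  obtain ⟨h1, h2⟩ := sbtw_iff_fr.1 hs
  rcases (show i + 1 < d ∨ i = d - 1 by have := mem_Iio.1 hi; omega) with h3 | h3
  · have h4 := mul_lt_mul_of_pos_left h2 hd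
    rw [h.fr_v h3, h.fr_v h.two_le] at h4
    have := h.u_le (Nat.zero_le i) hi
    have : (0 : ℝ) ≤ i := Nat.cast_nonneg i
    push_cast at h4
    linarith
  · rw [h3, h.v_last, fr_self] at h1
    exact lt_irrefl _ h1

lemma side_cases (hS : IsCanonicalSCM d P v C τ S) {e : Chord} (he : e ∈ sides P) :
    (∃ i, i + 1 < d ∧ e = s(v i, v (i + 1))) ∨ e = s(v 0, b) := by
  obtain ⟨x, y, hxy, rfl⟩ := he
  have hx := hxy.1
  rw [R.eq_image] at hx
  obtain ⟨i, hi, rfl⟩ := hx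
  rcases (show i + 1 < d ∨ i = d - 1 by have := mem_Iio.1 hi; omega) with h3 | rfl
  · left
    exact ⟨i, h3, by rw [hxy.right_unique (hS.isLongestChain.consecutive i (by omega))]⟩
  · right
    rw [h.v_last] at hxy ⊢
    rw [hxy.right_unique (R.consecutive h), Sym2.eq_swap]

lemma isSide : s(v 0, b) ∈ sides P := ⟨_, _, R.consecutive h, Sym2.eq_swap⟩

/-- The closing leaf is the strictly shortest side. -/
lemma chordLength_lt (hS : IsCanonicalSCM d P v C τ S) {e : Chord} (he : e ∈ sides P)
    (hne : e ≠ s(v 0, b)) : chordLength s(v 0, b) < chordLength e := by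
  have hd := h.d_posR
  have hu0 := h.pos
  have hu1 := h.u_lt_one h.two_le
  have hd3 : 3 ≤ d := by
    by_contra hd3
    have hd2 : d = 2 := by have := h.two_le; omega
    rcases R.side_cases h hS he with ⟨i, hi, rfl⟩ | rfl
    · apply hne
      have hi0 : i = 0 := by omega
      rw [hi0, ← h.v_last, hd2]
    · exact hne rfl
  have hd3' : (3 : ℝ) ≤ d := by exact_mod_cast hd3
  have h1 : chordLength s(v 0, b) ≤ u 0 / d := by
    rw [chordLength_mk, norm_sub_eq b, fr_self, sub_zero, h.fr_v_zero, abs_of_pos (by positivity)]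
    exact min_le_left _ _
  refine h1.trans_lt ?_
  rcases R.side_cases h hS he with ⟨i, hi, rfl⟩ | rfl
  · have hlt := h.lt_succ i hi
    have hle := h.u_le (Nat.zero_le i) (by omega)
    have hle1 := h.u_le_one hi
    have key : ∃ r : ℝ, v (i + 1) - v i = (r : Circ) ∧ d * r = 1 + (u (i + 1) - u i) := by
      refine ⟨(1 + (u (i + 1) - u i)) / d, ?_, by field_simp⟩
      rw [h.v_eq _ hi, h.v_eq i (by omega), brPt, brPt, add_sub_add_left_eq_sub,
        ← AddCircle.coe_sub]
      congr 1; push_cast; ring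
    obtain ⟨r, hr, hr'⟩ := key
    have hr0 : 0 ≤ r := by
      by_contra hr0; push Not at hr0
      nlinarith
    have hr1 : r ≤ 1 := by
      by_contra hr1; push Not at hr1
      nlinarith
    rw [chordLength_mk, norm_sub_rev, hr, norm_coe_eq hr0 hr1, lt_min_iff]
    constructor
    · rw [div_lt_iff₀ hd]; linarith
    · rw [div_lt_iff₀ hd]; linarith
  · exact absurd rfl hne

variable (hS : IsCanonicalSCM d P v C τ S)
include hS

omit hS in
lemma orbit_M_subset : forwardOrbit d {s(v 0, b)} ⊆ forwardOrbit d (sides P) := by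
  rintro _ ⟨_, rfl, m, rfl⟩
  exact ⟨_, R.isSide h, m, rfl⟩

/-- The closing leaf is a side, so its orbit is in `S` and crosses neither the orbit of the chain
nor `C`. Disjointness of the polygons in the orbit keeps its iterates off the chain between returns.
-/
lemma macFrame : MACFrame d (v 0) b (u 0) := by
  have hF := hS.orbit_subset R.periodic
  have hM : ∀ m, chordIter d m s(v 0, b) ∈ S := fun m => hF ⟨_, R.isSide h, m, rfl⟩
  have hne : ∀ k, ¬ n ∣ k → ∀ i < d, ∀ x ∈ P, (sigma d)^[k + 1] x ≠ sigma d (v i) := by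
    intro k hk i hi x hx heq
    rw [iterate_succ_apply'] at heq
    exact R.ne k hk x hx _ (R.v_mem hi) (eq_of_periodic
      (iterate_mem_periodicPts (R.periodic hx) k) (R.periodic (R.v_mem hi)) heq)
  exact h.macFrame_of_return R.pos (R.fixed _ (R.v_mem h.d_pos)) (R.fixed _ (R.b_mem h))
    (fun k hk i hi => ⟨hne k hk i hi _ (R.v_mem h.d_pos), hne k hk i hi _ (R.b_mem h)⟩)
    (fun k i hi => hS.noncrossing (hF (hS.chain_image_mem hi)) (hM _))
    (fun k c hc => hS.not_crosses_portrait hc (hM k)) fun i j => hS.noncrossing (hM i) (hM j)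

lemma pullback_eq : pullback τ (forwardOrbit d {s(v 0, b)}) = macPullback d (v 0) b := by
  have hF := hS.orbit_subset R.periodic
  have hM := R.macFrame h hS
  refine h.pullback_eq_macPullback hM (fun i hi => R.periodic (R.v_mem hi)) hS.isPullbackScheme
    (fun _ hi => mem_forwardOrbit_self (hS.chain_mem hi)) fun e he i hi => ?_
  refine h.not_crosses_macPullback hM (fun i hi => R.periodic (R.v_mem hi))
    (X := forwardOrbit d (sides P)) (fun _ hi => hS.chain_image_mem hi) ?_ ?_ e he _
    (hS.chain_image_mem hi)
  · intro x y hxy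
    have hσ : s(sigma d x, sigma d y) ∈ forwardOrbit d (sides P) :=
      chordIter_mem_forwardOrbit hxy 1
    obtain ⟨f, hf, m, hm⟩ := hxy
    -- At multiples of the return time the side is back in place; at other times it avoids all
    -- vertices in the chain.
    by_cases hnm : n ∣ m
    · have hfe : chordIter d m f = f := by
        obtain ⟨p, q, hpq, rfl⟩ := hf
        rw [chordIter_mk, R.iterate_of_dvd hnm hpq.1, R.iterate_of_dvd hnm hpq.2.1]
      rw [hfe] at hm
      rcases R.side_cases h hS hf with ⟨j, hj, hfj⟩ | hfM
      · exact Or.inl ⟨j, hj, hm.trans hfj⟩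
      · right
        refine ⟨?_, hσ⟩
        rw [hfM] at hm
        rcases Sym2.eq_iff.1 hm with ⟨rfl, rfl⟩ | ⟨rfl, rfl⟩
        · rw [h.idx_v_zero, MACFrame.idx_b]
        · rw [h.idx_v_zero, MACFrame.idx_b]
    · right
      refine ⟨?_, hσ⟩
      have hxy : s(x, y) ∈ forwardOrbit d (sides P) := ⟨f, hf, m, hm⟩
      obtain ⟨p, q, hpq, rfl⟩ := hf
      have hne : ∀ z ∈ P, ∀ j < d, sigma d ((sigma d)^[m] z) ≠ sigma d (v j) := by
        intro z hz j hj heq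
        exact R.ne m hnm z hz _ (R.v_mem hj) (eq_of_periodic
          (iterate_mem_periodicPts (R.periodic hz) m) (R.periodic (R.v_mem hj)) heq)
      have hne' : ∀ z ∈ s(x, y), ∀ j < d, sigma d z ≠ sigma d (v j) := by
        intro z hz
        rw [hm, chordIter_mk, Sym2.mem_iff] at hz
        rcases hz with rfl | rfl
        · exact hne _ hpq.1
        · exact hne _ hpq.2.1
      exact h.idx_eq (fun c hc => hS.not_crosses_portrait hc (hF hxy))
        (hne' x (Sym2.mem_mk_left _ _)) (hne' y (Sym2.mem_mk_right _ _))
        fun j hj => hS.noncrossing (hF (hS.chain_image_mem hj)) (hF hσ)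
  · exact fun f hf s hs => hS.noncrossing (hF hs) (hF (R.orbit_M_subset h hf))

lemma chordClosure_subset : chordClosure (macPullback d (v 0) b) ⊆ S := by
  rw [← R.pullback_eq h hS, hS.isPullback]
  exact chordClosure_mono (pullback_mono (R.orbit_M_subset h))

/-- The closed pullback is part of `S`, so each of its classes is contained in a class of `S`.
Finiteness and being a boundary chord pass to subsets. -/
lemma isCanonicalMAC : IsCanonicalMAC d s(v 0, b) (chordClosure (macPullback d (v 0) b)) := by
  have hsub := R.chordClosure_subset h hS
  refine (R.macFrame h hS).isCanonicalMAC (fun x => ?_) fun x y he => ?_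
  · exact (hS.isInvariantLamination.finite_classes x).subset (leafClass_mono hsub x)
  · exact (hS.isInvariantLamination.boundary_leaves x y (hsub he)).mono (leafClass_mono hsub x)
      (mem_leafClass_self _ _) (mem_leafClass_of_mem he)

end ReturnFrame

end

/-! ### The reduction of a canonical SCM lamination -/

lemma not_crosses_diag {p q x : Circ} : ¬ Crosses s(p, q) s(x, x) := by
  rw [crosses_iff_coord p, RCross]
  rintro (⟨h1, h2, h3 | h3⟩ | ⟨h1, h2, h3 | h3⟩) <;> linarith

/-- A point outside an arc is not closer to a point of the arc than both ends. -/
lemma norm_sub_le_or_of_sbtw {p q x z : Circ} (hx : sbtw p x q) (hz : ¬ sbtw p z q) :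
    ‖x - p‖ ≤ ‖x - z‖ ∨ ‖x - q‖ ≤ ‖x - z‖ := by
  rw [sbtw_iff_fr] at hx hz
  rw [norm_sub_eq p x p, norm_sub_eq p x q, norm_sub_eq p x z, fr_self, sub_zero,
    abs_of_pos hx.1, abs_of_neg (by linarith : fr p x - fr p q < 0)]
  have h0 := fr_nonneg p z
  rcases h0.lt_or_eq with h0 | h0
  · have h1 : fr p q ≤ fr p z := not_lt.1 fun h => hz ⟨h0, h⟩
    have h2 := fr_lt_one p z
    rw [abs_of_neg (by linarith : fr p x - fr p z < 0)]
    rcases min_cases (-(fr p x - fr p z)) (1 - -(fr p x - fr p z)) with ⟨h3, -⟩ | ⟨h3, -⟩ <;> rw [h3]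
    · exact Or.inr ((min_le_left _ _).trans (by linarith))
    · exact Or.inl ((min_le_left _ _).trans (by linarith))
  · rw [← h0, sub_zero, abs_of_pos hx.1]; exact Or.inl le_rfl

lemma continuousAt_br {d : ℕ} {b w : Circ} (j : ℕ) (hw : w ≠ sigma d b) :
    ContinuousAt (br d b j) w := by
  have : br d b j = brPt d b j ∘ fr (sigma d b) := rfl
  rw [this]
  exact (continuous_brPt j).continuousAt.comp (continuousAt_fr hw)

namespace MACFrame

variable {d : ℕ} {a b : Circ} {β : ℝ} (h : MACFrame d a b β)
include h

/-- The image of the leaf has length `min β (1 - β)`, at most `β/d ≤ β/2`. This rules out the value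
`β`. -/
lemma half_lt : 1 / 2 < β := by
  have hd := h.d_posR
  have hd2 : (2 : ℝ) ≤ d := by exact_mod_cast h.two_le
  have h1 := h.chordLength_orbit_le 1
  have hβ := h.pos
  rw [chordIter_mk, chordLength_mk, iterate_one, norm_sub_eq (sigma d b), h.fr_sigma_a, fr_self,
    sub_zero, abs_of_pos hβ, le_div_iff₀ hd] at h1
  rcases min_cases β (1 - β) with ⟨h2, h3⟩ | ⟨h2, h3⟩
  · rw [h2] at h1; nlinarith
  · linarith

/-- Canonical branches are continuous except at `σ_d b`, so away from it they carry limits of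
pullback leaves to such limits. -/
lemma map_mem_chordClosure {x y : Circ} (hidx : idx d b x = idx d b y)
    (hx : sigma d x ≠ sigma d b) (hy : sigma d y ≠ sigma d b)
    (he : s(sigma d x, sigma d y) ∈ chordClosure (macPullback d a b)) :
    s(x, y) ∈ chordClosure (macPullback d a b) := by
  rw [mk_mem_chordClosure] at he ⊢
  refine ⟨fun hxy => he.1 (congrArg _ hxy), ?_⟩
  have hj := idx_lt (b := b) h.d_pos x
  have hc : ContinuousAt (fun p : Circ × Circ => (br d b (idx d b x) p.1, br d b (idx d b x) p.2))
      (sigma d x, sigma d y) :=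
    (ContinuousAt.comp (f := Prod.fst) (continuousAt_br _ hx) continuousAt_fst).prodMk
      (ContinuousAt.comp (f := Prod.snd) (continuousAt_br _ hy) continuousAt_snd)
  have := hc.continuousWithinAt.mem_closure he.2
    (t := {p : Circ × Circ | s(p.1, p.2) ∈ macPullback d a b})
    fun p hp => h.branchInvariant.map_mem _ hp _ hj
  simp only at this
  rw [br_idx h.d_pos] at this
  rwa [hidx, br_idx h.d_pos] at this

lemma of_sbtw_br {c : ℕ} (hc : c < d) {p : Circ}
    (hs : sbtw (br d b c (sigma d b)) p (br d b c (sigma d a))) :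
    idx d b p = c ∧ 0 < fr (sigma d b) (sigma d p) ∧ fr (sigma d b) (sigma d p) < β := by
  have hd := h.d_posR
  have hβ := h.pos
  have hβ1 := h.lt_one
  rw [sbtw_iff_cyc b, fr_br hc, fr_br hc, h.fr_sigma_a, fr_self, add_zero, fr_eq_idx h.d_pos p, cyc]
    at hs
  simp only [div_lt_div_iff_of_pos_right hd] at hs
  have h3 := fr_nonneg (sigma d b) (sigma d p)
  have h4 := fr_lt_one (sigma d b) (sigma d p)
  rcases hs with ⟨h1, h2⟩ | ⟨h1, h2⟩ | ⟨h1, h2⟩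
  · have h5 : idx d b p < c + 1 := by
      have : (idx d b p : ℝ) < c + 1 := by linarith
      exact_mod_cast this
    have h6 : c < idx d b p + 1 := by
      have : (c : ℝ) < idx d b p + 1 := by linarith
      exact_mod_cast this
    have h7 : idx d b p = c := by omega
    rw [h7] at h1 h2
    exact ⟨h7, by linarith, by linarith⟩
  · linarith
  · linarith

end MACFrame

/-! ### Double points and leaves that are only limits -/

section
variable {d : ℕ} {P : Set Circ} {v : ℕ → Circ} {C : Set Chord} {τ : Fin d → Circ → Circ}
  {S : Set Chord} {b : Circ} {u g : ℕ → ℝ}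

/-- The points in two leaves of the pullback of the orbit of the polygon. -/
def doublePoints (d : ℕ) (P : Set Circ) (τ : Fin d → Circ → Circ) : Set Circ :=
  {x | ∃ y z, y ≠ z ∧ s(x, y) ∈ pullback τ (forwardOrbit d (sides P)) ∧
    s(x, z) ∈ pullback τ (forwardOrbit d (sides P))}

/-- All iterates of the chord `s(x, y)` are in the open arcs of the length of the MAC leaf. -/
structure IsInner (d : ℕ) (b : Circ) (β : ℝ) (x y : Circ) : Prop where
  idx_eq : ∀ k, idx d b ((sigma d)^[k] x) = idx d b ((sigma d)^[k] y)
  left : ∀ k, 0 < fr (sigma d b) ((sigma d)^[k + 1] x) ∧ fr (sigma d b) ((sigma d)^[k + 1] x) < β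
  right : ∀ k, 0 < fr (sigma d b) ((sigma d)^[k + 1] y) ∧ fr (sigma d b) ((sigma d)^[k + 1] y) < β

lemma IsInner.sigma {β : ℝ} {x y : Circ} (h : IsInner d b β x y) :
    IsInner d b β (sigma d x) (sigma d y) :=
  ⟨fun k => h.idx_eq (k + 1), fun k => h.left (k + 1), fun k => h.right (k + 1)⟩

namespace IsCanonicalSCM

variable (hS : IsCanonicalSCM d P v C τ S) (hper : P ⊆ periodicPts (sigma d))
include hS hper

omit hper in
lemma pullback_forward {x y : Circ} (he : s(x, y) ∈ pullback τ (forwardOrbit d (sides P))) :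
    s(sigma d x, sigma d y) ∈ pullback τ (forwardOrbit d (sides P)) :=
  chordIter_mem_pullback hS.isPullbackScheme.right_inverse
    (fun _ hf => chordIter_mem_forwardOrbit hf 1) he

/-- All leaves of `S` are sides of classes and a polygon has only two sides at a vertex; two
pullback leaves leave no place for another one. -/
lemma mem_pullback_of_mem_doublePoints {x y : Circ} (he : s(x, y) ∈ S)
    (hx : x ∈ doublePoints d P τ) : s(x, y) ∈ pullback τ (forwardOrbit d (sides P)) := by
  obtain ⟨y₁, y₂, hne, h1, h2⟩ := hx
  have hb := hS.isInvariantLamination.boundary_leaves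
  rcases eq_or_eq_of_isSide (hb _ _ (hS.pullback_subset hper h1))
    (hb _ _ (hS.pullback_subset hper h2)) hne (hb _ _ he) with rfl | rfl
  · exact h1
  · exact h2

omit hS in
lemma iterate_mem_doublePoints
    (hD : ∀ x ∈ P, ∃ y z, y ≠ z ∧ s(x, y) ∈ sides P ∧ s(x, z) ∈ sides P) {x : Circ} (hx : x ∈ P)
    (m : ℕ) : (sigma d)^[m] x ∈ doublePoints d P τ := by
  obtain ⟨y, z, hne, hy, hz⟩ := hD x hx
  have hmem : ∀ w, s(x, w) ∈ sides P → w ∈ P := by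
    rintro w ⟨p, q, hpq, he⟩
    rcases Sym2.eq_iff.1 he with ⟨rfl, rfl⟩ | ⟨rfl, rfl⟩
    · exact hpq.2.1
    · exact hpq.1
  exact ⟨(sigma d)^[m] y, (sigma d)^[m] z,
    orbit_nondegenerate_of_periodic hper (hmem _ hy) (hmem _ hz) hne m,
    subset_pullback ⟨_, hy, m, rfl⟩, subset_pullback ⟨_, hz, m, rfl⟩⟩

omit hper in
-- The values of the `d` branches at `σ_d x` lie in different arcs counted from `x`, so the arc
-- number `0`, hence `x` itself, occurs.
lemma exists_branch (hd : 0 < d) (x : Circ) : ∃ i, τ i (sigma d x) = x := by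
  have hτ := hS.isPullbackScheme
  let f : Fin d → Fin d := fun i => ⟨idx d x (τ i (sigma d x)), idx_lt hd _⟩
  have hf : Injective f := by
    intro i j hij
    apply hτ.disjoint_images (sigma d x)
    change τ i (sigma d x) = τ j (sigma d x)
    rw [← ChainFrame.br_idx_scheme (b := x) hτ hd i, ← ChainFrame.br_idx_scheme (b := x) hτ hd j]
    congr 1
    exact congrArg Fin.val hij
  obtain ⟨i, hi⟩ := (Finite.injective_iff_surjective.1 hf) ⟨idx d x x, idx_lt hd _⟩
  refine ⟨i, ?_⟩
  rw [← ChainFrame.br_idx_scheme (b := x) hτ hd i, show idx d x (τ i (sigma d x)) = idx d x x from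
    congrArg Fin.val hi, br_idx hd]

omit hper in
lemma mem_doublePoints_of_sigma (hd : 0 < d) {x : Circ} (hx : sigma d x ∈ doublePoints d P τ) :
    x ∈ doublePoints d P τ := by
  obtain ⟨y, z, hne, hy, hz⟩ := hx
  obtain ⟨i, hi⟩ := hS.exists_branch hd x
  refine ⟨τ i y, τ i z, fun h => hne ?_, ?_, ?_⟩
  · rw [← hS.isPullbackScheme.right_inverse i y, h, hS.isPullbackScheme.right_inverse]
  · have := map_mem_pullback hy i
    rwa [Sym2.map_mk, hi] at this
  · have := map_mem_pullback hz i
    rwa [Sym2.map_mk, hi] at this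

variable (h : ChainFrame d v C b u g)
  (hD : ∀ x ∈ P, ∃ y z, y ≠ z ∧ s(x, y) ∈ sides P ∧ s(x, z) ∈ sides P)
include h hD

/-- A leaf without ends in the orbit of the polygon lies in one of the arcs of length `1/d`. -/
lemma leaf_step {x y : Circ} (he : s(x, y) ∈ S) (hx : x ∉ doublePoints d P τ)
    (hy : y ∉ doublePoints d P τ) :
    idx d b x = idx d b y ∧ s(sigma d x, sigma d y) ∈ S ∧
      ((fr (sigma d b) (sigma d x) < u 0 ∧ fr (sigma d b) (sigma d y) < u 0) ∨
        (u 0 < fr (sigma d b) (sigma d x) ∧ u 0 < fr (sigma d b) (sigma d y))) := by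
  have hne : ∀ z, z ∉ doublePoints d P τ → ∀ i < d, sigma d z ≠ sigma d (v i) := by
    intro z hz i hi heq
    apply hz
    apply hS.mem_doublePoints_of_sigma h.d_pos
    rw [heq]
    exact iterate_mem_doublePoints hper hD (hS.v_mem h.two_le hi) 1
  have hcr : ∀ i, i + 1 < d →
      ¬ Crosses s(sigma d (v i), sigma d (v (i + 1))) s(sigma d x, sigma d y) := by
    intro i hi
    rcases hS.isInvariantLamination.forward_invariant _ he with h1 | h1
    · have h2 : sigma d x = sigma d y := by simpa using h1
      rw [h2]; exact not_crosses_diag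
    · exact hS.noncrossing (hS.orbit_subset hper (hS.chain_image_mem hi)) h1
  have hidx := h.idx_eq (fun c hc => hS.not_crosses_portrait hc he) (hne x hx) (hne y hy) hcr
  refine ⟨hidx, ?_, h.same_side (hne x hx) (hne y hy) hcr 0 h.d_pos⟩
  rcases hS.isInvariantLamination.forward_invariant _ he with h1 | h1
  · exfalso
    have h2 : sigma d x = sigma d y := by simpa using h1
    apply hS.isInvariantLamination.isLamination.nondegenerate _ he
    rw [Sym2.mk_isDiag_iff, ← br_idx (b := b) h.d_pos x, hidx, h2, br_idx h.d_pos]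
  · exact h1

lemma leaf_iterate {x y : Circ} (he : s(x, y) ∈ S) (hx : x ∉ doublePoints d P τ)
    (hy : y ∉ doublePoints d P τ) (k : ℕ) : s((sigma d)^[k] x, (sigma d)^[k] y) ∈ S ∧
      (sigma d)^[k] x ∉ doublePoints d P τ ∧ (sigma d)^[k] y ∉ doublePoints d P τ := by
  induction k with
  | zero => exact ⟨he, hx, hy⟩
  | succ k ih =>
    obtain ⟨h1, h2, h3⟩ := ih
    rw [iterate_succ_apply', iterate_succ_apply']
    exact ⟨(hS.leaf_step hper h hD h1 h2 h3).2.1,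
      fun h4 => h2 (hS.mem_doublePoints_of_sigma h.d_pos h4),
      fun h4 => h3 (hS.mem_doublePoints_of_sigma h.d_pos h4)⟩

variable (hM : MACFrame d (v 0) b (u 0))
include hM

/-- Short leaves double in length under iteration. Once the length reaches `1 - u 0`, the image
cannot fit above `u 0`, so it is low, and its length again is at least `1 - u 0`. -/
lemma exists_isInner {x y : Circ} (he : s(x, y) ∈ S) (hx : x ∉ doublePoints d P τ)
    (hy : y ∉ doublePoints d P τ) : ∃ K, IsInner d b (u 0) ((sigma d)^[K] x) ((sigma d)^[K] y) := by
  have hd := h.d_posR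
  have hd2 : (2 : ℝ) ≤ d := by exact_mod_cast h.two_le
  have hit := hS.leaf_iterate hper h hD he hx hy
  have hst := fun k => hS.leaf_step hper h hD (hit k).1 (hit k).2.1 (hit k).2.2
  have hhalf := hM.half_lt
  have hu1 := hM.lt_one
  set X : ℕ → ℝ := fun k => fr (sigma d b) ((sigma d)^[k] x) with hX
  set Y : ℕ → ℝ := fun k => fr (sigma d b) ((sigma d)^[k] y) with hY
  set len : ℕ → ℝ := fun k => ‖(sigma d)^[k] x - (sigma d)^[k] y‖ with hlen
  have hside : ∀ k, (X (k + 1) < u 0 ∧ Y (k + 1) < u 0) ∨ (u 0 < X (k + 1) ∧ u 0 < Y (k + 1)) := by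
    intro k
    simp only [hX, hY, iterate_succ_apply']
    exact (hst k).2.2
  have hX0 : ∀ k, 0 ≤ X k := fun k => fr_nonneg _ _
  have hX1 : ∀ k, X k < 1 := fun k => fr_lt_one _ _
  have hY0 : ∀ k, 0 ≤ Y k := fun k => fr_nonneg _ _
  have hY1 : ∀ k, Y k < 1 := fun k => fr_lt_one _ _
  have hlen0 : ∀ k, 0 ≤ len k := fun k => norm_nonneg _
  have hlen1 : ∀ k, d * len k = |X (k + 1) - Y (k + 1)| := by
    intro k
    simp only [hlen, hX, hY]
    rw [chordLength_of_idx_eq h.two_le (hst k).1, iterate_succ_apply', iterate_succ_apply']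
    field_simp
  have hlen2 : ∀ k, len (k + 1) = min (d * len k) (1 - d * len k) := by
    intro k
    rw [hlen1]
    exact norm_sub_eq (sigma d b) _ _
  have hlow_len : ∀ k, X (k + 1) < u 0 → Y (k + 1) < u 0 → d * len k < u 0 := by
    intro k h1 h2
    rw [hlen1, abs_lt]; constructor <;> linarith [hX0 (k + 1), hY0 (k + 1)]
  have hhigh_len : ∀ k, u 0 < X (k + 1) → u 0 < Y (k + 1) → d * len k < 1 - u 0 := by
    intro k h1 h2
    rw [hlen1, abs_lt]; constructor <;> linarith [hX1 (k + 1), hY1 (k + 1)]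
  have hmul : ∀ k, 2 * len k ≤ d * len k := fun k => mul_le_mul_of_nonneg_right hd2 (hlen0 k)
  -- Lengths below `1 - u 0` forever would double forever; `half_lt` excludes the wrapped value `1 -
  -- d * len k` meanwhile.
  obtain ⟨K, hK⟩ : ∃ K, 1 - u 0 ≤ len K := by
    by_contra hno
    push Not at hno
    have hdouble : ∀ k, 2 * len k ≤ len (k + 1) := by
      intro k
      have h1 := hno (k + 1)
      rw [hlen2] at h1 ⊢
      rcases min_cases (d * len k) (1 - d * len k) with ⟨h2, -⟩ | ⟨h2, -⟩
      · rw [h2]; exact hmul k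
      · exfalso
        rw [h2] at h1
        rcases hside k with h3 | h3
        · have := hlow_len k h3.1 h3.2; linarith
        · have := hhigh_len k h3.1 h3.2; linarith
    have hpow : ∀ k, 2 ^ k * len 0 ≤ len k := by
      intro k
      induction k with
      | zero => simp
      | succ k ih =>
        rw [pow_succ]; linarith [hdouble k]
    have hpos : 0 < len 0 := by
      simp only [hlen, iterate_zero, id_eq, norm_pos_iff, sub_ne_zero]
      have := hS.isInvariantLamination.isLamination.nondegenerate _ he
      rwa [Sym2.mk_isDiag_iff] at this
    obtain ⟨k, hk⟩ := pow_unbounded_of_one_lt (1 / len 0) (one_lt_two (α := ℝ))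
    rw [div_lt_iff₀ hpos] at hk
    linarith [hpow k, hno k]
  have hlong : ∀ k, 1 - u 0 ≤ len (K + k) ∧ X (K + k + 1) < u 0 ∧ Y (K + k + 1) < u 0 := by
    have hlow : ∀ k, 1 - u 0 ≤ len k → X (k + 1) < u 0 ∧ Y (k + 1) < u 0 := by
      intro k hk
      rcases hside k with h3 | h3
      · exact h3
      · have := hhigh_len k h3.1 h3.2
        linarith [hmul k]
    intro k
    induction k with
    | zero => exact ⟨hK, hlow K hK⟩
    | succ k ih =>
      have h1 : 1 - u 0 ≤ len (K + k + 1) := by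
        rw [hlen2, le_min_iff]
        have := hlow_len _ ih.2.1 ih.2.2
        exact ⟨by linarith [hmul (K + k)], by linarith⟩
      exact ⟨h1, hlow _ h1⟩
  -- The lower bound is strict because `σ_d b` is a double point.
  have hpos : ∀ z, z ∉ doublePoints d P τ → 0 < fr (sigma d b) z := by
    intro z hz
    rw [fr_pos]
    rintro rfl
    apply hz
    have := iterate_mem_doublePoints (τ := τ) hper hD
      (hS.v_mem h.two_le (i := d - 1) (by have := h.d_pos; omega)) 1
    rwa [h.v_last] at this
  refine ⟨K, fun k => ?_, fun k => ?_, fun k => ?_⟩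
  · rw [← iterate_add_apply, ← iterate_add_apply, add_comm]
    exact (hst _).1
  · rw [← iterate_add_apply, show k + 1 + K = K + k + 1 by omega]
    exact ⟨hpos _ (hit _).2.1, (hlong k).2.1⟩
  · rw [← iterate_add_apply, show k + 1 + K = K + k + 1 by omega]
    exact ⟨hpos _ (hit _).2.2, (hlong k).2.2⟩

omit hD hM in
/-- A leaf of the pullback with an end in the open arc of the length of the MAC leaf has its other
end in the same arc of length `1/d`. -/
lemma idx_eq_of_inner {x y : Circ} (he : s(x, y) ∈ pullback τ (forwardOrbit d (sides P)))
    (hx0 : 0 < fr (sigma d b) (sigma d x)) (hx1 : fr (sigma d b) (sigma d x) < u 0) :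
    idx d b x = idx d b y := by
  have hτ := hS.isPullbackScheme
  have hσ := hS.pullback_forward he
  have hfrv : ∀ i < d, fr (sigma d b) (sigma d (v i)) = 0 ∧ i = d - 1 ∨
      fr (sigma d b) (sigma d (v i)) = u i := by
    intro i hi
    rcases (show i + 1 < d ∨ i = d - 1 by omega) with h1 | h1
    · exact Or.inr (h.fr_sigma_v h1)
    · left; exact ⟨by rw [h1, h.v_last, fr_self], h1⟩
  have hxv : ∀ i < d, sigma d x ≠ sigma d (v i) := by
    intro i hi heq
    rw [heq] at hx0 hx1
    have := h.u_le (Nat.zero_le i) hi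
    rcases hfrv i hi with h1 | h1
    · linarith [h1.1]
    · linarith
  have hy : fr (sigma d b) (sigma d y) ≤ u 0 := by
    by_cases hyv : ∃ i < d, sigma d y = sigma d (v i)
    · obtain ⟨i, hi, hyi⟩ := hyv
      by_cases hi0 : i = 0
      · rw [hyi, hi0, h.fr_sigma_v h.two_le]
      · rcases (show i + 1 < d ∨ i = d - 1 by omega) with h1 | h1
        · exfalso
          -- At the image of an inner vertex, the two adjacent images of the chain are already the
          -- two sides of the class, so the leaf would have to be one of them.
          obtain ⟨j, rfl⟩ : ∃ j, i = j + 1 := ⟨i - 1, by omega⟩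
          have hb := hS.isInvariantLamination.boundary_leaves
          have hsub := hS.pullback_subset hper
          have h2 : IsSide (leafClass S (sigma d y)) s(sigma d y, sigma d x) :=
            hb _ _ (hsub (by rw [Sym2.eq_swap]; exact hσ))
          have h3 : IsSide (leafClass S (sigma d y)) s(sigma d y, sigma d (v j)) :=
            hb _ _ (hsub (by
              rw [hyi, Sym2.eq_swap]; exact subset_pullback (hS.chain_image_mem hi)))
          have h4 : IsSide (leafClass S (sigma d y)) s(sigma d y, sigma d (v (j + 1 + 1))) :=
            hb _ _ (hsub (by rw [hyi]; exact subset_pullback (hS.chain_image_mem h1)))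
          have h5 : sigma d (v j) ≠ sigma d (v (j + 1 + 1)) := by
            intro heq
            have h2 := h.fr_sigma_v hi
            rw [heq] at h2
            have h3 := h.lt_succ j hi
            have h4 := h.lt_succ _ h1
            have h5 := h.u_pos (i := j) (by omega)
            rcases hfrv _ h1 with h6 | h6
            · linarith [h6.1]
            · linarith
          rcases eq_or_eq_of_isSide h3 h4 h5 h2 with h6 | h6
          · exact hxv j (by omega) h6
          · exact hxv _ h1 h6
        · rw [hyi, h1, h.v_last, fr_self]; exact h.pos.le
    · push Not at hyv
      rcases h.same_side hxv hyv (fun i hi => hS.noncrossing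
        (hS.orbit_subset hper (hS.chain_image_mem hi)) (hS.pullback_subset hper hσ)) 0 h.d_pos with
        h1 | h1
      · exact h1.2.le
      · linarith [h1.1]
  obtain ⟨r, -, hr⟩ := h.exists_branch_index hτ fun i hi => mem_forwardOrbit_self (hS.chain_mem hi)
  obtain ⟨i, hi⟩ := exists_eq_map hτ.right_inverse hτ.fixes he
  obtain ⟨h1, h2⟩ := eq_of_map_eq (hτ.right_inverse i) hi
  rw [← h1, ← h2, hr i _ hx1.le, hr i _ hy, idx_br (r i).2, idx_br (r i).2]

end IsCanonicalSCM

end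

/-! ### Separation by pullbacks of the MAC leaf, and the reduction -/

section
variable {d : ℕ} {P : Set Circ} {v : ℕ → Circ} {C : Set Chord} {τ : Fin d → Circ → Circ}
  {S : Set Chord} {b : Circ} {u g : ℕ → ℝ}

namespace IsCanonicalSCM

variable (hS : IsCanonicalSCM d P v C τ S) (hper : P ⊆ periodicPts (sigma d))
variable (h : ChainFrame d v C b u g) (hM : MACFrame d (v 0) b (u 0))
include hS hper h hM

/-- Inner leaves are separated from the pullback of the orbit of the polygon by pullbacks of the MAC
leaf. -/
lemma exists_separating {m : ℕ} {x y p q : Circ} (hxy : IsInner d b (u 0) x y)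
    (hpq : s(p, q) ∈ pullback τ (forwardOrbit d (sides P)))
    (hm : ∃ i < d, ∃ j < d, chordIter d m s(p, q) = s(v i, v j)) :
    ∃ z w, s(z, w) ∈ macPullback d (v 0) b ∧ sbtw z x w ∧ sbtw z y w ∧ ¬ sbtw z p w ∧
      ¬ sbtw z q w := by
  have hd0 := h.d_pos
  -- If neither `p` nor `q` is inside the open arc of length `u 0 / d` that contains `x` and `y`,
  -- the pullback of `σ_d(M)` spanning this arc separates.
  have hfix : ∀ x y p q, IsInner d b (u 0) x y →
      (∀ z ∈ s(p, q), ¬ (idx d b z = idx d b x ∧ 0 < fr (sigma d b) (sigma d z) ∧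
        fr (sigma d b) (sigma d z) < u 0)) →
      ∃ z w, s(z, w) ∈ macPullback d (v 0) b ∧ sbtw z x w ∧ sbtw z y w ∧ ¬ sbtw z p w ∧
        ¬ sbtw z q w := by
    intro x y p q hxy hpq
    have hj := idx_lt (b := b) hd0 x
    have hin : ∀ z, idx d b z = idx d b x → 0 < fr (sigma d b) (sigma d z) →
        fr (sigma d b) (sigma d z) < u 0 →
        sbtw (br d b (idx d b x) (sigma d b)) z (br d b (idx d b x) (sigma d (v 0))) := by
      intro z h1 h2 h3
      have e : br d b (idx d b x) (sigma d z) = z := by rw [← h1, br_idx hd0]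
      have : sbtw (sigma d b) (sigma d z) (sigma d (v 0)) :=
        sbtw_iff_fr.2 ⟨h2, by rwa [hM.fr_sigma_a]⟩
      rwa [← sbtw_br hj, e] at this
    refine ⟨br d b (idx d b x) (sigma d b), br d b (idx d b x) (sigma d (v 0)), ?_,
      hin x rfl (hxy.left 0).1 (hxy.left 0).2,
      hin y (hxy.idx_eq 0).symm (hxy.right 0).1 (hxy.right 0).2,
      fun hs => hpq p (Sym2.mem_mk_left _ _) (hM.of_sbtw_br hj hs),
      fun hs => hpq q (Sym2.mem_mk_right _ _) (hM.of_sbtw_br hj hs)⟩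
    have := hM.branchInvariant.map_mem _ MACFrame.sigma_M_mem _ hj
    rwa [Sym2.map_mk, Sym2.eq_swap] at this
  induction m generalizing x y p q with
  | zero =>
    refine hfix x y p q hxy ?_
    have hv : ∀ i < d, ¬ (0 < fr (sigma d b) (sigma d (v i)) ∧
        fr (sigma d b) (sigma d (v i)) < u 0) := by
      rintro i hi ⟨h1, h2⟩
      rcases (show i + 1 < d ∨ i = d - 1 by omega) with h3 | h3
      · rw [h.fr_sigma_v h3] at h2
        linarith [h.u_le (Nat.zero_le i) hi]
      · rw [h3, h.v_last, fr_self] at h1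
        exact lt_irrefl _ h1
    obtain ⟨i, hi, j, hj, hij⟩ := hm
    rw [chordIter_zero] at hij
    rw [hij]
    intro z hz
    rcases Sym2.mem_iff.1 hz with rfl | rfl
    · exact fun h1 => hv i hi h1.2
    · exact fun h1 => hv j hj h1.2
  | succ m ih =>
    by_cases hin : ∀ z ∈ s(p, q), ¬ (idx d b z = idx d b x ∧ 0 < fr (sigma d b) (sigma d z) ∧
        fr (sigma d b) (sigma d z) < u 0)
    · exact hfix x y p q hxy hin
    -- Otherwise all four points lie in one arc of length `1/d`, and a leaf separating their images
    -- can be pulled back by its branch.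
    · have hidx : idx d b p = idx d b x ∧ idx d b q = idx d b x := by
        push Not at hin
        obtain ⟨z, hz, h1, h2, h3⟩ := hin
        rcases Sym2.mem_iff.1 hz with rfl | rfl
        · exact ⟨h1, (hS.idx_eq_of_inner hper h hpq h2 h3).symm.trans h1⟩
        · rw [Sym2.eq_swap] at hpq
          exact ⟨(hS.idx_eq_of_inner hper h hpq h2 h3).symm.trans h1, h1⟩
      obtain ⟨z, w, hzw, hx, hy, hp, hq⟩ := ih hxy.sigma (hS.pullback_forward hpq)
        (by simpa only [chordIter_mk, iterate_succ_apply] using hm)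
      have hj := idx_lt (b := b) hd0 x
      have hbr : ∀ r, idx d b r = idx d b x → (sbtw z (sigma d r) w ↔
          sbtw (br d b (idx d b x) z) r (br d b (idx d b x) w)) := by
        intro r hr
        rw [← sbtw_br hj, ← hr, br_idx hd0]
      rw [hbr x rfl] at hx
      rw [hbr y (hxy.idx_eq 0).symm] at hy
      rw [hbr p hidx.1] at hp
      rw [hbr q hidx.2] at hq
      exact ⟨_, _, hM.branchInvariant.map_mem _ hzw _ hj, hx, hy, hp, hq⟩

variable (hV : ∀ e ∈ forwardOrbit d (sides P), ∃ m, ∃ i < d, ∃ j < d, chordIter d m e = s(v i, v j))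
include hV

/-- Inner leaves are limits of pullbacks of the MAC leaf. -/
lemma inner_mem_chordClosure {x y : Circ} (hxy : IsInner d b (u 0) x y) (he : s(x, y) ∈ S) :
    s(x, y) ∈ chordClosure (macPullback d (v 0) b) := by
  rw [hS.isPullback, mk_mem_chordClosure] at he
  rw [mk_mem_chordClosure]
  obtain ⟨hne, hcl⟩ := he
  refine ⟨hne, ?_⟩
  rw [Metric.mem_closure_iff] at hcl ⊢
  intro ε hε
  have hpos : 0 < ‖x - y‖ := by rw [norm_pos_iff, sub_ne_zero]; exact hne
  obtain ⟨⟨p, q⟩, hpq, hdist⟩ := hcl (min ε (‖x - y‖ / 2)) (lt_min hε (by linarith))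
  obtain ⟨m₁, hm₁⟩ := exists_chordIter_mem hS.isPullbackScheme.right_inverse hpq
  obtain ⟨m₂, i, hi, j, hj, hm₂⟩ := hV _ hm₁
  rw [← chordIter_add] at hm₂
  obtain ⟨z, w, hzw, hx, hy, hp, hq⟩ :=
    hS.exists_separating hper h hM hxy hpq ⟨i, hi, j, hj, hm₂⟩
  rw [Prod.dist_eq, max_lt_iff, dist_eq_norm, dist_eq_norm] at hdist
  simp only [lt_min_iff] at hdist
  obtain ⟨⟨hp1, hp2⟩, hq1, hq2⟩ := hdist
  -- The two ends cannot be approximated by the same end of the separating leaf, since `p` and `q`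
  -- are within half of the distance between `x` and `y`.
  have hxy' : ∀ r, ‖x - r‖ ≤ ‖x - p‖ → ‖y - r‖ ≤ ‖y - q‖ → False := by
    intro r h1 h2
    have h3 : ‖x - y‖ ≤ ‖x - r‖ + ‖y - r‖ := by
      rw [norm_sub_rev y r]; exact norm_sub_le_norm_sub_add_norm_sub x r y
    linarith
  rcases norm_sub_le_or_of_sbtw hx hp with h1 | h1 <;>
  rcases norm_sub_le_or_of_sbtw hy hq with h2 | h2
  · exact (hxy' z h1 h2).elim
  · refine ⟨(z, w), hzw, ?_⟩
    rw [Prod.dist_eq, max_lt_iff, dist_eq_norm, dist_eq_norm]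
    exact ⟨by simp only; linarith, by simp only; linarith⟩
  · refine ⟨(w, z), show s(w, z) ∈ _ by rwa [Sym2.eq_swap], ?_⟩
    rw [Prod.dist_eq, max_lt_iff, dist_eq_norm, dist_eq_norm]
    exact ⟨by simp only; linarith, by simp only; linarith⟩
  · exact (hxy' w h1 h2).elim

variable (hD : ∀ x ∈ P, ∃ y z, y ≠ z ∧ s(x, y) ∈ sides P ∧ s(x, z) ∈ sides P)
include hD

/-- The leaves that do not come from the orbit of the polygon are limits of pullbacks of the MAC
leaf. -/
lemma mem_chordClosure_of_notMem {e : Chord} (he : e ∈ S)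
    (hno : e ∉ pullback τ (forwardOrbit d (sides P))) :
    e ∈ chordClosure (macPullback d (v 0) b) := by
  induction e using Sym2.ind with | _ x y
  have hx : x ∉ doublePoints d P τ := fun hx => hno (hS.mem_pullback_of_mem_doublePoints hper he hx)
  have hy : y ∉ doublePoints d P τ := fun hy => hno (by
    rw [Sym2.eq_swap] at he ⊢
    exact hS.mem_pullback_of_mem_doublePoints hper he hy)
  have hit := hS.leaf_iterate hper h hD he hx hy
  obtain ⟨K, hK⟩ := hS.exists_isInner hper h hD hM he hx hy
  have h1 := hS.inner_mem_chordClosure hper h hM hV hK (hit K).1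
  have hb : sigma d b ∈ doublePoints d P τ := by
    have := iterate_mem_doublePoints (τ := τ) hper hD
      (hS.v_mem h.two_le (i := d - 1) (by have := h.d_pos; omega)) 1
    rwa [h.v_last] at this
  -- Inner iterates are limits of pullbacks; continuity of the branches brings this back, one
  -- preimage at a time.
  clear hK
  induction K with
  | zero => exact h1
  | succ K ih =>
    apply ih
    obtain ⟨h2, h3, h4⟩ := hit K
    have hne : ∀ z, z ∉ doublePoints d P τ → sigma d z ≠ sigma d b := by
      intro z hz heq
      exact hz (hS.mem_doublePoints_of_sigma h.d_pos (heq ▸ hb))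
    rw [iterate_succ_apply', iterate_succ_apply'] at h1
    exact hM.map_mem_chordClosure (hS.leaf_step hper h hD h2 h3 h4).1 (hne _ h3) (hne _ h4) h1

omit hper h hM hV hD in
lemma mem_pullback_cases {M e : Chord} (he : e ∈ pullback τ (forwardOrbit d (sides P))) :
    e ∈ pullback τ (forwardOrbit d {M}) ∨ e ∈ grandOrbit d (sides P \ {M}) := by
  refine pullback_induction
    (p := fun e => e ∈ pullback τ (forwardOrbit d {M}) ∨ e ∈ grandOrbit d (sides P \ {M}))
    ?_ ?_ e he
  · rintro _ ⟨f, hf, k, rfl⟩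
    by_cases hfM : f = M
    · exact Or.inl (subset_pullback ⟨f, hfM, k, rfl⟩)
    · exact Or.inr ⟨f, ⟨hf, hfM⟩, 0, k, by simp⟩
  · rintro e - (h1 | ⟨f, hf, n, k, h1⟩) i
    · exact Or.inl (map_mem_pullback h1 i)
    · refine Or.inr ⟨f, hf, n + 1, k, ?_⟩
      rw [chordIter_succ, chordIter_one_map hS.isPullbackScheme.right_inverse, h1]

/-- The reduction of the SCM lamination is the closure of the pullback of the MAC leaf. -/
lemma reduction_eq (hpb : pullback τ (forwardOrbit d {s(v 0, b)}) = macPullback d (v 0) b)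
    (hGO : ∀ e ∈ sides P, e ≠ s(v 0, b) → ∀ l m, chordIter d l e ≠ chordIter d m s(v 0, b)) :
    reduction P τ S s(v 0, b) = chordClosure (macPullback d (v 0) b) := by
  have hτ := hS.isPullbackScheme.right_inverse
  have hE : macPullback d (v 0) b ⊆ chordClosure (macPullback d (v 0) b) := fun e he =>
    mem_chordClosure_of_mem he (hM.branchInvariant.nondegenerate e he)
  refine Subset.antisymm (chordClosure_subset_of ?_) (chordClosure_mono fun e he => ?_)
  · rintro e ⟨he | he, hgo⟩
    · by_cases hEP : e ∈ pullback τ (forwardOrbit d (sides P))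
      · rcases hS.mem_pullback_cases (M := s(v 0, b)) hEP with h1 | h1
        · rw [hpb] at h1; exact hE h1
        · have h2 : e ∈ grandOrbit d {s(v 0, b)} := by
            by_contra h2; exact hgo ⟨h1, h2⟩
          obtain ⟨f, hf, n, k, h3⟩ := h1
          obtain ⟨_, rfl, n', k', h4⟩ := h2
          -- Membership in both grand orbits would give an iterate of another side equal to an
          -- iterate of the MAC leaf.
          refine absurd ?_ (hGO f hf.1 hf.2 (n' + k) (n + k'))
          rw [chordIter_add, ← h3, chordIter_comm, h4, ← chordIter_add]
      · exact hS.mem_chordClosure_of_notMem hper h hM hV hD he hEP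
    · rw [hpb] at he; exact hE he
  · rw [← hpb] at he
    exact ⟨Or.inr he, fun h1 => h1.2 (pullback_forwardOrbit_subset_grandOrbit hτ he)⟩

end IsCanonicalSCM

end

/-! ### Assembling the two cases -/

lemma CyclicEnum.exists_two_sides {P : Set Circ} {N : ℕ} {p : ℕ → Circ} (h : CyclicEnum P N p)
    (hN : 3 ≤ N) : ∀ x ∈ P, ∃ y z, y ≠ z ∧ s(x, y) ∈ sides P ∧ s(x, z) ∈ sides P := by
  intro x hx
  obtain ⟨i, hi, rfl⟩ := h.exists_lt hx
  have h1 := h.consecutive (i + (N - 1))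
  rw [show i + (N - 1) + 1 = i + N by omega, h.add_self] at h1
  refine ⟨p (i + 1), p (i + (N - 1)), ?_, ⟨_, _, h.consecutive i, rfl⟩, ⟨_, _, h1, Sym2.eq_swap⟩⟩
  rw [Ne, h.eq_iff]
  intro h2
  have h3 := Nat.ModEq.add_left_cancel' i h2
  rw [Nat.ModEq, Nat.mod_eq_of_lt (by omega), Nat.mod_eq_of_lt (by omega)] at h3
  omega

section
variable {d : ℕ} {P : Set Circ} {v : ℕ → Circ} {C : Set Chord} {τ : Fin d → Circ → Circ}
  {S : Set Chord}

/-- If the polygon is the orbit of the MAC leaf, the reduction changes nothing. -/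
lemma IsCanonicalSCM.reduction_eq_of_orbit_eq (hS : IsCanonicalSCM d P v C τ S)
    (hper : P ⊆ periodicPts (sigma d)) {M : Chord}
    (hO : forwardOrbit d (sides P) = forwardOrbit d {M}) :
    reduction P τ S M = chordClosure (pullback τ (forwardOrbit d {M})) := by
  have hE := hS.pullback_nondegenerate hper
  have hSE := hS.isPullback
  rw [hO] at hE hSE
  refine Subset.antisymm (chordClosure_subset_of ?_) (chordClosure_mono fun e he => ?_)
  · rintro e ⟨he | he, -⟩
    · rwa [← hSE]
    · exact mem_chordClosure_of_mem he (hE e he)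
  · exact ⟨Or.inr he, fun h1 => h1.2
      (pullback_forwardOrbit_subset_grandOrbit hS.isPullbackScheme.right_inverse he)⟩

namespace ReturnFrame

variable {n : ℕ} {b : Circ} {u g : ℕ → ℝ} (R : ReturnFrame d n P v)
  (h : ChainFrame d v C b u g) (hS : IsCanonicalSCM d P v C τ S)
include R h hS

/-- For `d = 2` the polygon is the leaf itself. For `d ≥ 3` each vertex has two different sides, as
needed for double points, and orbits of different sides never meet. -/
lemma reduction_eq (hcard : P.ncard = d) :
    reduction P τ S s(v 0, b) = chordClosure (macPullback d (v 0) b) := by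
  have hd := h.two_le
  rcases hd.eq_or_lt with rfl | hd3
  · rw [← R.pullback_eq h hS]
    refine hS.reduction_eq_of_orbit_eq R.periodic ?_
    have : sides P = {s(v 0, b)} := by
      ext e
      refine ⟨fun he => ?_, fun he => he ▸ R.isSide h⟩
      rcases R.side_cases h hS he with ⟨i, hi, rfl⟩ | rfl
      · obtain rfl : i = 0 := by omega
        rw [← h.v_last]; rfl
      · rfl
    rw [this]
  · refine hS.reduction_eq R.periodic h (R.macFrame h hS) ?_ ?_ (R.pullback_eq h hS)
      fun e he hne l m => R.chordIter_ne he (R.isSide h) hne l m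
    · rintro _ ⟨_, ⟨x, y, hxy, rfl⟩, m, rfl⟩
      obtain ⟨c, hc⟩ : ∃ c, n ∣ c + m := ⟨m * (n - 1), m, by
        have := R.pos
        obtain ⟨n', rfl⟩ : ∃ n', n = n' + 1 := ⟨n - 1, by omega⟩
        rw [Nat.add_sub_cancel]; ring⟩
      have hx := hxy.1
      have hy := hxy.2.1
      refine ⟨c, ?_⟩
      rw [← chordIter_add, chordIter_mk, R.iterate_of_dvd hc hx, R.iterate_of_dvd hc hy]
      rw [R.eq_image] at hx hy
      obtain ⟨i, hi, rfl⟩ := hx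
      obtain ⟨j, hj, rfl⟩ := hy
      exact ⟨i, hi, j, hj, rfl⟩
    · obtain ⟨p, hp, -⟩ := exists_cyclicEnum (P := P) (by omega) (R.b_mem h)
      exact hp.exists_two_sides (by omega)

lemma isMarkedBy (hP : IsIdentityReturn d P) : IsMarkedBy d P s(v 0, b) :=
  ⟨fun _ => ⟨R.isSide h, fun _ he hne => R.chordLength_lt h hS he hne⟩,
    fun hrot => absurd hP (not_isIdentityReturn_of_isRotational hrot)⟩

lemma eq_of_isMarkedBy (hP : IsIdentityReturn d P) {M : Chord} (hM : IsMarkedBy d P M) :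
    M = s(v 0, b) := by
  obtain ⟨h1, h2⟩ := hM.1 hP
  by_contra hne
  exact lt_asymm (h2 _ (R.isSide h) (Ne.symm hne)) (R.chordLength_lt h hS h1 hne)

end ReturnFrame

namespace RotFrame

variable {k t : ℕ} {p : ℕ → Circ} {u g : ℕ → ℝ} (R : RotFrame d k t P v p)
  (h : ChainFrame d v C (p 0) u g) (hS : IsCanonicalSCM d P v C τ S)
include R h hS

/-- For `d = 2` the orbit of the leaf is the set of all sides. For `d ≥ 3` iterates of the leaf are
never sides, while iterates of sides always are. -/
lemma reduction_eq :
    reduction P τ S s(v 0, p 0) = chordClosure (macPullback d (v 0) (p 0)) := by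
  have hd := h.two_le
  have hper : P ⊆ periodicPts (sigma d) := fun x hx => R.periodic hx
  rcases hd.eq_or_lt with rfl | hd3
  · rw [← R.pullback_eq h hS.isPullbackScheme]
    refine hS.reduction_eq_of_orbit_eq hper ?_
    rw [R.forwardOrbit_sides]
    ext e
    rw [R.enum.mem_sides_iff, mem_forwardOrbit_singleton]
    constructor
    · rintro ⟨i, -, rfl⟩
      simpa using R.mem_orbit i
    · rintro ⟨m, rfl⟩
      have h1 := hS.chain_mem (i := 0) (by omega)
      have h2 := R.v_last
      simp only [Nat.add_one_sub_one, zero_add] at h1 h2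
      rw [h2] at h1
      exact R.enum.mem_sides_iff.1 (R.chordIter_side h1 m)
  · refine hS.reduction_eq hper h (R.macFrame h) ?_ ?_ (R.pullback_eq h hS.isPullbackScheme)
      fun e he _ l m heq => R.not_isSide hd3 m (heq ▸ R.chordIter_side he l)
    · rw [R.forwardOrbit_sides]
      intro e he
      obtain ⟨i, -, rfl⟩ := R.enum.mem_sides_iff.1 he
      have hr := Nat.mod_lt i (show 0 < d - 1 by omega)
      -- Iteration moves the first vertex of the side to the vertex of the chain with the same
      -- residue modulo `d - 1`, so the side lands in the chain.
      obtain ⟨m, hm⟩ := R.exists_iterate i (i % (d - 1)) (Nat.mod_modEq _ _) hr.le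
      refine ⟨m, i % (d - 1), by omega, i % (d - 1) + 1, by omega, ?_⟩
      rw [chordIter_mk, R.iterate_p, R.iterate_p, R.v_eq _ (by omega), R.v_eq _ (by omega),
        R.enum.eq_of_modEq hm, add_right_comm, R.enum.eq_of_modEq (hm.add_right 1), add_assoc]
    · refine R.enum.exists_two_sides ?_
      have : 2 * (d - 1) ≤ k * (d - 1) := Nat.mul_le_mul_right _ R.two_le_period
      omega

omit hS in
lemma isMarkedBy (hP : IsRotational d P) : IsMarkedBy d P s(v 0, p 0) := by
  refine ⟨fun hid => absurd hid (not_isIdentityReturn_of_isRotational hP), fun _ => ⟨?_, fun hd => ?_⟩⟩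
  · exact ⟨_, R.v_zero ▸ R.enum.mem _, _, R.enum.mem 0, (R.macFrame h).ne, rfl⟩
  · have := R.not_isSide hd 0
    rwa [chordIter_zero] at this

end RotFrame

end

end Lam

end

theorem mainTheorem3 (d : ℕ) (hd : 2 ≤ d) (P : Set Lam.Circ) (v : ℕ → Lam.Circ)
    (C : Set Lam.Chord) (τ : Fin d → Lam.Circ → Lam.Circ) (S : Set Lam.Chord)
    (hS : Lam.IsCanonicalSCM d P v C τ S)
    (hP : (Lam.IsIdentityReturn d P ∧ P.ncard = d) ∨
      (Lam.IsRotational d P ∧ ∃ k : ℕ,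
        (∀ x ∈ P, Function.minimalPeriod (Lam.sigma d) x = k) ∧ P.ncard = k * (d - 1))) :
    ∃ (M : Lam.Chord) (L : Set Lam.Chord),
      (Lam.IsCanonicalMAC d M L ∧ Lam.IsMarkedBy d P M) ∧
      M = s(v 0, v (d - 1)) ∧
      L = Lam.reduction P τ S M ∧
      ∀ (M' : Lam.Chord) (L' : Set Lam.Chord),
        Lam.IsCanonicalMAC d M' L' → Lam.IsMarkedBy d P M' → M' = M ∧ L' = L := by
  rcases hP with ⟨hid, hcard⟩ | ⟨hrot, k, hk, hcard⟩
  · have hper : P ⊆ Function.periodicPts (Lam.sigma d) := by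
      obtain ⟨-, n, hn, -, hfix, -⟩ := hid
      exact fun x hx => ⟨n, hn, hfix x hx⟩
    obtain ⟨u, g, h⟩ := hS.exists_chainFrame hper hd hcard.ge
    obtain ⟨n, R⟩ := Lam.exists_returnFrame h hid hcard fun i hi => hS.v_mem hd hi
    refine ⟨_, _, ⟨R.isCanonicalMAC h hS, R.isMarkedBy h hS hid⟩, rfl,
      (R.reduction_eq h hS hcard).symm, fun M' L' hL hM => ?_⟩
    obtain rfl := R.eq_of_isMarkedBy h hS hid hM
    exact ⟨rfl, (R.macFrame h hS).eq_of_isCanonicalMAC hL⟩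
  · obtain ⟨t, p, R, hp⟩ := Lam.exists_rotFrame hd hrot hk hcard hS.isLongestChain.consecutive
    -- Since the period is at least `2`, there are at least `2 * (d - 1) ≥ d` vertices, so the chain
    -- is not the whole boundary traversed from `v 0` back to `v 0`.
    have hle : d ≤ P.ncard := by
      have : 2 * (d - 1) ≤ k * (d - 1) := Nat.mul_le_mul_right _ R.two_le_period
      omega
    obtain ⟨u, g, h⟩ := hS.exists_chainFrame (fun x hx => R.periodic hx) hd hle
    rw [← hp] at h ⊢
    refine ⟨_, _, ⟨R.isCanonicalMAC h, R.isMarkedBy h hrot⟩, rfl,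
      (R.reduction_eq h hS).symm, fun M' L' hL hM => ?_⟩
    obtain rfl := R.eq_of_isMACLeaf h hL.isMACLeaf (hM.2 hrot).1
    exact ⟨rfl, (R.macFrame h).eq_of_isCanonicalMAC hL⟩
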